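/- **Setting.** Write $PL_2^+(\mathbb R)$ for the group of orientation-preserving homeomorphisms of $\mathbb R$ that map the set $\mathbb Z[\frac12]$ onto itself and are piecewise linear with slopes powers of $2$ and with a closed discrete (possibly infinite) set of breakpoints contained in $\mathbb Z[\frac12]$. Maps act on the right, so the word $uv$ means: first $u$, then $v$. Let $F_x\le PL_2^+(\mathbb R)$ be Thompson's group $F$ acting on the line, that is, the subgroup of those $f$ for which there are integers $k,l$ with $f(t)=t+k$ for all sufficiently large $t$ and $f(t)=t+l$ for all sufficiently small $t$. Let $\mathrm{Aut}^+F$ be the group of those elements of $PL_2^+(\mathbb R)$ that conjugate $F_x$ onto itself; here $F_x$ is the copy of $F$ given by inner automorphisms. Thompson's group $T$ is the group of homeomorphisms of $\mathbb R/\mathbb Z$ that lift to elements of $PL_2^+(\mathbb R)$, and $F\le T$ is the stabilizer of $0$. Every $g\in\mathrm{Aut}^+F$ satisfies $g(t+1)=g(t)+1$ for $|t|$ large, so it induces an element of $T$ at $-\infty$ and one at $+\infty$; this defines $\pi:\mathrm{Aut}^+F\to T\times T$. Let $C=\pi^{-1}(\{(h,h): h\in F\})$. Let $F_w$ be the group of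 all $f\in PL_2^+(\mathbb R)$ with $f(0)=0$ and $f(t+1)=f(t)+1$ for all $t$, that is, one and the same element of $F$, as a map of $[0,1]$, repeated in every box $[k,k+1]^2$; restriction to $[0,1]$ identifies $F_w$ with $F$. Let $x_0(t)=t+1$, and let $x_1$ be $t\mapsto t$ on $(-\infty,0]$, $t\mapsto 2t$ on $[0,1]$, $t\mapsto t+1$ on $[1,\infty)$. Let $u_0$ map $[0,\frac14],[\frac14,\frac12],[\frac12,1]$ affinely onto $[0,\frac12],[\frac12,\frac34],[\frac34,1]$, let $u_1$ be the identity on $[0,\frac12]$ and $u_1(t)=\frac12+\frac12u_0(2t-1)$ on $[\frac12,1]$, and let $w_0,w_1\in F_w$ be the periodic extensions of $u_0,u_1$. Word lengths $|\cdot|_{F_x},|\cdot|_{F_w},|\cdot|_C$ are taken with respect to $\{x_0,x_1\}$, $\{w_0,w_1\}$, $\{x_0,x_1,w_0,w_1\}$. Elements of $F_w$ (as maps of $[0,1]$) and of $F_x$ (as maps of the line, where the root of a tree stands for $\mathbb R$ and is divided at $0$, the right-hand vertices $[n,\infty)$ are divided at $n+1$, the left-hand vertices $(-\infty,-n]$ are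 divided at $-n-1$, and bounded intervals are halved) are represented by pairs of finite binary trees; a caret is an internal node with its two edges. The pair is reduced if there is no $i$ such that in both trees the $i$-th and $(i+1)$-st leaves are the two leaves of one caret. Let $N(f)$ be the number of carets of either tree of the reduced diagram of $f$. For $g\in C$ let $\sigma\pi(g)\in F_w$ be the periodic map that induces the same elements of $T$ as $g$ at both ends, and let $d_g=(\sigma\pi(g))^{-1}g$. Let $a(g)=N(\sigma\pi(g))$, $b(g)=N(d_g)$, and let $c(g)$ be the total number of carets on the left and right sides, not counting the roots, of the two trees of the reduced diagram of $d_g$. For a finitely generated subgroup $H$ of a finitely generated group $G$ put $\delta(n)=\max\{|x|_H: x\in H,\ |x|_G\le n\}$. The subgroup $H$ is (exactly) *quadratically distorted* if $\delta(n)=\Theta(n^2)$ as $n\to\infty$, and *undistorted* if $\delta(n)=O(n)$, for all choices of finite generating sets. **Theorem.** 1. $F_x$ is normal in $C$, $F_x\cap F_w=1$ and $F_xF_w=C$, so $C=F_x\rtimes F_w$. The groups $F_x$, $F_w$, $C$ are generated by $\{x_0,x_1\}$, $\{w_0,w_1\}$, $\{x_0,x_1,w_0,w_1\}$. Every element of $F_x$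 and every element of $F_w$ has exactly one reduced diagram, and for every $g\in C$ one has $\sigma\pi(g)\in F_w$ and $d_g\in F_x$. 2. $F_x$ is exactly quadratically distorted in $C$, and $F_w$ is undistorted in $C$. 3. There is $K>0$ such that $a(g)+\sqrt{b(g)}+c(g)\le K|g|_C$ for all $g\in C$. 4. There is $K>0$ such that $|x|_{F_x}\le K|x|_C^2$ for all $x\in F_x$, and there is $K>0$ such that $|w|_{F_w}\le K|w|_C$ for all $w\in F_w$. 5. There is $K>0$ such that for every $n\ge 0$ the element $r_n=w_0^{-n}x_1^nw_0^n$ lies in $F_x$ and satisfies $|r_n|_C\le 3n$, $\frac1K n^2\le N(r_n)\le Kn^2$ and $n^2\le K|r_n|_{F_x}$. -/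

import Mathlib

open Filter

namespace ThompsonAut

/-! ## Piecewise-linear homeomorphisms of the line -/

/-- The dyadic rationals, as a subset of `ℝ`. -/
def dyadics : Set ℝ := {x | ∃ (m : ℤ) (k : ℕ), x = (m : ℝ) / 2 ^ k}

/-- `f` is affine on every interval that misses `B`, with slope a power of two. -/
def IsAffineOff (f : ℝ → ℝ) (B : Set ℝ) : Prop :=
  ∀ a b : ℝ, a < b → Disjoint (Set.Ioo a b) B →
    ∃ k : ℤ, ∀ s ∈ Set.Icc a b, ∀ t ∈ Set.Icc a b, f t - f s = (2 : ℝ) ^ k * (t - s)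

/-- The condition defining the orientation-preserving dyadic piecewise-linear homeomorphisms of
the line: the dyadic rationals are preserved, and there is a closed discrete (that is, locally
finite) set of dyadic breakpoints off which the map is affine with slopes powers of two. -/
def IsPL2 (f : ℝ ≃o ℝ) : Prop :=
  (∀ x, f x ∈ dyadics ↔ x ∈ dyadics) ∧
  ∃ B : Set ℝ, B ⊆ dyadics ∧ (∀ a b : ℝ, (B ∩ Set.Icc a b).Finite) ∧ IsAffineOff f B

theorem isPL2_one : IsPL2 1 := by
  refine ⟨fun x => Iff.rfl, ∅, by simp, by simp, fun a b _ _ => ⟨0, fun s _ t _ => ?_⟩⟩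
  simp

theorem isPL2_mul {f g : ℝ ≃o ℝ} (hf : IsPL2 f) (hg : IsPL2 g) : IsPL2 (f * g) := by
  obtain ⟨hf1, B, hB, hBf, hfa⟩ := hf
  obtain ⟨hg1, D, hD, hDf, hga⟩ := hg
  refine ⟨fun x => (hf1 (g x)).trans (hg1 x), D ∪ g ⁻¹' B, ?_, ?_, ?_⟩
  · rintro x (hx | hx)
    · exact hD hx
    · exact (hg1 x).1 (hB hx)
  · intro a b
    rw [Set.union_inter_distrib_right]
    refine (hDf a b).union ?_
    refine ((hBf (g a) (g b)).preimage g.injective.injOn).subset ?_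
    rintro x ⟨hx, h1, h2⟩
    exact ⟨hx, g.monotone h1, g.monotone h2⟩
  · intro a b hab hdis
    rw [Set.disjoint_union_right] at hdis
    obtain ⟨k, hk⟩ := hga a b hab hdis.1
    have hdis2 : Disjoint (Set.Ioo (g a) (g b)) B := by
      rw [Set.disjoint_left]
      rintro y ⟨h1, h2⟩ hy
      have h3 : g.symm y ∈ Set.Ioo a b :=
        ⟨(OrderIso.lt_symm_apply g).2 h1, (OrderIso.symm_apply_lt g).2 h2⟩
      exact Set.disjoint_left.1 hdis.2 h3 (by simpa using hy)
    obtain ⟨l, hl⟩ := hfa (g a) (g b) (g.strictMono hab) hdis2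
    refine ⟨l + k, fun s hs t ht => ?_⟩
    have h1 := hl (g s) ⟨g.monotone hs.1, g.monotone hs.2⟩ (g t)
      ⟨g.monotone ht.1, g.monotone ht.2⟩
    have h2 := hk s hs t ht
    change f (g t) - f (g s) = _
    rw [h1, h2, zpow_add₀ two_ne_zero, mul_assoc]

theorem isPL2_inv {f : ℝ ≃o ℝ} (hf : IsPL2 f) : IsPL2 f⁻¹ := by
  obtain ⟨hf1, B, hB, hBf, hfa⟩ := hf
  have happ : ∀ x, f (f⁻¹ x) = x := fun x => f.apply_symm_apply x
  have happ' : ∀ x, f⁻¹ (f x) = x := fun x => f.symm_apply_apply x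
  refine ⟨fun x => ?_, f '' B, ?_, ?_, ?_⟩
  · rw [← hf1 (f⁻¹ x), happ]
  · rintro _ ⟨x, hx, rfl⟩
    exact (hf1 x).2 (hB hx)
  · intro a b
    refine ((hBf (f⁻¹ a) (f⁻¹ b)).image f).subset ?_
    rintro _ ⟨⟨x, hx, rfl⟩, h1, h2⟩
    refine ⟨x, ⟨hx, ?_, ?_⟩, rfl⟩
    · rw [← f.le_iff_le, happ]; exact h1
    · rw [← f.le_iff_le, happ]; exact h2
  · intro a b hab hdis
    have hdis2 : Disjoint (Set.Ioo (f⁻¹ a) (f⁻¹ b)) B := by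
      rw [Set.disjoint_left]
      rintro y ⟨h1, h2⟩ hy
      rw [← f.lt_iff_lt, happ] at h1 h2
      have h3 : f y ∈ Set.Ioo a b := ⟨h1, h2⟩
      exact Set.disjoint_left.1 hdis h3 ⟨y, hy, rfl⟩
    obtain ⟨k, hk⟩ := hfa _ _ ((f⁻¹).strictMono hab) hdis2
    refine ⟨-k, fun s hs t ht => ?_⟩
    have h1 := hk (f⁻¹ s) ⟨(f⁻¹).monotone hs.1, (f⁻¹).monotone hs.2⟩ (f⁻¹ t)
      ⟨(f⁻¹).monotone ht.1, (f⁻¹).monotone ht.2⟩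
    rw [happ, happ] at h1
    rw [h1, ← mul_assoc, ← zpow_add₀ two_ne_zero]
    simp

/-- `PL₂⁺(ℝ)`. The product is composition: `(f * g) x = f (g x)`. -/
def PL2Plus : Subgroup (ℝ ≃o ℝ) where
  carrier := {f | IsPL2 f}
  one_mem' := isPL2_one
  mul_mem' := isPL2_mul
  inv_mem' := isPL2_inv

/-- Thompson's group `F` acting on the line (the subgroup `F_x`): the elements of `PL₂⁺(ℝ)`
that are translations by integers near `+∞` and near `-∞`. -/
def Fx : Subgroup (ℝ ≃o ℝ) where
  carrier := {f | f ∈ PL2Plus ∧ (∃ k : ℤ, ∀ᶠ x in atTop, f x = x + k) ∧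
    ∃ l : ℤ, ∀ᶠ x in atBot, f x = x + l}
  one_mem' := ⟨one_mem _, ⟨0, by simp⟩, ⟨0, by simp⟩⟩
  mul_mem' := by
    rintro f g ⟨hf, ⟨k, hk⟩, ⟨l, hl⟩⟩ ⟨hg, ⟨k', hk'⟩, ⟨l', hl'⟩⟩
    refine ⟨mul_mem hf hg, ⟨k + k', ?_⟩, ⟨l + l', ?_⟩⟩
    · filter_upwards [hk', g.tendsto_atTop.eventually hk] with x h1 h2
      change f (g x) = _
      rw [h2, h1]; push_cast; ring
    · filter_upwards [hl', g.tendsto_atBot.eventually hl] with x h1 h2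
      change f (g x) = _
      rw [h2, h1]; push_cast; ring
  inv_mem' := by
    rintro f ⟨hf, ⟨k, hk⟩, ⟨l, hl⟩⟩
    have happ : ∀ x, f (f⁻¹ x) = x := fun x => f.apply_symm_apply x
    refine ⟨inv_mem hf, ⟨-k, ?_⟩, ⟨-l, ?_⟩⟩
    · filter_upwards [(f⁻¹).tendsto_atTop.eventually hk] with x h
      rw [happ] at h
      push_cast; linarith
    · filter_upwards [(f⁻¹).tendsto_atBot.eventually hl] with x h
      rw [happ] at h
      push_cast; linarith

/-- `Aut⁺F`: the elements of `PL₂⁺(ℝ)` that conjugate `F` onto itself. -/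
def AutPlusF : Subgroup (ℝ ≃o ℝ) := PL2Plus ⊓ Subgroup.normalizer (Fx : Set (ℝ ≃o ℝ))

/-! ## Thompson's group `T` on the circle, and the germs at the two ends -/

/-- The homeomorphism `f` of the line lifts the homeomorphism `τ` of the circle `ℝ/ℤ`. -/
def Lifts (f : ℝ ≃o ℝ) (τ : UnitAddCircle ≃ₜ UnitAddCircle) : Prop :=
  ∀ x : ℝ, τ (x : UnitAddCircle) = (f x : UnitAddCircle)

/-- Thompson's group `T`: the homeomorphisms of the circle `ℝ/ℤ` that lift to `PL₂⁺(ℝ)`. -/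
def T : Subgroup (UnitAddCircle ≃ₜ UnitAddCircle) where
  carrier := {τ | ∃ f ∈ PL2Plus, Lifts f τ}
  one_mem' := ⟨1, one_mem _, fun _ => rfl⟩
  mul_mem' := by
    rintro σ τ ⟨f, hf, hfσ⟩ ⟨g, hg, hgτ⟩
    refine ⟨f * g, mul_mem hf hg, fun x => ?_⟩
    change σ (τ x) = ((f (g x) : ℝ) : UnitAddCircle)
    rw [hgτ, hfσ]
  inv_mem' := by
    rintro τ ⟨f, hf, h⟩
    refine ⟨f⁻¹, inv_mem hf, fun x => ?_⟩
    have happ : f (f⁻¹ x) = x := f.apply_symm_apply x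
    have h2 := h (f⁻¹ x)
    rw [happ] at h2
    change τ.symm x = _
    rw [← h2, Homeomorph.symm_apply_apply]

/-- Thompson's group `F` as the subgroup of `T` fixing the base point: maps of the unit interval
with its endpoints identified. -/
def FT : Subgroup (UnitAddCircle ≃ₜ UnitAddCircle) where
  carrier := {τ | τ ∈ T ∧ τ 0 = 0}
  one_mem' := ⟨one_mem _, rfl⟩
  mul_mem' := by
    rintro σ τ ⟨hσ, h1⟩ ⟨hτ, h2⟩
    refine ⟨mul_mem hσ hτ, ?_⟩
    change σ (τ 0) = 0
    rw [h2, h1]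
  inv_mem' := by
    rintro τ ⟨hτ, h⟩
    refine ⟨inv_mem hτ, ?_⟩
    change τ.symm 0 = 0
    rw [Homeomorph.symm_apply_eq, h]

/-- Along the end `l` of the line (`atTop` or `atBot`), `g` induces the circle map `τ`. For
`g ∈ Aut⁺F`, the pair of circle maps induced at `-∞` and at `+∞` is the image of `g` under the
projection `π : Aut⁺F → T × T`. -/
def HasGerm (l : Filter ℝ) (g : ℝ ≃o ℝ) (τ : UnitAddCircle ≃ₜ UnitAddCircle) : Prop :=
  ∀ᶠ x in l, τ ((x : ℝ) : UnitAddCircle) = ((g x : ℝ) : UnitAddCircle)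

theorem HasGerm.mul {l : Filter ℝ} {f g : ℝ ≃o ℝ} {σ τ : UnitAddCircle ≃ₜ UnitAddCircle}
    (hl : Tendsto g l l) (hf : HasGerm l f σ) (hg : HasGerm l g τ) :
    HasGerm l (f * g) (σ * τ) := by
  filter_upwards [hg, hl.eventually hf] with x h1 h2
  change σ (τ x) = ((f (g x) : ℝ) : UnitAddCircle)
  rw [h1, h2]

theorem HasGerm.inv {l : Filter ℝ} {f : ℝ ≃o ℝ} {τ : UnitAddCircle ≃ₜ UnitAddCircle}
    (hl : Tendsto (f⁻¹ : ℝ ≃o ℝ) l l) (hf : HasGerm l f τ) : HasGerm l f⁻¹ τ⁻¹ := by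
  filter_upwards [hl.eventually hf] with x h
  have happ : f (f⁻¹ x) = x := f.apply_symm_apply x
  rw [happ] at h
  change τ.symm x = _
  rw [← h, Homeomorph.symm_apply_apply]

/-- `C = π⁻¹(D)`, where `D ⊆ T × T` is the diagonal copy of `F`. -/
def C : Subgroup (ℝ ≃o ℝ) where
  carrier := {g | g ∈ AutPlusF ∧ ∃ τ ∈ FT, HasGerm atBot g τ ∧ HasGerm atTop g τ}
  one_mem' := ⟨one_mem _, 1, one_mem _, Eventually.of_forall fun _ => rfl,
    Eventually.of_forall fun _ => rfl⟩
  mul_mem' := by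
    rintro f g ⟨hf, σ, hσ, h1, h2⟩ ⟨hg, τ, hτ, h3, h4⟩
    exact ⟨mul_mem hf hg, σ * τ, mul_mem hσ hτ, h1.mul g.tendsto_atBot h3,
      h2.mul g.tendsto_atTop h4⟩
  inv_mem' := by
    rintro f ⟨hf, τ, hτ, h1, h2⟩
    exact ⟨inv_mem hf, τ⁻¹, inv_mem hτ, h1.inv (f⁻¹).tendsto_atBot, h2.inv (f⁻¹).tendsto_atTop⟩

/-- The periodic copy `F_w` of `F`: one and the same homeomorphism of the unit interval is
repeated in every box `[k, k+1] × [k, k+1]`. -/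
def Fw : Subgroup (ℝ ≃o ℝ) where
  carrier := {f | f ∈ PL2Plus ∧ f 0 = 0 ∧ ∀ x, f (x + 1) = f x + 1}
  one_mem' := ⟨one_mem _, rfl, fun _ => rfl⟩
  mul_mem' := by
    rintro f g ⟨hf, hf0, hf1⟩ ⟨hg, hg0, hg1⟩
    refine ⟨mul_mem hf hg, ?_, fun x => ?_⟩
    · change f (g 0) = 0
      rw [hg0, hf0]
    · change f (g (x + 1)) = f (g x) + 1
      rw [hg1, hf1]
  inv_mem' := by
    rintro f ⟨hf, hf0, hf1⟩
    refine ⟨inv_mem hf, ?_, fun x => ?_⟩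
    · change f.symm 0 = 0
      rw [OrderIso.symm_apply_eq, hf0]
    · change f.symm (x + 1) = f.symm x + 1
      rw [OrderIso.symm_apply_eq, hf1, OrderIso.apply_symm_apply]

/-! ## The generators -/

/-- The translation `t ↦ t + 1`. -/
noncomputable def x0 : ℝ ≃o ℝ := OrderIso.addRight 1

/-- The second generator of `F_x` as a function: the identity on `(-∞, 0]`, `t ↦ 2t` on `[0, 1]`,
and `t ↦ t + 1` on `[1, ∞)`. -/
noncomputable def x1Fun (t : ℝ) : ℝ := if t ≤ 0 then t else if t ≤ 1 then 2 * t else t + 1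

/-- The inverse function of `x1Fun`. -/
noncomputable def x1Inv (t : ℝ) : ℝ := if t ≤ 0 then t else if t ≤ 2 then t / 2 else t - 1

theorem x1Fun_strictMono : StrictMono x1Fun := by
  intro a b h
  unfold x1Fun
  split_ifs <;> linarith

theorem x1_rightInverse : Function.RightInverse x1Inv x1Fun := by
  intro t
  unfold x1Fun x1Inv
  split_ifs <;> linarith

/-- The second generator of `F_x`. -/
noncomputable def x1 : ℝ ≃o ℝ :=
  x1Fun_strictMono.orderIsoOfRightInverse x1Fun x1Inv x1_rightInverse

/-- The first standard generator of `F` on the unit interval: it sends `[0,1/4]`, `[1/4,1/2]`,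
`[1/2,1]` affinely onto `[0,1/2]`, `[1/2,3/4]`, `[3/4,1]`. -/
noncomputable def u0 (t : ℝ) : ℝ :=
  if t ≤ 1 / 4 then 2 * t else if t ≤ 1 / 2 then t + 1 / 4 else t / 2 + 1 / 2

/-- The inverse of `u0`. -/
noncomputable def u0Inv (t : ℝ) : ℝ :=
  if t ≤ 1 / 2 then t / 2 else if t ≤ 3 / 4 then t - 1 / 4 else 2 * t - 1

/-- The second standard generator of `F` on the unit interval: the identity on `[0,1/2]` and a
half-size copy of `u0` on `[1/2,1]`. -/
noncomputable def u1 (t : ℝ) : ℝ := if t ≤ 1 / 2 then t else 1 / 2 + u0 (2 * t - 1) / 2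

/-- The inverse of `u1`. -/
noncomputable def u1Inv (t : ℝ) : ℝ := if t ≤ 1 / 2 then t else 1 / 2 + u0Inv (2 * t - 1) / 2

/-- The periodic extension of a map of the unit interval: a copy of it in every box
`[k, k+1] × [k, k+1]`. -/
noncomputable def periodicExt (a : ℝ → ℝ) (t : ℝ) : ℝ := ⌊t⌋ + a (Int.fract t)

theorem periodicExt_strictMono {a : ℝ → ℝ} (ha : StrictMono a) (h0 : a 0 = 0) (h1 : a 1 = 1) :
    StrictMono (periodicExt a) := by
  intro x y hxy
  unfold periodicExt
  rcases (Int.floor_mono hxy.le).eq_or_lt with h | h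
  · rw [h]
    have : Int.fract x < Int.fract y := by
      unfold Int.fract
      rw [h]; linarith
    have := ha this
    linarith
  · have h2 : ((⌊x⌋ : ℤ) : ℝ) + 1 ≤ ⌊y⌋ := by exact_mod_cast h
    have h3 : a (Int.fract x) < 1 := h1 ▸ ha (Int.fract_lt_one x)
    have h4 : 0 ≤ a (Int.fract y) := h0 ▸ ha.monotone (Int.fract_nonneg y)
    linarith

theorem periodicExt_rightInverse {a b : ℝ → ℝ} (hb : StrictMono b) (h0 : b 0 = 0) (h1 : b 1 = 1)
    (hab : Function.RightInverse b a) :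
    Function.RightInverse (periodicExt b) (periodicExt a) := by
  intro t
  have h3 : b (Int.fract t) < 1 := h1 ▸ hb (Int.fract_lt_one t)
  have h4 : 0 ≤ b (Int.fract t) := h0 ▸ hb.monotone (Int.fract_nonneg t)
  have hf : ⌊periodicExt b t⌋ = ⌊t⌋ := by
    unfold periodicExt
    rw [Int.floor_eq_iff]
    constructor <;> linarith
  have hfr : Int.fract (periodicExt b t) = b (Int.fract t) := by
    rw [Int.fract, hf]
    unfold periodicExt
    ring
  rw [periodicExt, hf, hfr, hab]
  exact Int.floor_add_fract t

theorem u0_strictMono : StrictMono u0 := by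
  intro a b h
  unfold u0
  split_ifs <;> linarith

theorem u0Inv_strictMono : StrictMono u0Inv := by
  intro a b h
  unfold u0Inv
  split_ifs <;> linarith

theorem u0_rightInverse : Function.RightInverse u0Inv u0 := by
  intro t
  unfold u0 u0Inv
  split_ifs <;> linarith

theorem u1_strictMono : StrictMono u1 := by
  intro a b h
  have h0 : u0 0 = 0 := by norm_num [u0]
  unfold u1
  split_ifs with h1 h2 h2
  · exact h
  · have := u0_strictMono (show (0 : ℝ) < 2 * b - 1 by linarith)
    linarith
  · linarith
  · have := u0_strictMono (show 2 * a - 1 < 2 * b - 1 by linarith)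
    linarith

theorem u1Inv_strictMono : StrictMono u1Inv := by
  intro a b h
  have h0 : u0Inv 0 = 0 := by norm_num [u0Inv]
  unfold u1Inv
  split_ifs with h1 h2 h2
  · exact h
  · have := u0Inv_strictMono (show (0 : ℝ) < 2 * b - 1 by linarith)
    linarith
  · linarith
  · have := u0Inv_strictMono (show 2 * a - 1 < 2 * b - 1 by linarith)
    linarith

theorem u1_rightInverse : Function.RightInverse u1Inv u1 := by
  intro t
  have h0 : u0Inv 0 = 0 := by norm_num [u0Inv]
  by_cases h : t ≤ 1 / 2
  · simp only [u1Inv, if_pos h, u1]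
  · have h1 := u0Inv_strictMono (show (0 : ℝ) < 2 * t - 1 by linarith)
    have h2 : ¬ (1 / 2 + u0Inv (2 * t - 1) / 2 ≤ 1 / 2) := by linarith
    simp only [u1Inv, if_neg h, u1, if_neg h2]
    have h3 : 2 * (1 / 2 + u0Inv (2 * t - 1) / 2) - 1 = u0Inv (2 * t - 1) := by ring
    rw [h3, u0_rightInverse]
    ring

/-- The first generator of `F_w`: the periodic extension of `u0`. -/
noncomputable def w0 : ℝ ≃o ℝ :=
  (periodicExt_strictMono u0_strictMono (by norm_num [u0]) (by norm_num [u0])).orderIsoOfRightInverse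
    (periodicExt u0) (periodicExt u0Inv)
    (periodicExt_rightInverse u0Inv_strictMono (by norm_num [u0Inv]) (by norm_num [u0Inv])
      u0_rightInverse)

/-- The second generator of `F_w`: the periodic extension of `u1`. -/
noncomputable def w1 : ℝ ≃o ℝ :=
  (periodicExt_strictMono u1_strictMono (by norm_num [u1, u0])
    (by norm_num [u1, u0])).orderIsoOfRightInverse
    (periodicExt u1) (periodicExt u1Inv)
    (periodicExt_rightInverse u1Inv_strictMono (by norm_num [u1Inv, u0Inv])
      (by norm_num [u1Inv, u0Inv]) u1_rightInverse)

/-! ## Word length and distortion -/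

/-- The word length of `g` with respect to `S`: the least length of a product of elements of `S`
and their inverses that is equal to `g`. -/
noncomputable def wordLength {G : Type*} [Group G] (S : Set G) (g : G) : ℕ :=
  sInf {n | ∃ l : List G, l.length = n ∧ (∀ s ∈ l, s ∈ S ∨ s⁻¹ ∈ S) ∧ l.prod = g}

/-- The distortion function `n ↦ max {|x|_H : x ∈ H, |x|_G ≤ n}`, where lengths in `H` are taken
with respect to `SH` and lengths in the ambient group with respect to `SG`. -/
noncomputable def distortion {G : Type*} [Group G] (H : Subgroup G) (SH SG : Set G) (n : ℕ) : ℕ :=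
  sSup {m | ∃ x ∈ H, wordLength SG x ≤ n ∧ wordLength SH x = m}

/-- The finitely generated subgroup `H` of the finitely generated group `G` (both inside `Γ`) is
exactly quadratically distorted: for all finite generating sets, the distortion function grows
like `n²`. -/
def IsQuadraticallyDistorted {Γ : Type*} [Group Γ] (H G : Subgroup Γ) : Prop :=
  H ≤ G ∧ H.FG ∧ G.FG ∧ ∀ SH SG : Set Γ, SH.Finite → SG.Finite →
    Subgroup.closure SH = H → Subgroup.closure SG = G →
      (fun n : ℕ => (distortion H SH SG n : ℝ)) =Θ[atTop] fun n : ℕ => (n : ℝ) ^ 2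

/-- The finitely generated subgroup `H` of the finitely generated group `G` (both inside `Γ`) is
undistorted: for all finite generating sets, the distortion function is at most linear. -/
def IsUndistorted {Γ : Type*} [Group Γ] (H G : Subgroup Γ) : Prop :=
  H ≤ G ∧ H.FG ∧ G.FG ∧ ∀ SH SG : Set Γ, SH.Finite → SG.Finite →
    Subgroup.closure SH = H → Subgroup.closure SG = G →
      (fun n : ℕ => (distortion H SH SG n : ℝ)) =O[atTop] fun n : ℕ => (n : ℝ)

/-! ## Tree diagrams -/

/-- The interval `[a, b]` is cut into halves repeatedly; a vertex of the infinite binary tree is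
the list of left (`false`) and right (`true`) turns leading to it from the root. -/
def halvesCell (a b : ℝ) : List Bool → Set ℝ
  | [] => Set.Icc a b
  | false :: u => halvesCell a ((a + b) / 2) u
  | true :: u => halvesCell ((a + b) / 2) b u

/-- The subinterval of `[0, 1]` attached to a vertex of the infinite binary tree. -/
def unitCell : List Bool → Set ℝ := halvesCell 0 1

/-- Subdivision of `[n, ∞)`: it is cut into `[n, n+1]` and `[n+1, ∞)`. -/
def rightCell (n : ℝ) : List Bool → Set ℝ
  | [] => Set.Ici n
  | false :: u => halvesCell n (n + 1) u
  | true :: u => rightCell (n + 1) u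

/-- Subdivision of `(-∞, n]`: it is cut into `(-∞, n-1]` and `[n-1, n]`. -/
def leftCell (n : ℝ) : List Bool → Set ℝ
  | [] => Set.Iic n
  | false :: u => leftCell (n - 1) u
  | true :: u => halvesCell (n - 1) n u

/-- The subinterval of the line attached to a vertex of the infinite binary tree. The root is cut
at `0`, and the vertices along the left and right sides of the tree are half-lines ending at
integers; this is `unitCell` transported by the standard identification of `(0, 1)` with `ℝ`. -/
def lineCell : List Bool → Set ℝ
  | [] => Set.univ
  | false :: u => leftCell 0 u
  | true :: u => rightCell 0 u

/-- The leaves of a finite binary tree, from left to right. The nodes of the tree are the carets,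
so that `numNodes` counts carets. -/
def leaves : BinaryTree Unit → List (List Bool)
  | .nil => [[]]
  | .node _ l r => (leaves l).map (List.cons false) ++ (leaves r).map (List.cons true)

/-- The pair of finite binary trees `(P, Q)` is a diagram of `f` with respect to the subdivision
`cell`: the trees have the same number of leaves, and `f` maps the cell of the `i`-th leaf of `P`
to the cell of the `i`-th leaf of `Q`, linearly, that is, matching all their iterated
subdivisions. -/
def IsDiagram (cell : List Bool → Set ℝ) (f : ℝ ≃o ℝ) (P Q : BinaryTree Unit) : Prop :=
  List.Forall₂ (fun u v => ∀ w, f '' cell (u ++ w) = cell (v ++ w)) (leaves P) (leaves Q)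

/-- The pair `(P, Q)` is reduced: no caret of `P` whose two leaves are the leaves `i` and `i + 1`
faces a caret of `Q` whose two leaves are the leaves `i` and `i + 1`. -/
def IsReducedPair (P Q : BinaryTree Unit) : Prop :=
  ¬ ∃ (i : ℕ) (u v : List Bool),
    (leaves P)[i]? = some (u ++ [false]) ∧ (leaves P)[i + 1]? = some (u ++ [true]) ∧
    (leaves Q)[i]? = some (v ++ [false]) ∧ (leaves Q)[i + 1]? = some (v ++ [true])

/-- `p` is a reduced tree diagram of `f`. -/
def IsReducedDiagram (cell : List Bool → Set ℝ) (f : ℝ ≃o ℝ)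
    (p : BinaryTree Unit × BinaryTree Unit) : Prop :=
  IsDiagram cell f p.1 p.2 ∧ IsReducedPair p.1 p.2

/-- The reduced tree diagram of `f`. -/
noncomputable def reducedDiagram (cell : List Bool → Set ℝ) (f : ℝ ≃o ℝ) :
    BinaryTree Unit × BinaryTree Unit :=
  Classical.epsilon (IsReducedDiagram cell f)

/-- The number of carets (of each of the two trees) of the reduced diagram of `f`. -/
noncomputable def carets (cell : List Bool → Set ℝ) (f : ℝ ≃o ℝ) : ℕ :=
  (reducedDiagram cell f).1.numNodes

/-- The number of carets on the left side of a tree, root included. -/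
def leftSide : BinaryTree Unit → ℕ
  | .nil => 0
  | .node _ l _ => leftSide l + 1

/-- The number of carets on the right side of a tree, root included. -/
def rightSide : BinaryTree Unit → ℕ
  | .nil => 0
  | .node _ _ r => rightSide r + 1

/-- The number of left and right carets of a tree, not counting the root. -/
def sideCarets : BinaryTree Unit → ℕ
  | .nil => 0
  | .node _ l r => leftSide l + rightSide r

/-! ## Periodic part and debris of an element of `C` -/

/-- For `g ∈ C`, the element `σ(π(g))` of `F_w`: the periodic map inducing the same circle map
as `g` does near `-∞` and near `+∞`. -/
noncomputable def periodicPart (g : ℝ ≃o ℝ) : ℝ ≃o ℝ :=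
  Classical.epsilon fun h => h ∈ Fw ∧ ∃ τ, Lifts h τ ∧ HasGerm atBot g τ ∧ HasGerm atTop g τ

/-- The debris of `g`: first `σ(π(g))⁻¹` is applied, then `g`. -/
noncomputable def debris (g : ℝ ≃o ℝ) : ℝ ≃o ℝ := g * (periodicPart g)⁻¹

/-- `a(g)`: the number of carets of the periodic part, as a map of the unit interval. -/
noncomputable def aNum (g : ℝ ≃o ℝ) : ℕ := carets unitCell (periodicPart g)

/-- `b(g)`: the number of carets of the debris. -/
noncomputable def bNum (g : ℝ ≃o ℝ) : ℕ := carets lineCell (debris g)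

/-- `c(g)`: the number of left and right carets, roots not counted, in both trees of the reduced
diagram of the debris. -/
noncomputable def cNum (g : ℝ ≃o ℝ) : ℕ :=
  sideCarets (reducedDiagram lineCell (debris g)).1 +
    sideCarets (reducedDiagram lineCell (debris g)).2

/-- Word length in `C`. -/
noncomputable def lenC : (ℝ ≃o ℝ) → ℕ := wordLength {x0, x1, w0, w1}

/-- Word length in `F_x`. -/
noncomputable def lenFx : (ℝ ≃o ℝ) → ℕ := wordLength {x0, x1}

/-- Word length in `F_w`. -/
noncomputable def lenFw : (ℝ ≃o ℝ) → ℕ := wordLength {w0, w1}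

/-- The homeomorphism given by the word `w₀⁻ⁿ x₁ⁿ w₀ⁿ`, whose letters act from left to right:
first `w₀⁻ⁿ`, then `x₁ⁿ`, then `w₀ⁿ`. -/
noncomputable def rWord (n : ℕ) : ℝ ≃o ℝ := w0 ^ n * x1 ^ n * (w0 ^ n)⁻¹

end ThompsonAut

/-! Everything is counted through one notion. A vertex $u$ of the infinite binary tree is carried by
$f$ if $f$ maps the cell of $u$ onto a cell, matching all further subdivisions; otherwise it is
uncarried. The uncarried vertices are closed under passing to prefixes, so when they are finite in
number they are the interior vertices of a finite tree. For $f$ and $f^{-1}$ these two trees form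
the unique reduced diagram (`IsReducedDiagram.inner_eq`, `isReducedDiagram_of_inner_eq`). Hence
$N(f)$ is the number of uncarried vertices, and facts about carets become facts about sets of
vertices. For instance $N(fg)\le N(f)+N(g)$, because a vertex not carried by $fg$ is either
uncarried by $g$ or sent by $g$ to a vertex uncarried by $f$. Conversely, expanding both trees of a
diagram to right combs writes an element as a word of length at most $8N$
(`exists_hasWord_isDiagram`). So $N$ and word length in $F_x$ agree up to constant factors.

An element $g\in C$ and its periodic part lift the same circle map near each end, so they differ
there by a constant integer, and the debris lies in $F_x$ (`mul_inv_mem_Fx_of_hasGerm`). Writing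
$g=dp$ with $d\in F_x$, $p\in F_w$, left multiplication by $s\in F_x$ replaces $d$ by $sd$, and by
$s\in F_w$ replaces $(d,p)$ by $(sds^{-1},sp)$. In particular $g\mapsto p$ deletes the letters $x_i$
from a word, so $F_w$ is undistorted.

For the quadratic upper bound the effect of $d\mapsto sds^{-1}$ is needed. A half-line vertex
carried by $d$ is one on which $d$ is an integer translation, and this commutes with $s$. So
conjugation does not increase the number of uncarried side vertices (`sideCount_conj_le`), and it
creates new uncarried vertices only in boxes hanging off uncarried side vertices of $d$ or $d^{-1}$
(`uncarried_conj_ncard_le`). The side counts therefore grow at most linearly along a word, each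
letter adds at most linearly many carets, and the total is quadratic (`exists_lenC_bounds`).

The lower bound comes from $r_n$. The map $x_1^n$ stretches each of the $n$ intervals
$[2^{-i-1},2^{-i}]$, $i<n$, onto a whole unit box, while $w_0^n$ is affine on each such interval.
After pulling back by $w_0^{-n}$, each box contributes $n$ uncarried vertices of $w_0^n$, which
gives $n^2$ carets (`sq_le_ncard_rWord`). -/

namespace ThompsonAut

/-! ## Systems of cells and the vertices carried by a map -/

/-- The properties shared by the two subdivisions `unitCell` and `lineCell`: the cells of the
children of a vertex fill its cell from left to right, and nested cells shrink to points. -/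
structure IsCellSystem (cell : List Bool → Set ℝ) : Prop where
  split : ∀ u, cell u = cell (u ++ [false]) ∪ cell (u ++ [true])
  sep : ∀ u, ∀ x ∈ cell (u ++ [false]), ∀ y ∈ cell (u ++ [true]), x ≤ y
  nontriv : ∀ u, ∃ x ∈ cell u, ∃ y ∈ cell u, x < y
  shrink : ∀ u, ∀ x ∈ cell u, ∀ ε > 0, ∃ w, x ∈ cell (u ++ w) ∧ ∀ y ∈ cell (u ++ w), |y - x| ≤ ε

/-- `f` maps the cell of `u` to the cell of `v` linearly, matching iterated subdivisions. -/
def Carries (cell : List Bool → Set ℝ) (f : ℝ ≃o ℝ) (u v : List Bool) : Prop :=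
  ∀ w, f '' cell (u ++ w) = cell (v ++ w)

/-- The vertices whose cells are not mapped linearly to cells. -/
def uncarried (cell : List Bool → Set ℝ) (f : ℝ ≃o ℝ) : Set (List Bool) :=
  {u | ¬ ∃ v, Carries cell f u v}

/-- The vertex `u` lies strictly to the left of the vertex `v`. -/
def LeftOf (u v : List Bool) : Prop := ∃ c a b, u = c ++ false :: a ∧ v = c ++ true :: b

theorem LeftOf.cons {u v : List Bool} (b : Bool) (h : LeftOf u v) : LeftOf (b :: u) (b :: v) := by
  obtain ⟨c, x, y, rfl, rfl⟩ := h
  exact ⟨b :: c, x, y, rfl, rfl⟩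

theorem prefix_or_leftOf (u v : List Bool) : u <+: v ∨ v <+: u ∨ LeftOf u v ∨ LeftOf v u := by
  induction u generalizing v with
  | nil => simp
  | cons b u ih =>
    cases v with
    | nil => simp
    | cons c v =>
      by_cases hbc : b = c
      · subst hbc
        rcases ih v with h | h | h | h
        · exact .inl (by simpa using h)
        · exact .inr (.inl (by simpa using h))
        · exact .inr (.inr (.inl (h.cons b)))
        · exact .inr (.inr (.inr (h.cons b)))
      · cases b <;> cases c <;> simp at hbc
        · exact .inr (.inr (.inl ⟨[], u, v, rfl, rfl⟩))
        · exact .inr (.inr (.inr ⟨[], v, u, rfl, rfl⟩))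

namespace IsCellSystem

variable {cell : List Bool → Set ℝ} (hc : IsCellSystem cell)
include hc

theorem append_subset (u w : List Bool) : cell (u ++ w) ⊆ cell u := by
  induction w generalizing u with
  | nil => simp
  | cons b w ih =>
    have h1 := ih (u ++ [b])
    rw [List.append_assoc] at h1
    refine h1.trans ?_
    rw [hc.split u]
    cases b
    · exact Set.subset_union_left
    · exact Set.subset_union_right

theorem le_of_leftOf {u v : List Bool} (h : LeftOf u v) :
    ∀ x ∈ cell u, ∀ y ∈ cell v, x ≤ y := by
  obtain ⟨c, a, b, rfl, rfl⟩ := h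
  intro x hx y hy
  refine hc.sep c x (hc.append_subset _ a ?_) y (hc.append_subset _ b ?_)
  · simpa using hx
  · simpa using hy

theorem not_le_of_subset {u v : List Bool} (h : cell u ⊆ cell v) :
    ¬ ∀ x ∈ cell u, ∀ y ∈ cell v, x ≤ y := by
  intro h1
  obtain ⟨x, hx, y, hy, hxy⟩ := hc.nontriv u
  exact absurd (h1 y hy x (h hx)) (not_le.2 hxy)

theorem not_ge_of_subset {u v : List Bool} (h : cell u ⊆ cell v) :
    ¬ ∀ x ∈ cell v, ∀ y ∈ cell u, x ≤ y := by
  intro h1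
  obtain ⟨x, hx, y, hy, hxy⟩ := hc.nontriv u
  exact absurd (h1 y (h hy) x hx) (not_le.2 hxy)

/-- If `u` were a proper prefix of `v`, one child of `u` would fill the whole cell of `u` and hence
contain the cell of its sibling, although siblings are ordered and nondegenerate. Incomparable
vertices are likewise ordered, so neither cell can contain the other. -/
theorem prefix_of_subset {u v : List Bool} (h : cell u ⊆ cell v) : v <+: u := by
  rcases prefix_or_leftOf u v with h1 | h1 | h1 | h1
  · obtain ⟨w, rfl⟩ := h1
    cases w with
    | nil => simp
    | cons b w =>
      exfalso
      have h2 : cell u ⊆ cell (u ++ [b]) := by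
        refine h.trans ?_
        have := hc.append_subset (u ++ [b]) w
        simpa using this
      cases b
      · refine hc.not_ge_of_subset (u := u ++ [true]) ?_ (hc.sep u)
        exact (hc.append_subset _ _).trans h2
      · refine hc.not_le_of_subset (u := u ++ [false]) ?_ (hc.sep u)
        exact (hc.append_subset _ _).trans h2
  · exact h1
  · exact absurd (hc.le_of_leftOf h1) (hc.not_le_of_subset h)
  · exact absurd (hc.le_of_leftOf h1) (hc.not_ge_of_subset h)

theorem injective : Function.Injective cell := by
  intro u v h
  have h1 := hc.prefix_of_subset h.subset
  have h2 := hc.prefix_of_subset h.symm.subset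
  exact h2.eq_of_length (le_antisymm h2.length_le h1.length_le)

end IsCellSystem

/-! ### Composition, inversion and rigidity of carried cells -/

namespace Carries

variable {cell : List Bool → Set ℝ} {f g : ℝ ≃o ℝ} {u v w : List Bool}

theorem image_eq (h : Carries cell f u v) : f '' cell u = cell v := by
  simpa using h []

theorem append (h : Carries cell f u v) (w : List Bool) : Carries cell f (u ++ w) (v ++ w) := by
  intro w'
  rw [List.append_assoc, List.append_assoc]
  exact h _

theorem one (u : List Bool) : Carries cell 1 u u := by
  intro w
  exact Set.image_id _

theorem mul (hf : Carries cell f v w) (hg : Carries cell g u v) : Carries cell (f * g) u w := by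
  intro w'
  have : ⇑(f * g) = f ∘ g := rfl
  rw [this, Set.image_comp, hg, hf]

theorem inv (h : Carries cell f u v) : Carries cell f⁻¹ v u := by
  intro w
  rw [← h w, ← Set.image_comp]
  have : (⇑f⁻¹ ∘ ⇑f) = id := by
    funext x
    exact f.symm_apply_apply x
  rw [this, Set.image_id]

theorem inv_iff : Carries cell f⁻¹ v u ↔ Carries cell f u v :=
  ⟨fun h => by simpa using h.inv, fun h => h.inv⟩

theorem right_unique (hc : IsCellSystem cell) (h1 : Carries cell f u v) (h2 : Carries cell f u w) :
    v = w :=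
  hc.injective (h1.image_eq.symm.trans h2.image_eq)

theorem left_unique (hc : IsCellSystem cell) (h1 : Carries cell f v u) (h2 : Carries cell f w u) :
    v = w :=
  right_unique hc h1.inv h2.inv

/-- This is the cancellation of a pair of facing carets. -/
theorem of_children (hc : IsCellSystem cell) (h0 : Carries cell f (u ++ [false]) (v ++ [false]))
    (h1 : Carries cell f (u ++ [true]) (v ++ [true])) : Carries cell f u v := by
  intro w
  cases w with
  | nil =>
    rw [List.append_nil, List.append_nil, hc.split u, hc.split v, Set.image_union, h0.image_eq,
      h1.image_eq]
  | cons b w =>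
    cases b
    · simpa using h0 w
    · simpa using h1 w

/-- Every descendant cell is mapped onto itself, and such cells shrink to `x`, so `f x` is
arbitrarily close to `x`. -/
theorem apply_eq_self (hc : IsCellSystem cell) (h : Carries cell f u u) {x : ℝ}
    (hx : x ∈ cell u) : f x = x := by
  refine eq_of_forall_dist_le fun ε hε => ?_
  obtain ⟨w, hw, hy⟩ := hc.shrink u x hx ε hε
  rw [Real.dist_eq]
  apply hy
  rw [← h w]
  exact ⟨x, hw, rfl⟩

theorem eqOn (hc : IsCellSystem cell) (hf : Carries cell f u v) (hg : Carries cell g u v) {x : ℝ}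
    (hx : x ∈ cell u) : f x = g x := by
  have h := (hg.inv.mul hf).apply_eq_self hc hx
  change g.symm (f x) = x at h
  rw [← h, OrderIso.apply_symm_apply, h]

theorem le_of_le (hf : Carries cell f u v) {u' v' : List Bool} (hf' : Carries cell f u' v')
    (h : ∀ x ∈ cell u, ∀ y ∈ cell u', x ≤ y) : ∀ x ∈ cell v, ∀ y ∈ cell v', x ≤ y := by
  rw [← hf.image_eq, ← hf'.image_eq]
  rintro _ ⟨x, hx, rfl⟩ _ ⟨y, hy, rfl⟩
  exact f.monotone (h x hx y hy)

end Carries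

/-! ### Counting uncarried vertices of products -/

theorem uncarried_of_append {cell : List Bool → Set ℝ} {f : ℝ ≃o ℝ} {u w : List Bool}
    (h : u ++ w ∈ uncarried cell f) : u ∈ uncarried cell f :=
  fun ⟨v, hv⟩ => h ⟨v ++ w, hv.append w⟩

theorem setOf_rel_finite_ncard_le {α β : Type*} {A : Set β} (hA : A.Finite) {R : α → β → Prop}
    (hR : ∀ u u' v, R u v → R u' v → u = u') :
    {u | ∃ v ∈ A, R u v}.Finite ∧ {u | ∃ v ∈ A, R u v}.ncard ≤ A.ncard := by
  classical
  rcases isEmpty_or_nonempty α with h | h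
  · rw [Set.eq_empty_of_isEmpty {u | ∃ v ∈ A, R u v}]
    simp
  · let φ : β → α := fun v => if h : ∃ u, R u v then h.choose else Classical.arbitrary α
    have hsub : {u | ∃ v ∈ A, R u v} ⊆ φ '' A := by
      rintro u ⟨v, hv, huv⟩
      refine ⟨v, hv, ?_⟩
      have hex : ∃ u, R u v := ⟨u, huv⟩
      simp only [φ, dif_pos hex]
      exact hR _ _ _ hex.choose_spec huv
    exact ⟨(hA.image φ).subset hsub,
      (Set.ncard_le_ncard hsub (hA.image φ)).trans (Set.ncard_image_le hA)⟩

/-- If `g` carries `u` to `v` and `f` carries `v`, then the product carries `u`. So an uncarried `u`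
is uncarried by `g` or is the `g`-preimage of some `v` uncarried by `f`, and such preimages are
unique. The set `D` allows the same count to be made for all vertices and for the side vertices
alone. -/
theorem uncarried_mul_finite_ncard_le {cell : List Bool → Set ℝ} (hc : IsCellSystem cell)
    {f g : ℝ ≃o ℝ} {D : Set (List Bool)} (hD : ∀ u v, Carries cell g u v → u ∈ D → v ∈ D)
    (hf : (uncarried cell f).Finite) (hg : (uncarried cell g).Finite) :
    (uncarried cell (f * g) ∩ D).Finite ∧ (uncarried cell (f * g) ∩ D).ncard ≤
      (uncarried cell f ∩ D).ncard + (uncarried cell g ∩ D).ncard := by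
  have hf' := hf.inter_of_left D
  have hg' := hg.inter_of_left D
  obtain ⟨h1, h2⟩ := setOf_rel_finite_ncard_le hf' (R := Carries cell g)
    fun u u' v h h' => h.left_unique hc h'
  have hsub : uncarried cell (f * g) ∩ D ⊆
      {u | ∃ v ∈ uncarried cell f ∩ D, Carries cell g u v} ∪ uncarried cell g ∩ D := by
    rintro u ⟨hu, huD⟩
    by_cases h : ∃ v, Carries cell g u v
    · obtain ⟨v, hv⟩ := h
      refine .inl ⟨v, ⟨?_, hD u v hv huD⟩, hv⟩
      rintro ⟨w, hw⟩
      exact hu ⟨w, hw.mul hv⟩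
    · exact .inr ⟨h, huD⟩
  refine ⟨(h1.union hg').subset hsub, ?_⟩
  refine (Set.ncard_le_ncard hsub (h1.union hg')).trans ((Set.ncard_union_le _ _).trans ?_)
  omega

theorem uncarried_mul_ncard_le {cell : List Bool → Set ℝ} (hc : IsCellSystem cell) {f g : ℝ ≃o ℝ}
    (hf : (uncarried cell f).Finite) (hg : (uncarried cell g).Finite) :
    (uncarried cell (f * g)).ncard ≤ (uncarried cell f).ncard + (uncarried cell g).ncard := by
  simpa using (uncarried_mul_finite_ncard_le hc (D := Set.univ) (fun _ _ _ _ => trivial) hf hg).2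

theorem uncarried_one (cell : List Bool → Set ℝ) : uncarried cell 1 = ∅ := by
  ext u
  simp only [uncarried, Set.mem_ofPred_eq, Set.mem_empty_iff_false, iff_false, not_not]
  exact ⟨u, .one u⟩

/-! ## Interior vertices and leaves of finite trees -/

/-- The interior vertices of a tree, one for each caret. -/
def inner : BinaryTree Unit → Set (List Bool)
  | .nil => ∅
  | .node _ l r => {[]} ∪ (List.cons false '' inner l ∪ List.cons true '' inner r)

@[simp] theorem inner_nil : inner .nil = ∅ := rfl

@[simp] theorem nil_mem_inner_node (a : Unit) (l r : BinaryTree Unit) :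
    [] ∈ inner (.node a l r) := by simp [inner]

@[simp] theorem false_cons_mem_inner_node (a : Unit) (l r : BinaryTree Unit) (u : List Bool) :
    false :: u ∈ inner (.node a l r) ↔ u ∈ inner l := by simp [inner]

@[simp] theorem true_cons_mem_inner_node (a : Unit) (l r : BinaryTree Unit) (u : List Bool) :
    true :: u ∈ inner (.node a l r) ↔ u ∈ inner r := by simp [inner]

@[simp] theorem nil_mem_leaves_node (a : Unit) (l r : BinaryTree Unit) :
    [] ∉ leaves (.node a l r) := by simp [leaves]

@[simp] theorem false_cons_mem_leaves_node (a : Unit) (l r : BinaryTree Unit) (u : List Bool) :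
    false :: u ∈ leaves (.node a l r) ↔ u ∈ leaves l := by simp [leaves]

@[simp] theorem true_cons_mem_leaves_node (a : Unit) (l r : BinaryTree Unit) (u : List Bool) :
    true :: u ∈ leaves (.node a l r) ↔ u ∈ leaves r := by simp [leaves]

theorem inner_finite_ncard (t : BinaryTree Unit) :
    (inner t).Finite ∧ (inner t).ncard = t.numNodes := by
  induction t with
  | nil => simp
  | node a l r hl hr =>
    have h1 := hl.1.image (List.cons false)
    have h2 := hr.1.image (List.cons true)
    refine ⟨(Set.finite_singleton _).union (h1.union h2), ?_⟩
    rw [inner, Set.ncard_union_eq _ (Set.finite_singleton _) (h1.union h2),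
      Set.ncard_union_eq _ h1 h2, Set.ncard_image_of_injective _ List.cons_injective,
      Set.ncard_image_of_injective _ List.cons_injective, hl.2, hr.2, Set.ncard_singleton,
      BinaryTree.numNodes, add_comm]
    · rw [Set.disjoint_left]
      rintro _ ⟨x, -, rfl⟩ ⟨y, -, h⟩
      simp at h
    · simp

theorem inner_injective : Function.Injective inner := by
  intro s t h
  induction s generalizing t with
  | nil =>
    cases t with
    | nil => rfl
    | node a l r =>
      have := nil_mem_inner_node a l r
      simp [← h] at this
  | node a l r hl hr =>
    cases t with
    | nil =>
      have := nil_mem_inner_node a l r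
      simp [h] at this
    | node a' l' r' =>
      rw [hl (t := l'), hr (t := r')]
      · ext u
        rw [← true_cons_mem_inner_node a l r u, h, true_cons_mem_inner_node]
      · ext u
        rw [← false_cons_mem_inner_node a l r u, h, false_cons_mem_inner_node]

/-- The prefix-closed set is split by the first turn; recursion runs on a bound for the depth,
finiteness being used only to obtain that bound. -/
theorem exists_inner_eq {A : Set (List Bool)} (hA : A.Finite) (h : ∀ u w, u ++ w ∈ A → u ∈ A) :
    ∃ t, inner t = A := by
  obtain ⟨d, hd⟩ : ∃ d, ∀ u ∈ A, u.length < d := by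
    obtain ⟨d, hd⟩ := (hA.image List.length).bddAbove
    exact ⟨d + 1, fun u hu => Nat.lt_succ_of_le (hd ⟨u, hu, rfl⟩)⟩
  clear hA
  induction d generalizing A with
  | zero => exact ⟨.nil, by ext u; simpa using fun hu => absurd (hd u hu) (by simp)⟩
  | succ d ih =>
    by_cases h0 : [] ∈ A
    · obtain ⟨l, hl⟩ := ih (A := {u | false :: u ∈ A}) (fun u w hu => h (false :: u) w hu)
        fun u hu => by simpa using hd _ hu
      obtain ⟨r, hr⟩ := ih (A := {u | true :: u ∈ A}) (fun u w hu => h (true :: u) w hu)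
        fun u hu => by simpa using hd _ hu
      refine ⟨.node () l r, ?_⟩
      ext u
      match u with
      | [] => simpa using h0
      | false :: u => simp [hl]
      | true :: u => simp [hr]
    · refine ⟨.nil, ?_⟩
      ext u
      simp only [inner_nil, Set.mem_empty_iff_false, false_iff]
      exact fun hu => h0 (h [] u hu)

theorem mem_inner_or_leaf_prefix (t : BinaryTree Unit) (u : List Bool) :
    u ∈ inner t ∨ ∃ l ∈ leaves t, l <+: u := by
  induction t generalizing u with
  | nil => simp [leaves]
  | node a l r hl hr =>
    match u with
    | [] => simp
    | false :: u =>
      rcases hl u with h | ⟨v, hv, h⟩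
      · simp [h]
      · exact .inr ⟨false :: v, by simpa using hv, by simpa using h⟩
    | true :: u =>
      rcases hr u with h | ⟨v, hv, h⟩
      · simp [h]
      · exact .inr ⟨true :: v, by simpa using hv, by simpa using h⟩

theorem mem_leaves_iff (t : BinaryTree Unit) (l : List Bool) :
    l ∈ leaves t ↔ l ∉ inner t ∧ ∀ u b, l = u ++ [b] → u ∈ inner t := by
  induction t generalizing l with
  | nil =>
    simp only [leaves, List.mem_singleton, inner_nil, Set.mem_empty_iff_false, not_false_eq_true,
      true_and]
    constructor
    · rintro rfl u b h
      simp at h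
    · intro h
      by_contra h1
      exact h _ _ (List.dropLast_append_getLast h1).symm
  | node a l' r' hl hr =>
    have key : ∀ (b : Bool) (l : List Bool), (∀ u c, b :: l = u ++ [c] → u ∈ inner (.node a l' r')) ↔
        ∀ u c, l = u ++ [c] → b :: u ∈ inner (.node a l' r') := by
      intro b l
      constructor
      · rintro h u c rfl
        exact h (b :: u) c rfl
      · intro h u c hu
        cases u with
        | nil => simp
        | cons d u =>
          simp only [List.cons_append, List.cons.injEq] at hu
          rw [← hu.1]
          exact h u c hu.2
    match l with
    | [] => simp
    | false :: l =>
      rw [key, false_cons_mem_leaves_node, false_cons_mem_inner_node, hl]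
      simp only [false_cons_mem_inner_node]
    | true :: l =>
      rw [key, true_cons_mem_leaves_node, true_cons_mem_inner_node, hr]
      simp only [true_cons_mem_inner_node]

theorem leaves_pairwise (t : BinaryTree Unit) : (leaves t).Pairwise LeftOf := by
  induction t with
  | nil => simp [leaves]
  | node a l r hl hr =>
    rw [leaves, List.pairwise_append]
    refine ⟨hl.map _ fun _ _ h => h.cons _, hr.map _ fun _ _ h => h.cons _, ?_⟩
    intro u hu v hv
    obtain ⟨x, -, rfl⟩ := List.mem_map.1 hu
    obtain ⟨y, -, rfl⟩ := List.mem_map.1 hv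
    exact ⟨[], x, y, rfl, rfl⟩

/-- Below every interior vertex there is a caret whose two leaves are leaves of the tree. -/
theorem exists_exposed_caret (t : BinaryTree Unit) (u : List Bool) (hu : u ∈ inner t) :
    ∃ (w : List Bool) (i : ℕ), (leaves t)[i]? = some (u ++ w ++ [false]) ∧
      (leaves t)[i + 1]? = some (u ++ w ++ [true]) := by
  have left : ∀ (a : Unit) (l r : BinaryTree Unit) (i : ℕ) (v : List Bool), (leaves l)[i]? = some v →
      (leaves (.node a l r))[i]? = some (false :: v) := by
    intro a l r i v h
    obtain ⟨hi, hv⟩ := List.getElem?_eq_some_iff.1 h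
    rw [leaves, List.getElem?_append_left (by simpa using hi), List.getElem?_map, h]
    rfl
  have right : ∀ (a : Unit) (l r : BinaryTree Unit) (i : ℕ) (v : List Bool), (leaves r)[i]? = some v →
      (leaves (.node a l r))[(leaves l).length + i]? = some (true :: v) := by
    intro a l r i v h
    rw [leaves, List.getElem?_append_right (by simp), List.length_map, Nat.add_sub_cancel_left,
      List.getElem?_map, h]
    rfl
  induction t generalizing u with
  | nil => simp at hu
  | node a l r hl hr =>
    have goL : ∀ u, u ∈ inner l → ∃ (w : List Bool) (i : ℕ),
        (leaves (.node a l r))[i]? = some (false :: u ++ w ++ [false]) ∧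
        (leaves (.node a l r))[i + 1]? = some (false :: u ++ w ++ [true]) := by
      intro u hu
      obtain ⟨w, i, h0, h1⟩ := hl u hu
      exact ⟨w, i, left a l r _ _ h0, left a l r _ _ h1⟩
    have goR : ∀ u, u ∈ inner r → ∃ (w : List Bool) (i : ℕ),
        (leaves (.node a l r))[i]? = some (true :: u ++ w ++ [false]) ∧
        (leaves (.node a l r))[i + 1]? = some (true :: u ++ w ++ [true]) := by
      intro u hu
      obtain ⟨w, i, h0, h1⟩ := hr u hu
      exact ⟨w, (leaves l).length + i, right a l r _ _ h0, right a l r _ _ h1⟩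
    match u with
    | false :: u => exact goL u (by simpa using hu)
    | true :: u => exact goR u (by simpa using hu)
    | [] =>
      cases l with
      | node b l1 l2 =>
        obtain ⟨w, i, h⟩ := goL [] (by simp)
        exact ⟨false :: w, i, by simpa using h⟩
      | nil =>
        cases r with
        | node b r1 r2 =>
          obtain ⟨w, i, h⟩ := goR [] (by simp)
          exact ⟨true :: w, i, by simpa using h⟩
        | nil => exact ⟨[], 0, by simp [leaves]⟩

/-! ## Reduced diagrams -/

section Diagram

variable {cell : List Bool → Set ℝ} {f g : ℝ ≃o ℝ} {P Q : BinaryTree Unit}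

theorem IsDiagram.inv (h : IsDiagram cell f P Q) : IsDiagram cell f⁻¹ Q P :=
  (List.Forall₂.imp (fun _ _ (h : Carries cell f _ _) => h.inv) h).flip

theorem IsReducedPair.symm (h : IsReducedPair P Q) : IsReducedPair Q P :=
  fun ⟨i, u, v, h1, h2, h3, h4⟩ => h ⟨i, v, u, h3, h4, h1, h2⟩

theorem IsReducedDiagram.inv (h : IsReducedDiagram cell f (P, Q)) :
    IsReducedDiagram cell f⁻¹ (Q, P) :=
  ⟨h.1.inv, h.2.symm⟩

theorem IsDiagram.exists_carries (h : IsDiagram cell f P Q) {u : List Bool} (hu : u ∈ leaves P) :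
    ∃ v, Carries cell f u v := by
  obtain ⟨i, hi, rfl⟩ := List.getElem_of_mem hu
  exact ⟨_, h.get hi (h.length_eq ▸ hi)⟩

theorem IsDiagram.carries_getElem? (hc : IsCellSystem cell) (h : IsDiagram cell f P Q) {i : ℕ}
    {u v : List Bool} (hu : (leaves P)[i]? = some u) (hv : Carries cell f u v) :
    (leaves Q)[i]? = some v := by
  obtain ⟨hi, rfl⟩ := List.getElem?_eq_some_iff.1 hu
  have hi' : i < (leaves Q).length := h.length_eq ▸ hi
  rw [List.getElem?_eq_some_iff]
  refine ⟨hi', ?_⟩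
  have h1 : Carries cell f (leaves P)[i] (leaves Q)[i] := h.get hi hi'
  exact h1.right_unique hc hv

/-- Below a carried interior vertex of `P` lies an exposed caret, and it would face an exposed caret
of `Q`, contrary to reducedness. Conversely, a vertex that is not interior lies below a leaf of `P`
and is carried along with that leaf. -/
theorem IsReducedDiagram.inner_eq (hc : IsCellSystem cell)
    (h : IsReducedDiagram cell f (P, Q)) : inner P = uncarried cell f := by
  ext u
  constructor
  · rintro hu ⟨v, hv⟩
    obtain ⟨w, i, h0, h1⟩ := exists_exposed_caret P u hu
    refine h.2 ⟨i, u ++ w, v ++ w, h0, h1, ?_, ?_⟩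
    · exact h.1.carries_getElem? hc h0 ((hv.append w).append _)
    · exact h.1.carries_getElem? hc h1 ((hv.append w).append _)
  · intro hu
    rcases mem_inner_or_leaf_prefix P u with h1 | ⟨l, hl, w, rfl⟩
    · exact h1
    · exact absurd (h.1.exists_carries hl) (uncarried_of_append hu)

/-- An interior `v` would be uncarried by the inverse, which it is not. If the parent of `v` were
carried back by the inverse, it would go to the parent of `u`, which is interior in `P` and hence
uncarried by `f`. -/
theorem leaf_of_carries_leaf (hc : IsCellSystem cell) (hP : inner P = uncarried cell f)
    (hQ : inner Q = uncarried cell f⁻¹) {u v : List Bool} (hu : u ∈ leaves P)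
    (hv : Carries cell f u v) : v ∈ leaves Q := by
  rw [mem_leaves_iff] at hu ⊢
  refine ⟨fun h => ?_, ?_⟩
  · rw [hQ] at h
    exact h ⟨u, hv.inv⟩
  · rintro v' b rfl
    rw [hQ]
    rintro ⟨u', hu'⟩
    have h1 := (hu'.append [b]).right_unique hc hv.inv
    have h2 := hu.2 u' b h1.symm
    rw [hP] at h2
    exact h2 ⟨v', Carries.inv_iff.1 hu'⟩

/-- The map from leaves of `P` to the vertices they are carried to is an order-preserving bijection
onto the leaves of `Q`, so it matches the two lists position by position. Two facing exposed carets
would make their common parent in `P` carried, by `Carries.of_children`. -/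
theorem isReducedDiagram_of_inner_eq (hc : IsCellSystem cell) (hP : inner P = uncarried cell f)
    (hQ : inner Q = uncarried cell f⁻¹) : IsReducedDiagram cell f (P, Q) := by
  have hex : ∀ u ∈ leaves P, ∃ v, Carries cell f u v := by
    intro u hu
    have h := ((mem_leaves_iff P u).1 hu).1
    rw [hP] at h
    exact not_not.1 h
  choose! F hF using hex
  have hQP : ∀ v ∈ leaves Q, ∃ u ∈ leaves P, F u = v := by
    intro v hv
    have h := ((mem_leaves_iff Q v).1 hv).1
    rw [hQ] at h
    obtain ⟨u, hu⟩ := not_not.1 h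
    have hu' : u ∈ leaves P := leaf_of_carries_leaf hc hQ (by rwa [inv_inv]) hv hu
    exact ⟨u, hu', (hF u hu').right_unique hc (Carries.inv_iff.1 hu)⟩
  have irr : ∀ u : List Bool, ¬ ∀ x ∈ cell u, ∀ y ∈ cell u, x ≤ y :=
    fun u => hc.not_le_of_subset subset_rfl
  have pw : ((leaves P).map F).Pairwise fun u v => ∀ x ∈ cell u, ∀ y ∈ cell v, x ≤ y := by
    rw [List.pairwise_map]
    refine (leaves_pairwise P).imp_of_mem fun {u v} hu hv h => ?_
    exact (hF u hu).le_of_le (hF v hv) (hc.le_of_leftOf h)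
  have pw' : (leaves Q).Pairwise fun u v => ∀ x ∈ cell u, ∀ y ∈ cell v, x ≤ y :=
    (leaves_pairwise Q).imp fun h => hc.le_of_leftOf h
  have nodup : ∀ l : List (List Bool),
      l.Pairwise (fun u v => ∀ x ∈ cell u, ∀ y ∈ cell v, x ≤ y) → l.Nodup := by
    intro l hl
    refine hl.imp ?_
    rintro a b h rfl
    exact irr _ h
  -- Both lists have the same members and are sorted for the relation "lies weakly to the left"; a
  -- sorted list is determined by its members.
  have heq : (leaves P).map F = leaves Q := by
    refine List.Perm.eq_of_pairwise ?_ pw pw' ?_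
    · intro a b _ _ h1 h2
      obtain ⟨x, hx, y, hy, hxy⟩ := hc.nontriv a
      obtain ⟨z, hz, -⟩ := hc.nontriv b
      have h3 := h1 y hy z hz
      have h4 := h2 z hz x hx
      linarith
    · rw [List.perm_ext_iff_of_nodup (nodup _ pw) (nodup _ pw')]
      intro v
      rw [List.mem_map]
      constructor
      · rintro ⟨u, hu, rfl⟩
        exact leaf_of_carries_leaf hc hP hQ hu (hF u hu)
      · exact hQP v
  constructor
  · change List.Forall₂ (Carries cell f) (leaves P) (leaves Q)
    rw [← heq, List.forall₂_map_right_iff, List.forall₂_same]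
    exact hF
  · rintro ⟨i, u, v, h1, h2, h3, h4⟩
    have hl : ∀ (j : ℕ) (w : List Bool), (leaves P)[j]? = some w → (leaves Q)[j]? = some (F w) := by
      intro j w h
      rw [← heq, List.getElem?_map, h]
      rfl
    have hu0 := List.mem_of_getElem? h1
    have hu1 := List.mem_of_getElem? h2
    have e0 : F (u ++ [false]) = v ++ [false] := Option.some.inj ((hl _ _ h1).symm.trans h3)
    have e1 : F (u ++ [true]) = v ++ [true] := Option.some.inj ((hl _ _ h2).symm.trans h4)
    have c0 := hF _ hu0
    have c1 := hF _ hu1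
    rw [e0] at c0
    rw [e1] at c1
    have h := ((mem_leaves_iff P _).1 hu0).2 u false rfl
    change u ∈ inner P at h
    rw [hP] at h
    exact h ⟨v, .of_children hc c0 c1⟩

theorem existsUnique_isReducedDiagram (hc : IsCellSystem cell) (hf : (uncarried cell f).Finite)
    (hf' : (uncarried cell f⁻¹).Finite) : ∃! p, IsReducedDiagram cell f p := by
  obtain ⟨P, hP⟩ := exists_inner_eq hf fun _ _ => uncarried_of_append
  obtain ⟨Q, hQ⟩ := exists_inner_eq hf' fun _ _ => uncarried_of_append
  refine ⟨(P, Q), isReducedDiagram_of_inner_eq hc hP hQ, ?_⟩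
  rintro ⟨P', Q'⟩ h
  rw [inner_injective ((h.inner_eq hc).trans hP.symm),
    inner_injective ((h.inv.inner_eq hc).trans hQ.symm)]

theorem isReducedDiagram_reducedDiagram (hc : IsCellSystem cell)
    (hf : (uncarried cell f).Finite) (hf' : (uncarried cell f⁻¹).Finite) :
    IsReducedDiagram cell f (reducedDiagram cell f) :=
  Classical.epsilon_spec (existsUnique_isReducedDiagram hc hf hf').exists

theorem inner_reducedDiagram (hc : IsCellSystem cell)
    (hf : (uncarried cell f).Finite) (hf' : (uncarried cell f⁻¹).Finite) :
    inner (reducedDiagram cell f).1 = uncarried cell f ∧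
      inner (reducedDiagram cell f).2 = uncarried cell f⁻¹ := by
  have h := isReducedDiagram_reducedDiagram hc hf hf'
  exact ⟨h.inner_eq hc, h.inv.inner_eq hc⟩

theorem carets_eq_ncard (hc : IsCellSystem cell)
    (hf : (uncarried cell f).Finite) (hf' : (uncarried cell f⁻¹).Finite) :
    carets cell f = (uncarried cell f).ncard := by
  rw [carets, ← (inner_finite_ncard _).2, (inner_reducedDiagram hc hf hf').1]

theorem leaves_length (t : BinaryTree Unit) : (leaves t).length = t.numNodes + 1 := by
  induction t with
  | nil => rfl
  | node a l r hl hr =>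
    rw [leaves, List.length_append, List.length_map, List.length_map, hl, hr, BinaryTree.numNodes]
    omega

theorem IsDiagram.eqOn (hc : IsCellSystem cell) (hf : IsDiagram cell f P Q)
    (hg : IsDiagram cell g P Q) {x : ℝ} (hx : x ∈ cell []) : f x = g x := by
  -- Every point of the cell of `u` lies in the cell of some leaf of a tree hung at `u`.
  have key : ∀ (t : BinaryTree Unit) (u : List Bool), x ∈ cell u → ∃ l ∈ leaves t, x ∈ cell (u ++ l) := by
    intro t
    induction t with
    | nil => exact fun u h => ⟨[], by simp [leaves], by simpa using h⟩
    | node a l r hl hr =>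
      intro u h
      rw [hc.split u] at h
      rcases h with h | h
      · obtain ⟨v, hv, h⟩ := hl _ h
        exact ⟨false :: v, by simpa using hv, by simpa using h⟩
      · obtain ⟨v, hv, h⟩ := hr _ h
        exact ⟨true :: v, by simpa using hv, by simpa using h⟩
  obtain ⟨l, hl, hx⟩ := key P [] hx
  obtain ⟨i, hi, rfl⟩ := List.getElem_of_mem hl
  have hi' : i < (leaves Q).length := hf.length_eq ▸ hi
  have h1 : Carries cell f (leaves P)[i] (leaves Q)[i] := hf.get hi hi'
  have h2 : Carries cell g (leaves P)[i] (leaves Q)[i] := hg.get hi hi'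
  exact h1.eqOn hc h2 hx

end Diagram

/-! ## Word length -/

section Word

variable {G : Type*} [Group G] {S : Set G}

/-- `g` is a product of at most `n` elements of `S` and their inverses. -/
def HasWord (S : Set G) (n : ℕ) (g : G) : Prop :=
  ∃ l : List G, l.length ≤ n ∧ (∀ s ∈ l, s ∈ S ∨ s⁻¹ ∈ S) ∧ l.prod = g

theorem HasWord.one (n : ℕ) : HasWord S n 1 := ⟨[], by simp⟩

theorem HasWord.mono {m n : ℕ} {g : G} (h : HasWord S m g) (hmn : m ≤ n) : HasWord S n g := by
  obtain ⟨l, h1, h2⟩ := h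
  exact ⟨l, h1.trans hmn, h2⟩

theorem HasWord.mul {m n : ℕ} {g h : G} (hg : HasWord S m g) (hh : HasWord S n h) :
    HasWord S (m + n) (g * h) := by
  obtain ⟨l, h1, h2, rfl⟩ := hg
  obtain ⟨l', h1', h2', rfl⟩ := hh
  refine ⟨l ++ l', by simp; omega, ?_, by simp⟩
  intro s hs
  rcases List.mem_append.1 hs with h | h
  · exact h2 s h
  · exact h2' s h

theorem HasWord.inv {n : ℕ} {g : G} (hg : HasWord S n g) : HasWord S n g⁻¹ := by
  obtain ⟨l, h1, h2, rfl⟩ := hg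
  refine ⟨(l.map (·⁻¹)).reverse, by simpa using h1, ?_, (List.prod_inv_reverse l).symm⟩
  intro s hs
  obtain ⟨t, ht, rfl⟩ := List.mem_map.1 (List.mem_reverse.1 hs)
  simpa using (h2 t ht).symm

theorem HasWord.of_mem {s : G} (hs : s ∈ S) : HasWord S 1 s := ⟨[s], by simp [hs]⟩

theorem HasWord.pow {n : ℕ} {g : G} (hg : HasWord S n g) (k : ℕ) : HasWord S (k * n) (g ^ k) := by
  induction k with
  | zero => simpa using HasWord.one 0
  | succ k ih =>
    rw [pow_succ, Nat.succ_mul]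
    exact ih.mul hg

theorem HasWord.mem_closure {n : ℕ} {g : G} (hg : HasWord S n g) : g ∈ Subgroup.closure S := by
  obtain ⟨l, -, h2, rfl⟩ := hg
  refine list_prod_mem fun s hs => ?_
  rcases h2 s hs with h | h
  · exact Subgroup.subset_closure h
  · exact inv_mem_iff.1 (Subgroup.subset_closure h)

theorem HasWord.wordLength_le {n : ℕ} {g : G} (hg : HasWord S n g) : wordLength S g ≤ n := by
  obtain ⟨l, h1, h2⟩ := hg
  have h3 : wordLength S g ≤ l.length := Nat.sInf_le ⟨l, rfl, h2⟩
  exact h3.trans h1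

theorem exists_hasWord {g : G} (hg : g ∈ Subgroup.closure S) : ∃ n, HasWord S n g := by
  induction hg using Subgroup.closure_induction with
  | mem x hx => exact ⟨1, .of_mem hx⟩
  | one => exact ⟨0, .one 0⟩
  | mul x y _ _ hx hy =>
    obtain ⟨m, hm⟩ := hx
    obtain ⟨n, hn⟩ := hy
    exact ⟨_, hm.mul hn⟩
  | inv x _ hx =>
    obtain ⟨m, hm⟩ := hx
    exact ⟨m, hm.inv⟩

theorem exists_list_wordLength {g : G} (hg : g ∈ Subgroup.closure S) :
    ∃ l : List G, l.length = wordLength S g ∧ (∀ s ∈ l, s ∈ S ∨ s⁻¹ ∈ S) ∧ l.prod = g := by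
  obtain ⟨n, l, -, h⟩ := exists_hasWord hg
  exact Nat.sInf_mem (s := {n | ∃ l : List G, l.length = n ∧ (∀ s ∈ l, s ∈ S ∨ s⁻¹ ∈ S) ∧ l.prod = g})
    ⟨_, l, rfl, h⟩

/-- Induction along a shortest word. -/
theorem wordLength_induction {p : G → ℕ → Prop} (h1 : p 1 0)
    (hs : ∀ s g n, (s ∈ S ∨ s⁻¹ ∈ S) → g ∈ Subgroup.closure S → p g n → p (s * g) (n + 1))
    {g : G} (hg : g ∈ Subgroup.closure S) : p g (wordLength S g) := by
  obtain ⟨l, hl, hS, rfl⟩ := exists_list_wordLength hg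
  rw [← hl]
  clear hl hg
  induction l with
  | nil => simpa using h1
  | cons s l ih =>
    have hS' : ∀ t ∈ l, t ∈ S ∨ t⁻¹ ∈ S := fun t ht => hS t (List.mem_cons_of_mem _ ht)
    rw [List.prod_cons, List.length_cons]
    exact hs _ _ _ (hS s List.mem_cons_self) (HasWord.mem_closure ⟨l, le_rfl, hS', rfl⟩) (ih hS')

/-- A change of finite generating sets changes the word length at most by a factor. -/
theorem exists_wordLength_le_mul {S' : Set G} (hS : S.Finite)
    (h : S ⊆ Subgroup.closure S') :
    ∃ K : ℕ, 0 < K ∧ ∀ g ∈ Subgroup.closure S, wordLength S' g ≤ K * wordLength S g := by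
  have hex : ∀ s ∈ S, ∃ n, HasWord S' n s := fun s hs => exists_hasWord (h hs)
  choose! N hN using hex
  obtain ⟨K, hK⟩ := (hS.image N).bddAbove
  -- Adding one to the bound on the lengths of the old generators keeps the constant positive.
  refine ⟨K + 1, Nat.succ_pos _, fun g hg => ?_⟩
  refine HasWord.wordLength_le ?_
  refine wordLength_induction (p := fun g n => HasWord S' ((K + 1) * n) g) (.one _) ?_ hg
  intro s g n hs _ hgn
  have h1 : HasWord S' (K + 1) s := by
    rcases hs with hs | hs
    · exact (hN s hs).mono ((hK ⟨s, hs, rfl⟩).trans (Nat.le_succ _))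
    · simpa using ((hN _ hs).mono ((hK ⟨_, hs, rfl⟩).trans (Nat.le_succ _))).inv
  refine (h1.mul hgn).mono (le_of_eq ?_)
  ring

end Word

theorem forall₂_trans {α : Type*} {R S T : α → α → Prop} (h : ∀ a b c, R a b → S b c → T a c)
    {l₁ l₂ l₃ : List α} (h₁ : List.Forall₂ R l₁ l₂) (h₂ : List.Forall₂ S l₂ l₃) :
    List.Forall₂ T l₁ l₃ := by
  induction h₁ generalizing l₃ with
  | nil => cases h₂; exact .nil
  | cons h1 _ ih =>
    cases h₂ with
    | cons h2 h3 => exact .cons (h _ _ _ h1 h2) (ih h3)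

/-! ## Elements with a given diagram as words in the generators -/

/-- `y₀` and `y₁` act on cells as the standard generators of Thompson's group do. -/
structure IsGeneratorPair (cell : List Bool → Set ℝ) (y₀ y₁ : ℝ ≃o ℝ) : Prop where
  y0_ff : Carries cell y₀ [false, false] [false]
  y0_ft : Carries cell y₀ [false, true] [true, false]
  y0_t : Carries cell y₀ [true] [true, true]
  y1_f : Carries cell y₁ [false] [false]
  y1_tff : Carries cell y₁ [true, false, false] [true, false]
  y1_tft : Carries cell y₁ [true, false, true] [true, true, false]
  y1_tt : Carries cell y₁ [true, true] [true, true, true]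

/-- The tree all of whose carets lie on the right side. -/
def comb : ℕ → BinaryTree Unit
  | 0 => .nil
  | n + 1 => .node () .nil (comb n)

/-- The first `n` leaves of a right comb with at least `n` carets. -/
def combInit : ℕ → List (List Bool)
  | 0 => []
  | n + 1 => [false] :: (combInit n).map (List.cons true)

theorem combInit_add (m n : ℕ) :
    combInit (m + n) = combInit m ++ (combInit n).map (List.replicate m true ++ ·) := by
  induction m with
  | zero => simp [combInit]
  | succ m ih => simp [Nat.succ_add, combInit, ih, Function.comp_def, List.replicate_succ]

theorem leaves_comb_add (m n : ℕ) :
    leaves (comb (m + n)) = combInit m ++ (leaves (comb n)).map (List.replicate m true ++ ·) := by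
  induction m with
  | zero => simp [combInit]
  | succ m ih =>
    simp [Nat.succ_add, combInit, comb, leaves, ih, Function.comp_def, List.replicate_succ]

/-- The element expanding the cell `10` so that the leaves of `t` below it become successive leaves
of a right comb. -/
def expandTree (y₀ y₁ : ℝ ≃o ℝ) : BinaryTree Unit → (ℝ ≃o ℝ)
  | .nil => 1
  | .node _ l r => expandTree y₀ y₁ l * (y₀ * expandTree y₀ y₁ r * y₀⁻¹) * y₁

/-- The element expanding the leaves of `t` below the vertex `1` to the leaves of a right comb. -/
def expandRight (y₀ y₁ : ℝ ≃o ℝ) : BinaryTree Unit → (ℝ ≃o ℝ)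
  | .nil => 1
  | .node _ l r => expandTree y₀ y₁ l * (y₀ * expandRight y₀ y₁ r * y₀⁻¹)

/-- The element expanding the leaves of the tree with branches `l`, `r` to those of a comb. -/
def expandNode (y₀ y₁ : ℝ ≃o ℝ) : BinaryTree Unit → BinaryTree Unit → (ℝ ≃o ℝ)
  | .nil, r => expandRight y₀ y₁ r
  | .node _ a b, r => expandNode y₀ y₁ a (.node () b r) * y₀

/-- The element expanding the leaves of a tree to those of a right comb. -/
def expand (y₀ y₁ : ℝ ≃o ℝ) : BinaryTree Unit → (ℝ ≃o ℝ)
  | .nil => 1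
  | .node _ l r => expandNode y₀ y₁ l r

namespace IsGeneratorPair

variable {cell : List Bool → Set ℝ} {y₀ y₁ : ℝ ≃o ℝ} (h : IsGeneratorPair cell y₀ y₁)
include h

/-- Since `y₀` carries the vertex `1` to `11`, conjugation by it moves an action below `1` to the
same action below `11`. Since it also carries `01` to `10` and `00` to `0`, an element fixing the
cell of `0` linearly becomes one fixing those of `10` and `0`. -/
theorem conj_tt {g : ℝ ≃o ℝ} {u v : List Bool} (hg : Carries cell g (true :: u) (true :: v)) :
    Carries cell (y₀ * g * y₀⁻¹) (true :: true :: u) (true :: true :: v) :=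
  ((h.y0_t.append v).mul hg).mul (h.y0_t.append u).inv

theorem conj_tf {g : ℝ ≃o ℝ} (hg : Carries cell g [false] [false]) :
    Carries cell (y₀ * g * y₀⁻¹) [true, false] [true, false] :=
  (h.y0_ft.mul (hg.append [true])).mul h.y0_ft.inv

theorem conj_f {g : ℝ ≃o ℝ} (hg : Carries cell g [false] [false]) :
    Carries cell (y₀ * g * y₀⁻¹) [false] [false] :=
  (h.y0_ff.mul (hg.append [false])).mul h.y0_ff.inv

theorem expandTree_f (t : BinaryTree Unit) : Carries cell (expandTree y₀ y₁ t) [false] [false] := by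
  induction t with
  | nil => exact .one _
  | node a l r hl hr => exact (hl.mul (h.conj_f hr)).mul h.y1_f

/-- Each caret of `t` expanded at `10` is inserted into the right side of the comb, so whatever was
below `11` moves down by as many steps as `t` has carets. -/
theorem expandTree_tt (t : BinaryTree Unit) : Carries cell (expandTree y₀ y₁ t) [true, true]
    (true :: List.replicate (t.numNodes + 1) true) := by
  induction t with
  | nil => exact .one _
  | node a l r hl hr =>
    have h1 := h.conj_tt (u := [true]) hr
    have h2 := (hl.append (List.replicate (r.numNodes + 1) true)).mul h1
    have h3 := (h2.append []).mul h.y1_tt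
    have e : (BinaryTree.node a l r).numNodes + 1 = (l.numNodes + 1) + (r.numNodes + 1) := by
      simp only [BinaryTree.numNodes]; omega
    rw [e, List.replicate_add]
    simpa [expandTree] using h3

/-- For a caret with branches `l`, `r`, the map `y₁` opens `10` into `10` and `110`. The conjugated
element then expands `r` at `110` without disturbing `10`, and finally `l` is expanded at `10`,
which pushes the leaves of `r` to the right by `expandTree_tt`. -/
theorem expandTree_leaves (t : BinaryTree Unit) :
    List.Forall₂ (fun u v => Carries cell (expandTree y₀ y₁ t) (true :: false :: u) (true :: v))
      (leaves t) (combInit (t.numNodes + 1)) := by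
  induction t with
  | nil =>
    simp only [leaves, combInit, BinaryTree.numNodes, List.map_nil, List.forall₂_cons,
      List.Forall₂.nil, and_true]
    exact .one _
  | node a l r hl hr =>
    have e : (BinaryTree.node a l r).numNodes + 1 = (l.numNodes + 1) + (r.numNodes + 1) := by
      simp only [BinaryTree.numNodes]; omega
    rw [e, combInit_add, leaves]
    refine List.rel_append ?_ ?_
    · rw [List.forall₂_map_left_iff]
      refine hl.imp fun u v huv => ?_
      have h1 := huv.mul ((h.conj_tf (h.expandTree_f r)).append u)
      exact h1.mul (h.y1_tff.append u)
    · rw [List.forall₂_map_left_iff, List.forall₂_map_right_iff]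
      refine hr.imp fun u v huv => ?_
      have h1 := ((h.expandTree_tt l).append v).mul (h.conj_tt huv)
      exact h1.mul (h.y1_tft.append u)

theorem expandRight_f (t : BinaryTree Unit) :
    Carries cell (expandRight y₀ y₁ t) [false] [false] := by
  induction t with
  | nil => exact .one _
  | node a l r hl hr => exact (h.expandTree_f l).mul (h.conj_f hr)

theorem expandRight_leaves (t : BinaryTree Unit) :
    List.Forall₂ (fun u v => Carries cell (expandRight y₀ y₁ t) (true :: u) (true :: v))
      (leaves t) (leaves (comb t.numNodes)) := by
  induction t with
  | nil =>
    simp only [leaves, comb, BinaryTree.numNodes, List.forall₂_cons, List.Forall₂.nil, and_true]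
    exact .one _
  | node a l r hl hr =>
    have e : (BinaryTree.node a l r).numNodes = (l.numNodes + 1) + r.numNodes := by
      simp only [BinaryTree.numNodes]; omega
    rw [e, leaves_comb_add, leaves]
    refine List.rel_append ?_ ?_
    · rw [List.forall₂_map_left_iff]
      refine (h.expandTree_leaves l).imp fun u v huv => ?_
      exact huv.mul ((h.conj_tf (h.expandRight_f r)).append u)
    · rw [List.forall₂_map_left_iff, List.forall₂_map_right_iff]
      refine hr.imp fun u v huv => ?_
      exact ((h.expandTree_tt l).append v).mul (h.conj_tt huv)

/-- Applying `y₀` is a rotation: a tree with left branch `(b, c)` and right branch `r` becomes one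
with left branch `b` and right branch `(c, r)`. Repeating this empties the left branch, and the rest
is `expandRight`. -/
theorem isDiagram_expandNode (l r : BinaryTree Unit) :
    IsDiagram cell (expandNode y₀ y₁ l r) (.node () l r) (comb (l.numNodes + r.numNodes + 1)) := by
  induction l generalizing r with
  | nil =>
    change List.Forall₂ (Carries cell (expandRight y₀ y₁ r)) _ _
    simp only [leaves, comb, BinaryTree.numNodes, zero_add, List.map_cons, List.map_nil,
      List.cons_append, List.nil_append, List.forall₂_cons, List.forall₂_map_left_iff,
      List.forall₂_map_right_iff]
    exact ⟨h.expandRight_f r, h.expandRight_leaves r⟩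
  | node a b c hb hc =>
    have h1 := hb (.node () c r)
    have e : b.numNodes + (BinaryTree.node () c r).numNodes + 1 =
        (BinaryTree.node a b c).numNodes + r.numNodes + 1 := by
      simp only [BinaryTree.numNodes]; omega
    rw [e] at h1
    change List.Forall₂ (Carries cell _) _ _ at h1
    change List.Forall₂ (Carries cell (expandNode y₀ y₁ b (.node () c r) * y₀)) _ _
    generalize leaves (comb _) = M at h1 ⊢
    have e1 : leaves (.node () b (.node () c r)) = (leaves b).map (List.cons false) ++
        ((leaves c).map (fun u => true :: false :: u) ++
          (leaves r).map fun u => true :: true :: u) := by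
      simp [leaves, Function.comp_def]
    have e2 : leaves (.node () (.node a b c) r) = (leaves b).map (fun u => false :: false :: u) ++
        ((leaves c).map (fun u => false :: true :: u) ++ (leaves r).map (List.cons true)) := by
      simp [leaves, Function.comp_def]
    have h2 : List.Forall₂ (Carries cell y₀) (leaves (.node () (.node a b c) r))
        (leaves (.node () b (.node () c r))) := by
      rw [e1, e2]
      refine List.rel_append ?_ (List.rel_append ?_ ?_)
      all_goals rw [List.forall₂_map_left_iff, List.forall₂_map_right_iff, List.forall₂_same]
      · exact fun u _ => h.y0_ff.append u
      · exact fun u _ => h.y0_ft.append u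
      · exact fun u _ => h.y0_t.append u
    exact forall₂_trans (fun _ _ _ h3 h4 => h4.mul h3) h2 h1

theorem isDiagram_expand (t : BinaryTree Unit) :
    IsDiagram cell (expand y₀ y₁ t) t (comb t.numNodes) := by
  cases t with
  | nil =>
    change List.Forall₂ (Carries cell 1) _ _
    simp only [leaves, comb, BinaryTree.numNodes, List.forall₂_cons, List.Forall₂.nil, and_true]
    exact .one _
  | node a l r => exact h.isDiagram_expandNode l r

omit h

/-- Each caret costs one `y₁` and the two letters of a conjugation by `y₀`. -/
theorem hasWord_expandTree (y₀ y₁ : ℝ ≃o ℝ) (t : BinaryTree Unit) :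
    HasWord {y₀, y₁} (3 * t.numNodes) (expandTree y₀ y₁ t) := by
  have h0 : HasWord {y₀, y₁} 1 y₀ := .of_mem (by simp)
  have h1 : HasWord {y₀, y₁} 1 y₁ := .of_mem (by simp)
  induction t with
  | nil => exact .one _
  | node a l r hl hr =>
    refine ((hl.mul ((h0.mul hr).mul h0.inv)).mul h1).mono ?_
    simp only [BinaryTree.numNodes]; omega

theorem hasWord_expandRight (y₀ y₁ : ℝ ≃o ℝ) (t : BinaryTree Unit) :
    HasWord {y₀, y₁} (3 * t.numNodes) (expandRight y₀ y₁ t) := by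
  have h0 : HasWord {y₀, y₁} 1 y₀ := .of_mem (by simp)
  induction t with
  | nil => exact .one _
  | node a l r hl hr =>
    refine ((hasWord_expandTree y₀ y₁ l).mul ((h0.mul hr).mul h0.inv)).mono ?_
    simp only [BinaryTree.numNodes]; omega

/-- A caret of the left branch may cost a rotation `y₀` in addition to the three letters it costs
once it belongs to the right branch. -/
theorem hasWord_expandNode (y₀ y₁ : ℝ ≃o ℝ) (l r : BinaryTree Unit) :
    HasWord {y₀, y₁} (4 * l.numNodes + 3 * r.numNodes) (expandNode y₀ y₁ l r) := by
  have h0 : HasWord {y₀, y₁} 1 y₀ := .of_mem (by simp)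
  induction l generalizing r with
  | nil => exact (hasWord_expandRight y₀ y₁ r).mono (by simp)
  | node a b c hb hc =>
    refine ((hb (.node () c r)).mul h0).mono ?_
    simp only [BinaryTree.numNodes]; omega

theorem hasWord_expand (y₀ y₁ : ℝ ≃o ℝ) (t : BinaryTree Unit) :
    HasWord {y₀, y₁} (4 * t.numNodes) (expand y₀ y₁ t) := by
  cases t with
  | nil => exact .one _
  | node a l r =>
    refine (hasWord_expandNode y₀ y₁ l r).mono ?_
    simp only [BinaryTree.numNodes]; omega

include h

/-- Every diagram is realized by a word whose length is at most linear in the number of carets. -/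
theorem exists_hasWord_isDiagram {f : ℝ ≃o ℝ} {P Q : BinaryTree Unit} (hf : IsDiagram cell f P Q) :
    ∃ g, HasWord {y₀, y₁} (8 * P.numNodes) g ∧ IsDiagram cell g P Q := by
  have hn : P.numNodes = Q.numNodes := by
    have := hf.length_eq
    rw [leaves_length, leaves_length] at this
    omega
  refine ⟨(expand y₀ y₁ Q)⁻¹ * expand y₀ y₁ P,
    ((hasWord_expand y₀ y₁ Q).inv.mul (hasWord_expand y₀ y₁ P)).mono (by omega), ?_⟩
  have h1 : List.Forall₂ (Carries cell _) _ _ := h.isDiagram_expand P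
  have h2 : List.Forall₂ (Carries cell _) _ _ := (h.isDiagram_expand Q).inv
  rw [← hn] at h2
  exact forall₂_trans (fun _ _ _ h3 h4 => h4.mul h3) h1 h2

end IsGeneratorPair

/-! ## Repeated halving of an interval -/

/-- The position of a vertex among the vertices of the same level. -/
def levelIndex : List Bool → ℕ
  | [] => 0
  | false :: u => levelIndex u
  | true :: u => 2 ^ u.length + levelIndex u

theorem exists_levelIndex_eq (k i : ℕ) (hi : i < 2 ^ k) :
    ∃ u : List Bool, u.length = k ∧ levelIndex u = i := by
  induction k generalizing i with
  | zero => exact ⟨[], rfl, by simp at hi; simp [levelIndex, hi]⟩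
  | succ k ih =>
    rcases lt_or_ge i (2 ^ k) with h | h
    · obtain ⟨u, hu, rfl⟩ := ih i h
      exact ⟨false :: u, by simp [hu], rfl⟩
    · obtain ⟨u, hu, hi'⟩ := ih (i - 2 ^ k) (by rw [pow_succ] at hi; omega)
      exact ⟨true :: u, by simp [hu], by rw [levelIndex, hu, hi']; omega⟩

theorem levelIndex_lt (u : List Bool) : levelIndex u < 2 ^ u.length := by
  induction u with
  | nil => simp [levelIndex]
  | cons b u ih => cases b <;> simp only [levelIndex, List.length_cons, pow_succ] <;> omega

theorem halvesCell_append (a b : ℝ) (u w : List Bool) :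
    halvesCell a b (u ++ w) = halvesCell (a + levelIndex u / 2 ^ u.length * (b - a))
      (a + (levelIndex u + 1) / 2 ^ u.length * (b - a)) w := by
  induction u generalizing a b with
  | nil => simp [levelIndex]
  | cons c u ih =>
    have h2 : (2 : ℝ) ^ u.length ≠ 0 := by positivity
    cases c
    · rw [List.cons_append, halvesCell, ih, levelIndex, List.length_cons, pow_succ]
      congr 1 <;> field_simp <;> ring
    · rw [List.cons_append, halvesCell, ih, levelIndex, List.length_cons, pow_succ]
      push_cast
      congr 1 <;> field_simp <;> ring

theorem exists_halvesCell_append {a b : ℝ} (hab : a < b) (u : List Bool) :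
    ∃ a' b', a' < b' ∧ ∀ w, halvesCell a b (u ++ w) = halvesCell a' b' w := by
  refine ⟨_, _, ?_, halvesCell_append a b u⟩
  have h1 : 0 < b - a := sub_pos.2 hab
  gcongr
  linarith

/-- Here `n` is the number of halvings that bring the length of the interval down to `ε`. -/
theorem halvesCell_shrink {ε : ℝ} {x : ℝ} (n : ℕ) {a b : ℝ} (hx : x ∈ Set.Icc a b)
    (h : b - a ≤ 2 ^ n * ε) :
    ∃ w, x ∈ halvesCell a b w ∧ ∀ y ∈ halvesCell a b w, |y - x| ≤ ε := by
  induction n generalizing a b with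
  | zero =>
    refine ⟨[], hx, fun y hy => ?_⟩
    have h1 : y ∈ Set.Icc a b := hy
    rw [abs_le]
    constructor <;> linarith [h1.1, h1.2, hx.1, hx.2]
  | succ n ih =>
    rw [pow_succ] at h
    rcases le_total x ((a + b) / 2) with h1 | h1
    · obtain ⟨w, hw⟩ := ih (a := a) (b := (a + b) / 2) ⟨hx.1, h1⟩ (by linarith)
      exact ⟨false :: w, hw⟩
    · obtain ⟨w, hw⟩ := ih (a := (a + b) / 2) (b := b) ⟨h1, hx.2⟩ (by linarith)
      exact ⟨true :: w, hw⟩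

theorem exists_halvesCell_shrink {a b x ε : ℝ} (hx : x ∈ Set.Icc a b) (hε : 0 < ε) :
    ∃ w, x ∈ halvesCell a b w ∧ ∀ y ∈ halvesCell a b w, |y - x| ≤ ε := by
  obtain ⟨n, hn⟩ := pow_unbounded_of_one_lt ((b - a) / ε) (one_lt_two)
  refine halvesCell_shrink n hx ?_
  rw [div_lt_iff₀ hε] at hn
  exact hn.le

theorem halvesCell_split {a b : ℝ} (h : a < b) :
    halvesCell a b [] = halvesCell a b [false] ∪ halvesCell a b [true] := by
  simp only [halvesCell]
  rw [Set.Icc_union_Icc_eq_Icc] <;> linarith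

/-- The part of the conditions on a system of cells that concerns one vertex. -/
structure IsCellVertex (cell : List Bool → Set ℝ) : Prop where
  split : cell [] = cell [false] ∪ cell [true]
  sep : ∀ x ∈ cell [false], ∀ y ∈ cell [true], x ≤ y
  nontriv : ∃ x ∈ cell [], ∃ y ∈ cell [], x < y
  shrink : ∀ x ∈ cell [], ∀ ε > 0, ∃ w, x ∈ cell w ∧ ∀ y ∈ cell w, |y - x| ≤ ε

theorem isCellSystem_of_isCellVertex {cell : List Bool → Set ℝ}
    (h : ∀ u, IsCellVertex fun w => cell (u ++ w)) : IsCellSystem cell where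
  split u := by simpa using (h u).split
  sep u := (h u).sep
  nontriv u := by simpa using (h u).nontriv
  shrink u := by simpa using (h u).shrink

theorem isCellVertex_halvesCell {a b : ℝ} (h : a < b) : IsCellVertex (halvesCell a b) where
  split := halvesCell_split h
  sep x hx y hy := (show x ∈ Set.Icc a ((a + b) / 2) from hx).2.trans
    (show y ∈ Set.Icc ((a + b) / 2) b from hy).1
  nontriv := ⟨a, ⟨le_rfl, h.le⟩, b, ⟨h.le, le_rfl⟩, h⟩
  shrink _ hx _ hε := exists_halvesCell_shrink hx hε

theorem isCellSystem_unitCell : IsCellSystem unitCell := by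
  refine isCellSystem_of_isCellVertex fun u => ?_
  obtain ⟨a, b, hab, h⟩ := exists_halvesCell_append zero_lt_one u
  rw [show (fun w => unitCell (u ++ w)) = halvesCell a b from funext h]
  exact isCellVertex_halvesCell hab

/-! ## The vertices of the subdivision of the line -/

theorem isCellVertex_rightCell (n : ℝ) : IsCellVertex (rightCell n) where
  split := by
    change Set.Ici n = Set.Icc n (n + 1) ∪ Set.Ici (n + 1)
    rw [Set.Icc_union_Ici_eq_Ici]
    linarith
  sep x hx y hy := (show x ∈ Set.Icc n (n + 1) from hx).2.trans (show y ∈ Set.Ici (n + 1) from hy)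
  nontriv := ⟨n, Set.mem_Ici.2 le_rfl, n + 1, Set.mem_Ici.2 (by linarith), by linarith⟩
  shrink x hx ε hε := by
    -- Induction on the number `k` of unit steps from `n` to `x`: when the walk reaches the box of
    -- `x`, that box is halved repeatedly.
    have key : ∀ (k : ℕ) (n : ℝ), n ≤ x → x ≤ n + k →
        ∃ w, x ∈ rightCell n w ∧ ∀ y ∈ rightCell n w, |y - x| ≤ ε := by
      intro k
      induction k with
      | zero =>
        intro n h1 h2
        obtain ⟨w, hw⟩ := exists_halvesCell_shrink (a := n) (b := n + 1) (x := x)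
          ⟨h1, by simp at h2; linarith⟩ hε
        exact ⟨false :: w, hw⟩
      | succ k ih =>
        intro n h1 h2
        rcases le_total x (n + 1) with h3 | h3
        · obtain ⟨w, hw⟩ := exists_halvesCell_shrink (a := n) (b := n + 1) (x := x) ⟨h1, h3⟩ hε
          exact ⟨false :: w, hw⟩
        · obtain ⟨w, hw⟩ := ih (n + 1) h3 (by push_cast at h2; linarith)
          exact ⟨true :: w, hw⟩
    obtain ⟨k, hk⟩ := exists_nat_ge (x - n)
    exact key k n hx (by linarith)

theorem isCellVertex_leftCell (n : ℝ) : IsCellVertex (leftCell n) where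
  split := by
    change Set.Iic n = Set.Iic (n - 1) ∪ Set.Icc (n - 1) n
    rw [Set.Iic_union_Icc_eq_Iic]
    linarith
  sep x hx y hy := (show x ∈ Set.Iic (n - 1) from hx).trans (show y ∈ Set.Icc (n - 1) n from hy).1
  nontriv := ⟨n - 1, Set.mem_Iic.2 (by linarith), n, Set.mem_Iic.2 le_rfl, by linarith⟩
  shrink x hx ε hε := by
    have key : ∀ (k : ℕ) (n : ℝ), x ≤ n → n ≤ x + k →
        ∃ w, x ∈ leftCell n w ∧ ∀ y ∈ leftCell n w, |y - x| ≤ ε := by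
      intro k
      induction k with
      | zero =>
        intro n h1 h2
        obtain ⟨w, hw⟩ := exists_halvesCell_shrink (a := n - 1) (b := n) (x := x)
          ⟨by simp at h2; linarith, h1⟩ hε
        exact ⟨true :: w, hw⟩
      | succ k ih =>
        intro n h1 h2
        rcases le_total (n - 1) x with h3 | h3
        · obtain ⟨w, hw⟩ := exists_halvesCell_shrink (a := n - 1) (b := n) (x := x) ⟨h3, h1⟩ hε
          exact ⟨true :: w, hw⟩
        · obtain ⟨w, hw⟩ := ih (n - 1) h3 (by push_cast at h2; linarith)
          exact ⟨false :: w, hw⟩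
    obtain ⟨k, hk⟩ := exists_nat_ge (n - x)
    exact key k n hx (by linarith)

/-- The vertex `[k, ∞)`. -/
def rightVertex (k : ℕ) : List Bool := List.replicate (k + 1) true

/-- The vertex `(-∞, -k]`. -/
def leftVertex (k : ℕ) : List Bool := List.replicate (k + 1) false

/-- The vertex `[n, n + 1]`. -/
def unitVertex : ℤ → List Bool
  | Int.ofNat k => rightVertex k ++ [false]
  | Int.negSucc k => leftVertex k ++ [true]

theorem rightCell_replicate_append (n : ℝ) (k : ℕ) (w : List Bool) :
    rightCell n (List.replicate k true ++ w) = rightCell (n + k) w := by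
  induction k generalizing n with
  | zero => simp
  | succ k ih =>
    rw [List.replicate_succ, List.cons_append, rightCell, ih]
    push_cast
    congr 1; ring

theorem leftCell_replicate_append (n : ℝ) (k : ℕ) (w : List Bool) :
    leftCell n (List.replicate k false ++ w) = leftCell (n - k) w := by
  induction k generalizing n with
  | zero => simp
  | succ k ih =>
    rw [List.replicate_succ, List.cons_append, leftCell, ih]
    push_cast
    congr 1; ring

theorem lineCell_rightVertex_append (k : ℕ) (w : List Bool) :
    lineCell (rightVertex k ++ w) = rightCell k w := by
  rw [rightVertex, List.replicate_succ, List.cons_append, lineCell, rightCell_replicate_append,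
    zero_add]

theorem lineCell_leftVertex_append (k : ℕ) (w : List Bool) :
    lineCell (leftVertex k ++ w) = leftCell (-k) w := by
  rw [leftVertex, List.replicate_succ, List.cons_append, lineCell, leftCell_replicate_append,
    zero_sub]

theorem lineCell_unitVertex_append (n : ℤ) (w : List Bool) :
    lineCell (unitVertex n ++ w) = halvesCell n (n + 1) w := by
  cases n with
  | ofNat k =>
    rw [unitVertex, List.append_assoc, lineCell_rightVertex_append]
    simp [rightCell]
  | negSucc k =>
    rw [unitVertex, List.append_assoc, lineCell_leftVertex_append]
    simp only [List.cons_append, List.nil_append, leftCell, Int.cast_negSucc]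
    push_cast
    congr 1 <;> ring

theorem exists_eq_replicate (b : Bool) (u : List Bool) :
    ∃ k, u = List.replicate k b ∨ ∃ w, u = List.replicate k b ++ (!b) :: w := by
  induction u with
  | nil => exact ⟨0, .inl rfl⟩
  | cons c u ih =>
    by_cases hbc : c = b
    · subst hbc
      obtain ⟨k, rfl | ⟨w, rfl⟩⟩ := ih
      · exact ⟨k + 1, .inl rfl⟩
      · exact ⟨k + 1, .inr ⟨w, rfl⟩⟩
    · refine ⟨0, .inr ⟨u, ?_⟩⟩
      rw [Bool.eq_not_of_ne hbc]
      rfl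

/-- The initial run of equal turns decides the type: a vertex that never leaves a side is the line
or a half-line, and otherwise it lies in the box entered at the first change of turn. -/
theorem lineVertex_cases (u : List Bool) : u = [] ∨ (∃ k, u = rightVertex k) ∨
    (∃ k, u = leftVertex k) ∨ ∃ n w, u = unitVertex n ++ w := by
  match u with
  | [] => exact .inl rfl
  | true :: u =>
    obtain ⟨k, rfl | ⟨w, rfl⟩⟩ := exists_eq_replicate true u
    · exact .inr (.inl ⟨k, rfl⟩)
    · refine .inr (.inr (.inr ⟨k, w, ?_⟩))
      change _ = (rightVertex k ++ [false]) ++ w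
      simp [rightVertex, List.replicate_succ]
  | false :: u =>
    obtain ⟨k, rfl | ⟨w, rfl⟩⟩ := exists_eq_replicate false u
    · exact .inr (.inr (.inl ⟨k, rfl⟩))
    · refine .inr (.inr (.inr ⟨Int.negSucc k, w, ?_⟩))
      simp [unitVertex, leftVertex, List.replicate_succ]

theorem isCellSystem_lineCell : IsCellSystem lineCell := by
  refine isCellSystem_of_isCellVertex fun u => ?_
  rcases lineVertex_cases u with rfl | ⟨k, rfl⟩ | ⟨k, rfl⟩ | ⟨n, u, rfl⟩
  · have hR := isCellVertex_rightCell 0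
    have hL := isCellVertex_leftCell 0
    refine ⟨?_, ?_, ⟨0, trivial, 1, trivial, one_pos⟩, ?_⟩
    · exact Set.Iic_union_Ici.symm
    · exact fun x hx y hy => (show x ∈ Set.Iic (0 : ℝ) from hx).trans hy
    · intro x _ ε hε
      rcases le_total 0 x with h | h
      · obtain ⟨w, hw⟩ := hR.shrink x h ε hε
        exact ⟨true :: w, hw⟩
      · obtain ⟨w, hw⟩ := hL.shrink x h ε hε
        exact ⟨false :: w, hw⟩
  · rw [show (fun w => lineCell (rightVertex k ++ w)) = rightCell k from
      funext (lineCell_rightVertex_append k)]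
    exact isCellVertex_rightCell k
  · rw [show (fun w => lineCell (leftVertex k ++ w)) = leftCell (-k) from
      funext (lineCell_leftVertex_append k)]
    exact isCellVertex_leftCell _
  · obtain ⟨a, b, hab, h⟩ := exists_halvesCell_append (show (n : ℝ) < n + 1 by linarith) u
    have : (fun w => lineCell (unitVertex n ++ u ++ w)) = halvesCell a b := by
      funext w
      rw [List.append_assoc, lineCell_unitVertex_append, h]
    rw [this]
    exact isCellVertex_halvesCell hab

theorem lineCell_rightVertex (k : ℕ) : lineCell (rightVertex k) = Set.Ici (k : ℝ) := by
  simpa [rightCell] using lineCell_rightVertex_append k []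

theorem lineCell_leftVertex (k : ℕ) : lineCell (leftVertex k) = Set.Iic (-k : ℝ) := by
  simpa [leftCell] using lineCell_leftVertex_append k []

theorem lineCell_unitVertex_subset (n : ℤ) (w : List Bool) :
    lineCell (unitVertex n ++ w) ⊆ Set.Icc (n : ℝ) (n + 1) := by
  refine (isCellSystem_lineCell.append_subset _ w).trans ?_
  have h := lineCell_unitVertex_append n []
  rw [List.append_nil] at h
  rw [h]
  exact subset_rfl

/-- Boundedness above and below separates right half-lines, left half-lines and cells inside boxes.
Homeomorphisms that preserve order also preserve it, so a carried vertex keeps its type. -/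
theorem bddAbove_lineCell_iff (u : List Bool) :
    BddAbove (lineCell u) ↔ (∃ k, u = leftVertex k) ∨ ∃ n w, u = unitVertex n ++ w := by
  constructor
  · intro h
    rcases lineVertex_cases u with rfl | ⟨k, rfl⟩ | h' | h'
    · exact absurd h not_bddAbove_univ
    · rw [lineCell_rightVertex] at h
      exact absurd h (not_bddAbove_Ici _)
    · exact .inl h'
    · exact .inr h'
  · rintro (⟨k, rfl⟩ | ⟨n, w, rfl⟩)
    · rw [lineCell_leftVertex]; exact bddAbove_Iic
    · exact bddAbove_Icc.mono (lineCell_unitVertex_subset n w)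

theorem bddBelow_lineCell_iff (u : List Bool) :
    BddBelow (lineCell u) ↔ (∃ k, u = rightVertex k) ∨ ∃ n w, u = unitVertex n ++ w := by
  constructor
  · intro h
    rcases lineVertex_cases u with rfl | h' | ⟨k, rfl⟩ | h'
    · exact absurd h not_bddBelow_univ
    · exact .inl h'
    · rw [lineCell_leftVertex] at h
      exact absurd h (not_bddBelow_Iic _)
    · exact .inr h'
  · rintro (⟨k, rfl⟩ | ⟨n, w, rfl⟩)
    · rw [lineCell_rightVertex]; exact bddBelow_Ici
    · exact bddBelow_Icc.mono (lineCell_unitVertex_subset n w)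

section

variable {f : ℝ ≃o ℝ} {u v : List Bool}

theorem Carries.bddAbove_iff {cell : List Bool → Set ℝ} (h : Carries cell f u v) :
    BddAbove (cell v) ↔ BddAbove (cell u) := by
  rw [← h.image_eq, OrderIso.bddAbove_image]

theorem Carries.bddBelow_iff {cell : List Bool → Set ℝ} (h : Carries cell f u v) :
    BddBelow (cell v) ↔ BddBelow (cell u) := by
  rw [← h.image_eq, OrderIso.bddBelow_image]

theorem Carries.exists_rightVertex {k : ℕ} (h : Carries lineCell f (rightVertex k) v) :
    ∃ m, v = rightVertex m := by
  have h1 : BddBelow (lineCell v) := by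
    rw [h.bddBelow_iff, bddBelow_lineCell_iff]
    exact .inl ⟨k, rfl⟩
  rcases (bddBelow_lineCell_iff v).1 h1 with h2 | h2
  · exact h2
  · have h3 := (bddAbove_lineCell_iff v).2 (.inr h2)
    rw [h.bddAbove_iff, lineCell_rightVertex] at h3
    exact absurd h3 (not_bddAbove_Ici _)

theorem Carries.exists_leftVertex {k : ℕ} (h : Carries lineCell f (leftVertex k) v) :
    ∃ m, v = leftVertex m := by
  have h1 : BddAbove (lineCell v) := by
    rw [h.bddAbove_iff, bddAbove_lineCell_iff]
    exact .inl ⟨k, rfl⟩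
  rcases (bddAbove_lineCell_iff v).1 h1 with h2 | h2
  · exact h2
  · have h3 := (bddBelow_lineCell_iff v).2 (.inr h2)
    rw [h.bddBelow_iff, lineCell_leftVertex] at h3
    exact absurd h3 (not_bddBelow_Iic _)

theorem Carries.exists_unitVertex {n : ℤ} (h : Carries lineCell f (unitVertex n ++ u) v) :
    ∃ m w, v = unitVertex m ++ w := by
  have h1 := h.bddAbove_iff.2 ((bddAbove_lineCell_iff _).2 (.inr ⟨n, u, rfl⟩))
  have h2 := h.bddBelow_iff.2 ((bddBelow_lineCell_iff _).2 (.inr ⟨n, u, rfl⟩))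
  rcases (bddAbove_lineCell_iff v).1 h1 with ⟨k, rfl⟩ | h1
  · rw [lineCell_leftVertex] at h2
    exact absurd h2 (not_bddBelow_Iic _)
  · exact h1

/-! ## Affine maps between cells -/

/-- An affine map sends midpoints to midpoints, hence matches all halvings. -/
theorem image_halvesCell {a b : ℝ} (hab : a ≤ b) {s c : ℝ} (hf : ∀ t ∈ Set.Icc a b, f t = s * t + c)
    (w : List Bool) : f '' halvesCell a b w = halvesCell (f a) (f b) w := by
  induction w generalizing a b with
  | nil => exact f.image_Icc a b
  | cons e w ih =>
    have hm : f ((a + b) / 2) = (f a + f b) / 2 := by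
      rw [hf _ ⟨le_rfl, hab⟩, hf _ ⟨hab, le_rfl⟩, hf _ ⟨by linarith, by linarith⟩]
      ring
    cases e
    · rw [halvesCell, halvesCell, ih (by linarith) fun t ht => hf t ⟨ht.1, by linarith [ht.2]⟩, hm]
    · rw [halvesCell, halvesCell, ih (by linarith) fun t ht => hf t ⟨by linarith [ht.1], ht.2⟩, hm]

theorem image_rightCell {n k : ℝ} (hf : ∀ t, n ≤ t → f t = t + k) (w : List Bool) :
    f '' rightCell n w = rightCell (n + k) w := by
  induction w generalizing n with
  | nil =>
    rw [rightCell, f.image_Ici, hf n le_rfl]; rfl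
  | cons e w ih =>
    cases e
    · rw [rightCell, rightCell, image_halvesCell (s := 1) (c := k) (by linarith)
        fun t ht => by rw [hf t ht.1]; ring]
      rw [hf _ le_rfl, hf _ (by linarith)]
      congr 1; ring
    · rw [rightCell, rightCell, ih fun t ht => hf t (by linarith)]
      congr 1; ring

theorem image_leftCell {n k : ℝ} (hf : ∀ t, t ≤ n → f t = t + k) (w : List Bool) :
    f '' leftCell n w = leftCell (n + k) w := by
  induction w generalizing n with
  | nil =>
    rw [leftCell, f.image_Iic, hf n le_rfl]; rfl
  | cons e w ih =>
    cases e
    · rw [leftCell, leftCell, ih fun t ht => hf t (by linarith)]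
      congr 1; ring
    · rw [leftCell, leftCell, image_halvesCell (s := 1) (c := k) (by linarith)
        fun t ht => by rw [hf t ht.2]; ring]
      rw [hf _ le_rfl, hf _ (by linarith)]
      congr 1; ring

theorem carries_of_affine {cell : List Bool → Set ℝ} {a b c d s e : ℝ}
    (hu : ∀ w, cell (u ++ w) = halvesCell a b w) (hv : ∀ w, cell (v ++ w) = halvesCell c d w)
    (hab : a ≤ b) (hf : ∀ t ∈ Set.Icc a b, f t = s * t + e) (ha : s * a + e = c)
    (hb : s * b + e = d) : Carries cell f u v := by
  intro w
  rw [hu, hv, image_halvesCell hab hf, hf a ⟨le_rfl, hab⟩, hf b ⟨hab, le_rfl⟩, ha, hb]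

theorem carries_rightVertex {k m : ℕ} (hf : ∀ t, (k : ℝ) ≤ t → f t = t + ((m : ℝ) - k)) :
    Carries lineCell f (rightVertex k) (rightVertex m) := by
  intro w
  rw [lineCell_rightVertex_append, lineCell_rightVertex_append, image_rightCell hf]
  congr 1; ring

theorem carries_leftVertex {k m : ℕ} (hf : ∀ t, t ≤ (-k : ℝ) → f t = t + ((k : ℝ) - m)) :
    Carries lineCell f (leftVertex k) (leftVertex m) := by
  intro w
  rw [lineCell_leftVertex_append, lineCell_leftVertex_append, image_leftCell hf]
  congr 1; ring

/-- The translation by `m - k` carries the same vertices, and maps carrying one vertex to the same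
vertex agree on its cell. So carrying a half-line is the same as being an integer translation there.
-/
theorem apply_of_carries_rightVertex {k m : ℕ}
    (h : Carries lineCell f (rightVertex k) (rightVertex m)) {t : ℝ} (ht : (k : ℝ) ≤ t) :
    f t = t + ((m : ℤ) - (k : ℤ) : ℤ) := by
  have h1 : Carries lineCell (OrderIso.addRight ((m : ℝ) - k)) (rightVertex k) (rightVertex m) :=
    carries_rightVertex fun t _ => rfl
  have h2 := h.eqOn isCellSystem_lineCell h1 (x := t) (by rw [lineCell_rightVertex]; exact ht)
  rw [h2]
  push_cast
  rfl

theorem apply_of_carries_leftVertex {k m : ℕ}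
    (h : Carries lineCell f (leftVertex k) (leftVertex m)) {t : ℝ} (ht : t ≤ (-k : ℝ)) :
    f t = t + ((k : ℤ) - (m : ℤ) : ℤ) := by
  have h1 : Carries lineCell (OrderIso.addRight ((k : ℝ) - m)) (leftVertex k) (leftVertex m) :=
    carries_leftVertex fun t _ => rfl
  have h2 := h.eqOn isCellSystem_lineCell h1 (x := t) (by rw [lineCell_leftVertex]; exact ht)
  rw [h2]
  push_cast
  rfl

end

/-! ## The generators of `F_x` and `F_w` -/

/-- The formula holds on the closed box; at its right end, where the integer part jumps, it relies
on `a 0 = 0` and `a 1 = 1`. -/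
theorem periodicExt_apply {a : ℝ → ℝ} (h0 : a 0 = 0) (h1 : a 1 = 1) (j : ℤ) {t : ℝ}
    (ht : t ∈ Set.Icc (j : ℝ) (j + 1)) : periodicExt a t = j + a (t - j) := by
  rcases ht.2.lt_or_eq with h | rfl
  · have hf : ⌊t⌋ = j := Int.floor_eq_iff.2 ⟨ht.1, h⟩
    rw [periodicExt, Int.fract, hf]
  · rw [periodicExt, Int.fract_add_one, Int.floor_add_one, Int.floor_intCast, Int.fract_intCast]
    push_cast
    rw [add_sub_cancel_left, h0, h1, add_zero]

theorem w0_apply (j : ℤ) {t : ℝ} (ht : t ∈ Set.Icc (j : ℝ) (j + 1)) : w0 t = j + u0 (t - j) :=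
  periodicExt_apply (by norm_num [u0]) (by norm_num [u0]) j ht

theorem w1_apply (j : ℤ) {t : ℝ} (ht : t ∈ Set.Icc (j : ℝ) (j + 1)) : w1 t = j + u1 (t - j) :=
  periodicExt_apply (by norm_num [u1, u0]) (by norm_num [u1, u0]) j ht

theorem isGeneratorPair_x : IsGeneratorPair lineCell x0 x1 where
  y0_ff := carries_leftVertex (k := 1) (m := 0) fun t _ => by simp [x0]
  y0_ft := by
    refine carries_of_affine (a := -1) (b := 0) (c := 0) (d := 1) (s := 1) (e := 1) ?_ ?_ (by norm_num) ?_
      (by norm_num) (by norm_num)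
    · intro w; simp [lineCell, leftCell]
    · intro w; simp [lineCell, rightCell]
    · intro t _; simp [x0]
  y0_t := carries_rightVertex (k := 0) (m := 1) fun t _ => by simp [x0]
  y1_f := carries_leftVertex (k := 0) (m := 0) fun t ht => by
    change x1Fun t = _
    simp at ht
    simp [x1Fun, ht]
  y1_tff := by
    refine carries_of_affine (a := 0) (b := 1 / 2) (c := 0) (d := 1) (s := 2) (e := 0) ?_ ?_ (by norm_num) ?_
      (by norm_num) (by norm_num)
    · intro w; simp [lineCell, rightCell, halvesCell]
    · intro w; simp [lineCell, rightCell]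
    · intro t ht
      change x1Fun t = _
      unfold x1Fun
      split_ifs <;> linarith [ht.1, ht.2]
  y1_tft := by
    refine carries_of_affine (a := 1 / 2) (b := 1) (c := 1) (d := 2) (s := 2) (e := 0) ?_ ?_ (by norm_num) ?_
      (by norm_num) (by norm_num)
    · intro w; simp [lineCell, rightCell, halvesCell]
    · intro w; norm_num [lineCell, rightCell]
    · intro t ht
      change x1Fun t = _
      unfold x1Fun
      split_ifs <;> linarith [ht.1, ht.2]
  y1_tt := carries_rightVertex (k := 1) (m := 2) fun t ht => by
    change x1Fun t = _
    unfold x1Fun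
    push_cast at ht ⊢
    split_ifs <;> linarith

theorem isGeneratorPair_w : IsGeneratorPair unitCell w0 w1 := by
  have key0 : ∀ (u v : List Bool) (a b c d s e : ℝ), (∀ w, unitCell (u ++ w) = halvesCell a b w) →
      (∀ w, unitCell (v ++ w) = halvesCell c d w) → 0 ≤ a → a ≤ b → b ≤ 1 →
      (∀ t ∈ Set.Icc a b, u0 t = s * t + e) → s * a + e = c → s * b + e = d →
      Carries unitCell w0 u v := by
    intro u v a b c d s e hu hv h0 hab h1 hf ha hb
    refine carries_of_affine hu hv hab (fun t ht => ?_) ha hb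
    rw [w0_apply 0 ⟨by push_cast; linarith [ht.1], by push_cast; linarith [ht.2]⟩, ← hf t ht]
    simp
  have key1 : ∀ (u v : List Bool) (a b c d s e : ℝ), (∀ w, unitCell (u ++ w) = halvesCell a b w) →
      (∀ w, unitCell (v ++ w) = halvesCell c d w) → 0 ≤ a → a ≤ b → b ≤ 1 →
      (∀ t ∈ Set.Icc a b, u1 t = s * t + e) → s * a + e = c → s * b + e = d →
      Carries unitCell w1 u v := by
    intro u v a b c d s e hu hv h0 hab h1 hf ha hb
    refine carries_of_affine hu hv hab (fun t ht => ?_) ha hb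
    rw [w1_apply 0 ⟨by push_cast; linarith [ht.1], by push_cast; linarith [ht.2]⟩, ← hf t ht]
    simp
  constructor
  · refine key0 _ _ 0 (1 / 4) 0 (1 / 2) 2 0 ?_ ?_ (by norm_num) (by norm_num) (by norm_num) ?_
      (by norm_num) (by norm_num)
    · intro w; norm_num [unitCell, halvesCell]
    · intro w; norm_num [unitCell, halvesCell]
    · rintro t ⟨h1, h2⟩
      unfold u0
      split_ifs <;> linarith
  · refine key0 _ _ (1 / 4) (1 / 2) (1 / 2) (3 / 4) 1 (1 / 4) ?_ ?_ (by norm_num) (by norm_num) (by norm_num) ?_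
      (by norm_num) (by norm_num)
    · intro w; norm_num [unitCell, halvesCell]
    · intro w; norm_num [unitCell, halvesCell]
    · rintro t ⟨h1, h2⟩
      unfold u0
      split_ifs <;> linarith
  · refine key0 _ _ (1 / 2) 1 (3 / 4) 1 (1 / 2) (1 / 2) ?_ ?_ (by norm_num) (by norm_num) (by norm_num) ?_
      (by norm_num) (by norm_num)
    · intro w; norm_num [unitCell, halvesCell]
    · intro w; norm_num [unitCell, halvesCell]
    · rintro t ⟨h1, h2⟩
      unfold u0
      split_ifs <;> linarith
  · refine key1 _ _ 0 (1 / 2) 0 (1 / 2) 1 0 ?_ ?_ (by norm_num) (by norm_num) (by norm_num) ?_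
      (by norm_num) (by norm_num)
    · intro w; norm_num [unitCell, halvesCell]
    · intro w; norm_num [unitCell, halvesCell]
    · rintro t ⟨h1, h2⟩
      unfold u1 u0
      split_ifs <;> linarith
  · refine key1 _ _ (1 / 2) (5 / 8) (1 / 2) (3 / 4) 2 (-1 / 2) ?_ ?_ (by norm_num) (by norm_num) (by norm_num) ?_
      (by norm_num) (by norm_num)
    · intro w; norm_num [unitCell, halvesCell]
    · intro w; norm_num [unitCell, halvesCell]
    · rintro t ⟨h1, h2⟩
      unfold u1 u0
      split_ifs <;> linarith
  · refine key1 _ _ (5 / 8) (3 / 4) (3 / 4) (7 / 8) 1 (1 / 8) ?_ ?_ (by norm_num) (by norm_num) (by norm_num) ?_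
      (by norm_num) (by norm_num)
    · intro w; norm_num [unitCell, halvesCell]
    · intro w; norm_num [unitCell, halvesCell]
    · rintro t ⟨h1, h2⟩
      unfold u1 u0
      split_ifs <;> linarith
  · refine key1 _ _ (3 / 4) 1 (7 / 8) 1 (1 / 2) (1 / 2) ?_ ?_ (by norm_num) (by norm_num) (by norm_num) ?_
      (by norm_num) (by norm_num)
    · intro w; norm_num [unitCell, halvesCell]
    · intro w; norm_num [unitCell, halvesCell]
    · rintro t ⟨h1, h2⟩
      unfold u1 u0
      split_ifs <;> linarith

/-! ## Dyadic rationals -/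

theorem intCast_mem_dyadics (n : ℤ) : (n : ℝ) ∈ dyadics := ⟨n, 0, by simp⟩

theorem add_mem_dyadics {x y : ℝ} (hx : x ∈ dyadics) (hy : y ∈ dyadics) : x + y ∈ dyadics := by
  obtain ⟨m, k, rfl⟩ := hx
  obtain ⟨n, l, rfl⟩ := hy
  refine ⟨m * 2 ^ l + n * 2 ^ k, k + l, ?_⟩
  push_cast
  rw [pow_add]
  field_simp

theorem neg_mem_dyadics {x : ℝ} (hx : x ∈ dyadics) : -x ∈ dyadics := by
  obtain ⟨m, k, rfl⟩ := hx
  exact ⟨-m, k, by push_cast; ring⟩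

theorem zpow_mul_mem_dyadics {x : ℝ} (k : ℤ) (hx : x ∈ dyadics) : (2 : ℝ) ^ k * x ∈ dyadics := by
  obtain ⟨m, l, rfl⟩ := hx
  cases k with
  | ofNat k => exact ⟨2 ^ k * m, l, by push_cast; simp; ring⟩
  | negSucc k =>
    refine ⟨m, l + (k + 1), ?_⟩
    rw [zpow_negSucc]
    field_simp
    ring

theorem exists_eq_div_pow {x : ℝ} (hx : x ∈ dyadics) :
    ∀ᶠ k : ℕ in atTop, ∃ i : ℤ, x = i / 2 ^ k := by
  obtain ⟨m, l, rfl⟩ := hx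
  filter_upwards [eventually_ge_atTop l] with k hk
  obtain ⟨j, rfl⟩ := Nat.exists_eq_add_of_le hk
  refine ⟨m * 2 ^ j, ?_⟩
  push_cast
  rw [pow_add]
  field_simp

/-- A map that is affine with a power of two as slope and a dyadic constant term on every interval
`[n/8, (n+1)/8]` is in `PL₂⁺(ℝ)`. -/
theorem mem_PL2Plus_of_eighths {f : ℝ ≃o ℝ} (h : ∀ n : ℤ, ∃ (k : ℤ) (c : ℝ), c ∈ dyadics ∧
    ∀ t ∈ Set.Icc ((n : ℝ) / 8) ((n + 1 : ℝ) / 8), f t = 2 ^ k * t + c) : f ∈ PL2Plus := by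
  refine ⟨fun x => ?_, Set.range fun n : ℤ => (n : ℝ) / 8, ?_, ?_, ?_⟩
  · obtain ⟨k, c, hc, hf⟩ := h ⌊8 * x⌋
    have h1 := Int.floor_le (8 * x)
    have h2 := Int.lt_floor_add_one (8 * x)
    rw [hf x ⟨by linarith, by linarith⟩]
    constructor
    · intro hx
      have h3 := zpow_mul_mem_dyadics (-k) (add_mem_dyadics hx (neg_mem_dyadics hc))
      rwa [add_neg_cancel_right, ← mul_assoc, ← zpow_add₀ two_ne_zero, neg_add_cancel, zpow_zero,
        one_mul] at h3
    · exact fun hx => add_mem_dyadics (zpow_mul_mem_dyadics k hx) hc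
  · rintro _ ⟨n, rfl⟩
    exact ⟨n, 3, by norm_num⟩
  · intro a b
    refine ((Set.finite_Icc ⌈8 * a⌉ ⌊8 * b⌋).image fun n : ℤ => (n : ℝ) / 8).subset ?_
    rintro _ ⟨⟨n, rfl⟩, h1, h2⟩
    refine ⟨n, ⟨Int.ceil_le.2 ?_, Int.le_floor.2 ?_⟩, rfl⟩ <;> linarith
  · intro a b hab hdis
    obtain ⟨k, c, -, hf⟩ := h ⌊8 * a⌋
    have h1 := Int.floor_le (8 * a)
    have h2 := Int.lt_floor_add_one (8 * a)
    have h3 : b ≤ ((⌊8 * a⌋ : ℝ) + 1) / 8 := by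
      by_contra h4
      have h5 : ((⌊8 * a⌋ : ℝ) + 1) / 8 ∈ Set.Ioo a b := ⟨by linarith, by linarith⟩
      exact Set.disjoint_left.1 hdis h5 ⟨⌊8 * a⌋ + 1, by push_cast; rfl⟩
    refine ⟨k, fun s hs t ht => ?_⟩
    rw [hf s ⟨by linarith [hs.1], hs.2.trans h3⟩, hf t ⟨by linarith [ht.1], ht.2.trans h3⟩]
    ring

theorem x0_mem_PL2Plus : x0 ∈ PL2Plus :=
  mem_PL2Plus_of_eighths fun n => ⟨0, 1, by simpa using intCast_mem_dyadics 1,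
    fun t _ => by simp [x0]⟩

theorem x1_mem_PL2Plus : x1 ∈ PL2Plus := by
  refine mem_PL2Plus_of_eighths fun n => ?_
  have h0 : (0 : ℝ) ∈ dyadics := by simpa using intCast_mem_dyadics 0
  have h1 : (1 : ℝ) ∈ dyadics := by simpa using intCast_mem_dyadics 1
  rcases lt_or_ge n 0 with hn | hn
  · refine ⟨0, 0, h0, fun t ht => ?_⟩
    have hn' : (n : ℝ) + 1 ≤ 0 := by exact_mod_cast hn
    change x1Fun t = _
    have : t ≤ 0 := by linarith [ht.2]
    simp [x1Fun, this]
  · have hn0 : (0 : ℝ) ≤ n := by exact_mod_cast hn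
    rcases lt_or_ge n 8 with hn' | hn'
    · refine ⟨1, 0, h0, fun t ht => ?_⟩
      have hn1 : (n : ℝ) + 1 ≤ 8 := by exact_mod_cast hn'
      change x1Fun t = _
      rw [zpow_one]
      unfold x1Fun
      split_ifs <;> linarith [ht.1, ht.2]
    · refine ⟨0, 1, h1, fun t ht => ?_⟩
      have hn1 : (8 : ℝ) ≤ n := by exact_mod_cast hn'
      change x1Fun t = _
      rw [zpow_zero]
      unfold x1Fun
      split_ifs <;> linarith [ht.1, ht.2]

theorem x0_mem_Fx : x0 ∈ Fx :=
  ⟨x0_mem_PL2Plus, ⟨1, by simp [x0]⟩, 1, by simp [x0]⟩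

theorem x1_mem_Fx : x1 ∈ Fx := by
  refine ⟨x1_mem_PL2Plus, ⟨1, ?_⟩, 0, ?_⟩
  · filter_upwards [eventually_ge_atTop 2] with t ht
    change x1Fun t = _
    unfold x1Fun
    push_cast
    split_ifs <;> linarith
  · filter_upwards [eventually_le_atBot 0] with t ht
    change x1Fun t = _
    simp [x1Fun, ht]

/-- The quotient of `n` by 8 is the box and the remainder the eighth inside it. Eighths suffice for
the generators, since their breakpoints all lie in $\frac18\mathbb Z$. -/
theorem mem_Icc_sub_of_mem_eighth {n : ℤ} {t : ℝ} (ht : t ∈ Set.Icc ((n : ℝ) / 8) ((n + 1 : ℝ) / 8)) :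
    t ∈ Set.Icc (((n / 8 : ℤ)) : ℝ) ((n / 8 : ℤ) + 1) ∧
      ((n % 8 : ℤ) : ℝ) / 8 ≤ t - (n / 8 : ℤ) ∧ t - (n / 8 : ℤ) ≤ ((n % 8 : ℤ) + 1 : ℝ) / 8 := by
  have h1 : (n : ℝ) = 8 * (n / 8 : ℤ) + (n % 8 : ℤ) := by
    exact_mod_cast (Int.mul_ediv_add_emod n 8).symm
  have h2 : (0 : ℝ) ≤ (n % 8 : ℤ) := by exact_mod_cast Int.emod_nonneg n (by norm_num)
  have h3 : ((n % 8 : ℤ) : ℝ) + 1 ≤ 8 := by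
    exact_mod_cast Int.emod_lt_of_pos n (by norm_num)
  rw [h1] at ht
  obtain ⟨h4, h5⟩ := ht
  refine ⟨⟨?_, ?_⟩, ?_, ?_⟩ <;> linarith

theorem w0_mem_PL2Plus : w0 ∈ PL2Plus := by
  refine mem_PL2Plus_of_eighths fun n => ?_
  have h4 : (1 / 4 : ℝ) ∈ dyadics := ⟨1, 2, by norm_num⟩
  have hj := intCast_mem_dyadics (n / 8)
  rcases lt_or_ge (n % 8) 2 with h | h
  · refine ⟨1, -(n / 8 : ℤ), neg_mem_dyadics hj, fun t ht => ?_⟩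
    obtain ⟨h1, h2, h3⟩ := mem_Icc_sub_of_mem_eighth ht
    have h5 : ((n % 8 : ℤ) : ℝ) + 1 ≤ 2 := by exact_mod_cast h
    rw [w0_apply _ h1, zpow_one]
    unfold u0
    split_ifs <;> linarith
  · have h6 : (2 : ℝ) ≤ (n % 8 : ℤ) := by exact_mod_cast h
    rcases lt_or_ge (n % 8) 4 with h' | h'
    · refine ⟨0, 1 / 4, h4, fun t ht => ?_⟩
      obtain ⟨h1, h2, h3⟩ := mem_Icc_sub_of_mem_eighth ht
      have h5 : ((n % 8 : ℤ) : ℝ) + 1 ≤ 4 := by exact_mod_cast h'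
      rw [w0_apply _ h1, zpow_zero]
      unfold u0
      split_ifs <;> linarith
    · have h5 : (4 : ℝ) ≤ (n % 8 : ℤ) := by exact_mod_cast h'
      refine ⟨-1, ((n / 8 + 1 : ℤ) : ℝ) / 2 ^ 1, ⟨_, _, rfl⟩, fun t ht => ?_⟩
      obtain ⟨h1, h2, h3⟩ := mem_Icc_sub_of_mem_eighth ht
      rw [w0_apply _ h1, zpow_neg_one]
      unfold u0
      push_cast at *
      split_ifs <;> linarith

theorem w1_mem_PL2Plus : w1 ∈ PL2Plus := by
  refine mem_PL2Plus_of_eighths fun n => ?_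
  have h8 : (1 / 8 : ℝ) ∈ dyadics := ⟨1, 3, by norm_num⟩
  have hh : (-1 / 2 : ℝ) ∈ dyadics := ⟨-1, 1, by norm_num⟩
  have h0 : (0 : ℝ) ∈ dyadics := by simpa using intCast_mem_dyadics 0
  have hj := intCast_mem_dyadics (n / 8)
  rcases lt_or_ge (n % 8) 4 with h | h
  · refine ⟨0, 0, h0, fun t ht => ?_⟩
    obtain ⟨h1, h2, h3⟩ := mem_Icc_sub_of_mem_eighth ht
    have h5 : ((n % 8 : ℤ) : ℝ) + 1 ≤ 4 := by exact_mod_cast h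
    rw [w1_apply _ h1, zpow_zero]
    unfold u1
    split_ifs <;> linarith
  have h6 : (4 : ℝ) ≤ (n % 8 : ℤ) := by exact_mod_cast h
  rcases lt_or_ge (n % 8) 5 with h' | h'
  · refine ⟨1, -1 / 2 + -(n / 8 : ℤ), add_mem_dyadics hh (neg_mem_dyadics hj), fun t ht => ?_⟩
    obtain ⟨h1, h2, h3⟩ := mem_Icc_sub_of_mem_eighth ht
    have h5 : ((n % 8 : ℤ) : ℝ) + 1 ≤ 5 := by exact_mod_cast h'
    rw [w1_apply _ h1, zpow_one]
    unfold u1 u0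
    split_ifs <;> linarith
  have h7 : (5 : ℝ) ≤ (n % 8 : ℤ) := by exact_mod_cast h'
  rcases lt_or_ge (n % 8) 6 with h'' | h''
  · refine ⟨0, 1 / 8, h8, fun t ht => ?_⟩
    obtain ⟨h1, h2, h3⟩ := mem_Icc_sub_of_mem_eighth ht
    have h5 : ((n % 8 : ℤ) : ℝ) + 1 ≤ 6 := by exact_mod_cast h''
    rw [w1_apply _ h1, zpow_zero]
    unfold u1 u0
    split_ifs <;> linarith
  · have h5 : (6 : ℝ) ≤ (n % 8 : ℤ) := by exact_mod_cast h''
    refine ⟨-1, ((n / 8 + 1 : ℤ) : ℝ) / 2 ^ 1, ⟨_, _, rfl⟩, fun t ht => ?_⟩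
    obtain ⟨h1, h2, h3⟩ := mem_Icc_sub_of_mem_eighth ht
    rw [w1_apply _ h1, zpow_neg_one]
    unfold u1 u0
    push_cast at *
    split_ifs <;> linarith

theorem periodicExt_add_one (a : ℝ → ℝ) (t : ℝ) : periodicExt a (t + 1) = periodicExt a t + 1 := by
  rw [periodicExt, periodicExt, Int.floor_add_one, Int.fract_add_one]
  push_cast
  ring

theorem w0_mem_Fw : w0 ∈ Fw :=
  ⟨w0_mem_PL2Plus, by rw [w0_apply 0 (by norm_num)]; norm_num [u0], periodicExt_add_one u0⟩

theorem w1_mem_Fw : w1 ∈ Fw :=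
  ⟨w1_mem_PL2Plus, by rw [w1_apply 0 (by norm_num)]; norm_num [u1], periodicExt_add_one u1⟩

theorem Fw_apply_add_int {f : ℝ ≃o ℝ} (hf : f ∈ Fw) (x : ℝ) (n : ℤ) : f (x + n) = f x + n := by
  induction n with
  | zero => simp
  | succ n ih =>
    push_cast at *
    rw [← add_assoc, hf.2.2, ih, add_assoc]
  | pred n ih =>
    have h := hf.2.2 (x + ((-n - 1 : ℤ) : ℝ))
    push_cast at *
    rw [show x + (-(n : ℝ) - 1) + 1 = x + -n by ring, ih] at h
    linarith

theorem Fw_apply_int {f : ℝ ≃o ℝ} (hf : f ∈ Fw) (n : ℤ) : f n = n := by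
  simpa [hf.2.1] using Fw_apply_add_int hf 0 n

theorem Fw_ext {f g : ℝ ≃o ℝ} (hf : f ∈ Fw) (hg : g ∈ Fw) (h : ∀ x ∈ Set.Icc (0 : ℝ) 1, f x = g x) :
    f = g := by
  ext x
  have h1 := h (Int.fract x) ⟨Int.fract_nonneg x, (Int.fract_lt_one x).le⟩
  rw [← Int.fract_add_floor x, Fw_apply_add_int hf, Fw_apply_add_int hg, h1]

/-! ## Elements of `F_x` and `F_w` have diagrams -/

/-- An element of `PL₂⁺(ℝ)` maps all sufficiently small standard dyadic subintervals of
`[n, n + 1]` affinely to standard dyadic intervals. -/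
theorem eventually_affine {f : ℝ ≃o ℝ} (hf : f ∈ PL2Plus) (n : ℤ) : ∀ᶠ k : ℕ in atTop, ∀ m : ℤ,
    (n : ℝ) ≤ m / 2 ^ k → ((m : ℝ) + 1) / 2 ^ k ≤ n + 1 → ∃ (e : ℕ) (c : ℤ),
      ∀ t ∈ Set.Icc ((m : ℝ) / 2 ^ k) (((m : ℝ) + 1) / 2 ^ k),
        f t = 2 ^ k / 2 ^ e * t + ((c : ℝ) - m) / 2 ^ e := by
  obtain ⟨hd, B, hB, hBf, haff⟩ := hf
  -- At level `N` all breakpoints in the box, which are finitely many, are endpoints of standard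
  -- intervals.
  have hN : ∀ᶠ k : ℕ in atTop, ∀ x ∈ B ∩ Set.Icc (n : ℝ) (n + 1), ∃ i : ℤ, x = i / 2 ^ k :=
    (eventually_all_finite (hBf _ _)).2 fun x hx => exists_eq_div_pow (hB hx.1)
  obtain ⟨N, hN⟩ := hN.exists
  have h2 : ∀ k : ℕ, (0 : ℝ) < 2 ^ k := fun k => by positivity
  have key : ∀ i ∈ Set.Icc (n * 2 ^ N : ℤ) ((n + 1) * 2 ^ N - 1), ∀ᶠ k : ℕ in atTop, ∀ m : ℤ,
      (i : ℝ) / 2 ^ N ≤ m / 2 ^ k → ((m : ℝ) + 1) / 2 ^ k ≤ (i + 1) / 2 ^ N → ∃ (e : ℕ) (c : ℤ),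
      ∀ t ∈ Set.Icc ((m : ℝ) / 2 ^ k) (((m : ℝ) + 1) / 2 ^ k),
        f t = 2 ^ k / 2 ^ e * t + ((c : ℝ) - m) / 2 ^ e := by
    rintro i ⟨hi1, hi2⟩
    have hi1' : (n : ℝ) ≤ i / 2 ^ N := by
      rw [le_div_iff₀ (h2 N)]; exact_mod_cast hi1
    have hi2' : ((i : ℝ) + 1) / 2 ^ N ≤ n + 1 := by
      rw [div_le_iff₀ (h2 N)]
      have : i + 1 ≤ (n + 1) * 2 ^ N := by omega
      exact_mod_cast this
    have hlt : (i : ℝ) / 2 ^ N < (i + 1) / 2 ^ N := by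
      have := h2 N
      gcongr; linarith
    obtain ⟨κ, hκ⟩ := haff _ _ hlt (by
      rw [Set.disjoint_left]
      rintro x ⟨h3, h4⟩ hx
      obtain ⟨j, rfl⟩ := hN x ⟨hx, by linarith, by linarith⟩
      rw [div_lt_div_iff_of_pos_right (h2 N)] at h3 h4
      norm_cast at h3 h4
      omega)
    obtain ⟨c₀, e₀, hc₀⟩ := (hd (i / 2 ^ N)).2 ⟨i, N, rfl⟩
    filter_upwards [eventually_ge_atTop N, eventually_ge_atTop (κ + e₀).toNat] with k hkN hk m h3 h4
    -- At level `k` the image interval has length $2^{\kappa-k}$. Requiring $k\ge\kappa+e_0$ makes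
    -- this at most $2^{-e_0}$, so the image endpoints are integer multiples of the image length and
    -- the image is again standard, with exponent $e=k-\kappa=e_0+d$.
    have hk' : κ + e₀ ≤ k := by omega
    obtain ⟨d, hd'⟩ := Int.eq_ofNat_of_zero_le (show 0 ≤ (k : ℤ) - κ - e₀ by omega)
    obtain ⟨p, rfl⟩ := Nat.exists_eq_add_of_le hkN
    have hslope : (2 : ℝ) ^ κ = 2 ^ (N + p) / 2 ^ (e₀ + d) := by
      rw [eq_div_iff (h2 _).ne', ← zpow_natCast, ← zpow_natCast, ← zpow_add₀ two_ne_zero]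
      congr 1
      push_cast at *
      omega
    -- The left end of the image is the value $c_0/2^{e_0}$ at the left end of the level-`N`
    -- interval plus $m-i\,2^p$ steps of length $2^{-e}$.
    refine ⟨e₀ + d, c₀ * 2 ^ d + (m - i * 2 ^ p), fun t ht => ?_⟩
    have h5 := hκ _ ⟨le_rfl, hlt.le⟩ t ⟨h3.trans ht.1, ht.2.trans h4⟩
    rw [hc₀, hslope] at h5
    have h6 : f t = (c₀ : ℝ) / 2 ^ e₀ + 2 ^ (N + p) / 2 ^ (e₀ + d) * (t - i / 2 ^ N) := by
      linarith
    rw [h6]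
    push_cast
    rw [pow_add, pow_add]
    field_simp
    ring
  have key2 := (eventually_all_finite (Set.finite_Icc _ _)).2 key
  filter_upwards [key2, eventually_ge_atTop N] with k hk hkN m h3 h4
  obtain ⟨p, rfl⟩ := Nat.exists_eq_add_of_le hkN
  rw [le_div_iff₀ (h2 _)] at h3
  rw [div_le_iff₀ (h2 _)] at h4
  norm_cast at h3 h4
  rw [pow_add] at h3 h4
  push_cast at h3 h4
  have hp : (0 : ℤ) < 2 ^ p := by positivity
  have h5 := Int.mul_ediv_add_emod m (2 ^ p)
  have h6 := Int.emod_nonneg m hp.ne'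
  have h7 := Int.emod_lt_of_pos m hp
  -- The integer quotient of `m` by $2^p$ is the index of the level-`N` interval containing the
  -- given level-`k` interval.
  refine hk (m / 2 ^ p) ⟨?_, ?_⟩ m ?_ ?_
  · rw [Int.le_ediv_iff_mul_le hp]
    linarith
  · rw [Int.le_sub_one_iff, Int.ediv_lt_iff_lt_mul hp]
    linarith
  · rw [div_le_div_iff₀ (h2 _) (h2 _), pow_add]
    have h8 : (m / 2 ^ p : ℤ) * 2 ^ p ≤ m := by linarith
    have h8' : ((m / 2 ^ p : ℤ) : ℝ) * 2 ^ p ≤ m := by exact_mod_cast h8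
    have := h2 N
    nlinarith
  · rw [div_le_div_iff₀ (h2 _) (h2 _), pow_add]
    have h8 : m + 1 ≤ (m / 2 ^ p + 1 : ℤ) * 2 ^ p := by linarith
    have h8' : (m : ℝ) + 1 ≤ (((m / 2 ^ p : ℤ) : ℝ) + 1) * 2 ^ p := by exact_mod_cast h8
    have := h2 N
    nlinarith

theorem halvesCell_int_append (n : ℤ) (u w : List Bool) :
    halvesCell n (n + 1) (u ++ w) =
      halvesCell (((n * 2 ^ u.length + levelIndex u : ℤ) : ℝ) / 2 ^ u.length)
        ((((n * 2 ^ u.length + levelIndex u : ℤ) : ℝ) + 1) / 2 ^ u.length) w := by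
  rw [halvesCell_append]
  have h2 : (2 : ℝ) ^ u.length ≠ 0 := by positivity
  push_cast
  congr 1 <;> field_simp <;> ring

/-- The quotient of `c` by $2^e$ names the box and the remainder the position among the $2^e$
subintervals of that box. -/
theorem exists_halvesCell_int_append (e : ℕ) (c : ℤ) : ∃ u : List Bool, ∀ w,
    halvesCell (c / 2 ^ e : ℤ) ((c / 2 ^ e : ℤ) + 1) (u ++ w) =
      halvesCell ((c : ℝ) / 2 ^ e) (((c : ℝ) + 1) / 2 ^ e) w := by
  have hp : (0 : ℤ) < 2 ^ e := by positivity
  have h5 := Int.mul_ediv_add_emod c (2 ^ e)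
  have h6 := Int.emod_nonneg c hp.ne'
  have h7 := Int.emod_lt_of_pos c hp
  obtain ⟨i, hi⟩ := Int.eq_ofNat_of_zero_le h6
  obtain ⟨u, hu, hui⟩ := exists_levelIndex_eq e i (by rw [hi] at h7; exact_mod_cast h7)
  refine ⟨u, fun w => ?_⟩
  rw [halvesCell_int_append, hu, hui]
  have : c / 2 ^ e * 2 ^ e + (i : ℤ) = c := by linarith
  rw [this]

/-- At a sufficiently deep level every standard interval of the box goes affinely onto a standard
interval. The hypothesis `himg` supplies a vertex for each box reached, which makes the argument
serve both subdivisions. -/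
theorem eventually_carries {cell : List Bool → Set ℝ} {f : ℝ ≃o ℝ} (hf : f ∈ PL2Plus) {n : ℤ}
    {v : List Bool} (hv : ∀ w, cell (v ++ w) = halvesCell n (n + 1) w)
    (himg : ∀ m : ℤ, (∃ t, (n : ℝ) ≤ t ∧ t < n + 1 ∧ (m : ℝ) ≤ f t ∧ f t < m + 1) →
      ∃ v', ∀ w, cell (v' ++ w) = halvesCell m (m + 1) w) :
    ∀ᶠ k : ℕ in atTop, ∀ u : List Bool, u.length = k → ∃ v', Carries cell f (v ++ u) v' := by
  have h2 : ∀ k : ℕ, (0 : ℝ) < 2 ^ k := fun k => by positivity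
  filter_upwards [eventually_affine hf n] with k hk u hu
  have hlt := levelIndex_lt u
  rw [hu] at hlt
  have hlt' : (levelIndex u : ℝ) + 1 ≤ 2 ^ k := by exact_mod_cast hlt
  obtain ⟨m, hm⟩ : ∃ m : ℤ, n * 2 ^ k + levelIndex u = m := ⟨_, rfl⟩
  have hm' : (n : ℝ) * 2 ^ k + levelIndex u = m := by exact_mod_cast hm
  have hl : (n : ℝ) ≤ m / 2 ^ k := by
    rw [le_div_iff₀ (h2 k), ← hm']; simp
  have hr : ((m : ℝ) + 1) / 2 ^ k ≤ n + 1 := by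
    rw [div_le_iff₀ (h2 k), ← hm']; linarith
  have hlr : (m : ℝ) / 2 ^ k < (m + 1) / 2 ^ k := by
    have := h2 k
    gcongr; linarith
  obtain ⟨e, c, hec⟩ := hk m hl hr
  have hfl : f (m / 2 ^ k) = c / 2 ^ e := by
    rw [hec _ ⟨le_rfl, hlr.le⟩]
    have := (h2 k).ne'
    field_simp
    ring
  obtain ⟨v', hv'⟩ := himg (c / 2 ^ e) ⟨m / 2 ^ k, hl, by linarith, by
    have hp : (0 : ℤ) < 2 ^ e := by positivity
    have h6 := Int.mul_ediv_add_emod c (2 ^ e)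
    have h7 := Int.emod_nonneg c hp.ne'
    have h8 := Int.emod_lt_of_pos c hp
    rw [hfl, le_div_iff₀ (h2 e), div_lt_iff₀ (h2 e)]
    constructor
    · have : c / 2 ^ e * 2 ^ e ≤ c := by linarith
      exact_mod_cast this
    · have : c < (c / 2 ^ e + 1) * 2 ^ e := by linarith
      exact_mod_cast this⟩
  obtain ⟨u', hu'⟩ := exists_halvesCell_int_append e c
  refine ⟨v' ++ u', carries_of_affine (a := m / 2 ^ k) (b := (m + 1) / 2 ^ k) (c := c / 2 ^ e)
    (d := (c + 1) / 2 ^ e) ?_ ?_ hlr.le hec ?_ ?_⟩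
  · intro w
    rw [List.append_assoc, hv, halvesCell_int_append, hu, hm]
  · intro w
    rw [List.append_assoc, hv', hu']
  · have := (h2 k).ne'
    field_simp
    ring
  · have := (h2 k).ne'
    field_simp
    ring

theorem uncarried_finite_of_length {cell : List Bool → Set ℝ} {f : ℝ ≃o ℝ} (k : ℕ)
    (h : ∀ u : List Bool, u.length = k → ∃ v, Carries cell f u v) : (uncarried cell f).Finite := by
  refine (List.finite_length_lt Bool k).subset fun u hu => ?_
  by_contra hlen
  change ¬ u.length < k at hlen
  rw [← List.take_append_drop k u] at hu
  exact uncarried_of_append hu (h _ (by simp; omega))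

theorem uncarried_unitCell_finite {f : ℝ ≃o ℝ} (hf : f ∈ Fw) : (uncarried unitCell f).Finite := by
  have h := eventually_carries (cell := unitCell) (v := []) hf.1 (n := 0)
    (fun w => by simp [unitCell]) (by
      rintro m ⟨t, h1, h2, h3, h4⟩
      have h5 : f t < f 1 := f.strictMono (by simpa using h2)
      have h6 : f 0 ≤ f t := f.monotone (by simpa using h1)
      have h7 : f 1 = 1 := by simpa using Fw_apply_int hf 1
      rw [hf.2.1] at h6
      rw [h7] at h5
      have h8 : (m : ℝ) < 1 := by linarith
      have h9 : (0 : ℝ) < m + 1 := by linarith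
      norm_cast at h8 h9
      obtain rfl : m = 0 := by omega
      exact ⟨[], fun w => by simp [unitCell]⟩)
  obtain ⟨k, hk⟩ := h.exists
  exact uncarried_finite_of_length k hk

theorem rightVertex_add (k j : ℕ) : rightVertex (k + j) = rightVertex k ++ List.replicate j true := by
  rw [rightVertex, rightVertex, List.replicate_append_replicate]
  congr 1; omega

theorem leftVertex_add (k j : ℕ) : leftVertex (k + j) = leftVertex k ++ List.replicate j false := by
  rw [leftVertex, leftVertex, List.replicate_append_replicate]
  congr 1; omega

theorem uncarried_lineCell_finite {f : ℝ ≃o ℝ} (hf : f ∈ Fx) : (uncarried lineCell f).Finite := by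
  obtain ⟨hPL, ⟨k, hk⟩, ⟨l, hl⟩⟩ := hf
  obtain ⟨a, ha⟩ := eventually_atTop.1 hk
  obtain ⟨b, hb⟩ := eventually_atBot.1 hl
  -- Beyond `M` on either side `f` is a translation; `M` is also at least `-k` and `l`, so that the
  -- image half-lines are again vertices on the sides of the tree.
  obtain ⟨M, hM⟩ := exists_nat_ge (max (max a (-b)) (max (-k) l : ℝ))
  simp only [max_le_iff] at hM
  obtain ⟨⟨hMa, hMb⟩, hMk, hMl⟩ := hM
  have hMk' : -k ≤ (M : ℤ) := by exact_mod_cast hMk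
  have hMl' : l ≤ (M : ℤ) := by exact_mod_cast hMl
  have hR : ∃ v, Carries lineCell f (rightVertex M) v := by
    refine ⟨rightVertex (M + k).toNat, carries_rightVertex fun t ht => ?_⟩
    have h1 : (((M + k).toNat : ℤ) : ℝ) = ((M + k : ℤ) : ℝ) := by
      rw [Int.toNat_of_nonneg (by omega)]
    rw [Int.cast_natCast] at h1
    rw [ha t (by linarith), h1]
    push_cast; ring
  have hL : ∃ v, Carries lineCell f (leftVertex M) v := by
    refine ⟨leftVertex (M - l).toNat, carries_leftVertex fun t ht => ?_⟩
    have h1 : (((M - l).toNat : ℤ) : ℝ) = ((M - l : ℤ) : ℝ) := by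
      rw [Int.toNat_of_nonneg (by omega)]
    rw [Int.cast_natCast] at h1
    rw [hb t (by linarith), h1]
    push_cast; ring
  have hmid : ∀ n ∈ Set.Icc (-M : ℤ) M, ∀ᶠ k : ℕ in atTop, ∀ u : List Bool, u.length = k →
      ∃ v, Carries lineCell f (unitVertex n ++ u) v := fun n _ =>
    eventually_carries hPL (lineCell_unitVertex_append n)
      fun m _ => ⟨unitVertex m, lineCell_unitVertex_append m⟩
  obtain ⟨N, hN⟩ := eventually_atTop.1 ((eventually_all_finite (Set.finite_Icc _ _)).2 hmid)
  -- The vertex of a box inside the middle range has depth at most $M+1$. So a vertex this deep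
  -- either lies below one of the two carried half-lines or at relative depth at least `N` inside a
  -- middle box.
  refine uncarried_finite_of_length (M + 2 + N) fun u hu => ?_
  have goR : ∀ j w, M ≤ j → ∃ v, Carries lineCell f (rightVertex j ++ w) v := by
    intro j w hj
    obtain ⟨i, rfl⟩ := Nat.exists_eq_add_of_le hj
    obtain ⟨v, hv⟩ := hR
    rw [rightVertex_add, List.append_assoc]
    exact ⟨_, hv.append _⟩
  have goL : ∀ j w, M ≤ j → ∃ v, Carries lineCell f (leftVertex j ++ w) v := by
    intro j w hj
    obtain ⟨i, rfl⟩ := Nat.exists_eq_add_of_le hj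
    obtain ⟨v, hv⟩ := hL
    rw [leftVertex_add, List.append_assoc]
    exact ⟨_, hv.append _⟩
  rcases lineVertex_cases u with rfl | ⟨j, rfl⟩ | ⟨j, rfl⟩ | ⟨n, w, rfl⟩
  · simp at hu; omega
  · simp only [rightVertex, List.length_replicate] at hu
    simpa using goR j [] (by omega)
  · simp only [leftVertex, List.length_replicate] at hu
    simpa using goL j [] (by omega)
  · cases n with
    | ofNat j =>
      rcases lt_or_ge j M with hj | hj
      · refine hN w.length ?_ _ ⟨?_, ?_⟩ w rfl
        · simp [unitVertex, rightVertex] at hu; omega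
        · simp only [Int.ofNat_eq_natCast]; omega
        · simp only [Int.ofNat_eq_natCast]; omega
      · rw [unitVertex, List.append_assoc]
        exact goR j _ hj
    | negSucc j =>
      rcases lt_or_ge j M with hj | hj
      · refine hN w.length ?_ _ ⟨?_, ?_⟩ w rfl
        · simp [unitVertex, leftVertex] at hu; omega
        · omega
        · omega
      · rw [unitVertex, List.append_assoc]
        exact goL j _ hj

/-! ### Generation of $F_x$ and $F_w$, with the linear bound on length by carets -/

theorem hasWord_of_mem_Fx {f : ℝ ≃o ℝ} (hf : f ∈ Fx) :
    HasWord {x0, x1} (8 * (uncarried lineCell f).ncard) f := by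
  have hfin := uncarried_lineCell_finite hf
  have hfin' := uncarried_lineCell_finite (inv_mem hf)
  have hd := isReducedDiagram_reducedDiagram isCellSystem_lineCell hfin hfin'
  obtain ⟨g, hg, hgd⟩ := isGeneratorPair_x.exists_hasWord_isDiagram hd.1
  have hn := carets_eq_ncard isCellSystem_lineCell hfin hfin'
  rw [carets] at hn
  rw [hn] at hg
  convert hg using 1
  ext x
  exact hd.1.eqOn isCellSystem_lineCell hgd (Set.mem_univ x)

theorem closure_w_le : Subgroup.closure {w0, w1} ≤ Fw := by
  rw [Subgroup.closure_le]
  rintro _ (rfl | rfl)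
  · exact w0_mem_Fw
  · exact w1_mem_Fw

theorem closure_x : Subgroup.closure {x0, x1} = Fx := by
  refine le_antisymm ?_ fun f hf => (hasWord_of_mem_Fx hf).mem_closure
  rw [Subgroup.closure_le]
  rintro _ (rfl | rfl)
  · exact x0_mem_Fx
  · exact x1_mem_Fx

/-- A diagram over the unit interval determines a map only on $[0,1]$, so equality on the line also
needs the word to be periodic; this is why `closure_w_le` comes first. -/
theorem closure_w : Subgroup.closure {w0, w1} = Fw := by
  refine le_antisymm closure_w_le fun f hf => ?_
  have hfin := uncarried_unitCell_finite hf
  have hfin' := uncarried_unitCell_finite (inv_mem hf)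
  have hd := isReducedDiagram_reducedDiagram isCellSystem_unitCell hfin hfin'
  obtain ⟨g, hg, hgd⟩ := isGeneratorPair_w.exists_hasWord_isDiagram hd.1
  rw [Fw_ext hf (closure_w_le hg.mem_closure)
    fun x hx => hd.1.eqOn isCellSystem_unitCell hgd hx]
  exact hg.mem_closure

/-! ## The decomposition of `C` -/

theorem mem_C_iff {g : ℝ ≃o ℝ} :
    g ∈ C ↔ g ∈ AutPlusF ∧ ∃ τ ∈ FT, HasGerm atBot g τ ∧ HasGerm atTop g τ := Iff.rfl

theorem unitAddCircle_coe_eq_iff {x y : ℝ} :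
    (x : UnitAddCircle) = y ↔ ∃ n : ℤ, x = y + n := by
  rw [← sub_eq_zero, ← AddCircle.coe_sub, AddCircle.coe_eq_zero_iff]
  simp only [zsmul_eq_mul, mul_one]
  refine exists_congr fun n => ?_
  constructor <;> intro h <;> linarith

/-- Continuous functions that differ by integers on an interval differ by a constant. -/
theorem exists_int_add_of_continuous {f g : ℝ → ℝ} (hf : Continuous f) (hg : Continuous g)
    {S : Set ℝ} (hS : IsPreconnected S) (h : ∀ x ∈ S, ∃ n : ℤ, f x = g x + n) :
    ∃ n : ℤ, ∀ x ∈ S, f x = g x + n := by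
  have hd : IsDiscrete (Set.range ((↑) : ℤ → ℝ)) :=
    Int.isClosedEmbedding_coe_real.isEmbedding.isInducing.isDiscrete_range
  obtain ⟨_, ⟨n, rfl⟩, hn⟩ := hS.eqOn_const_of_mapsTo hd (f := fun x => f x - g x)
    (hf.sub hg).continuousOn (fun x hx => by
      obtain ⟨n, hn⟩ := h x hx
      exact ⟨n, by linarith⟩) (Set.range_nonempty _)
  refine ⟨n, fun x hx => ?_⟩
  have h1 : f x - g x = n := hn hx
  linarith

theorem addRight_mem_Fx (n : ℤ) : OrderIso.addRight (n : ℝ) ∈ Fx :=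
  ⟨mem_PL2Plus_of_eighths fun _ => ⟨0, n, intCast_mem_dyadics n, fun t _ => by simp⟩,
    ⟨n, by simp⟩, n, by simp⟩

/-- Near either end `f` is an integer translation, and this commutes with the periodic map `h`. -/
theorem conj_mem_Fx {f h : ℝ ≃o ℝ} (hf : f ∈ Fx) (hh : h ∈ Fw) : h * f * h⁻¹ ∈ Fx := by
  obtain ⟨hPL, ⟨k, hk⟩, ⟨l, hl⟩⟩ := hf
  have happ : ∀ x, h (h⁻¹ x) = x := fun x => h.apply_symm_apply x
  refine ⟨mul_mem (mul_mem hh.1 hPL) (inv_mem hh.1), ⟨k, ?_⟩, l, ?_⟩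
  · filter_upwards [(h⁻¹).tendsto_atTop.eventually hk] with x hx
    change h (f (h⁻¹ x)) = _
    rw [hx, Fw_apply_add_int hh, happ]
  · filter_upwards [(h⁻¹).tendsto_atBot.eventually hl] with x hx
    change h (f (h⁻¹ x)) = _
    rw [hx, Fw_apply_add_int hh, happ]

/-- A periodic element fixes the integers, so its translation number near $+\infty$ is zero;
periodicity then spreads the identity from that end to the whole line. -/
theorem Fx_inf_Fw : Fx ⊓ Fw = ⊥ := by
  rw [eq_bot_iff]
  rintro f ⟨⟨-, ⟨k, hk⟩, -⟩, hw⟩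
  rw [Subgroup.mem_bot]
  obtain ⟨a, ha⟩ := eventually_atTop.1 hk
  have hk0 : (k : ℝ) = 0 := by
    have h1 := ha ⌈a⌉ (Int.le_ceil a)
    rw [Fw_apply_int hw] at h1
    linarith
  ext x
  have h1 := ha (x + ⌈a - x⌉) (by linarith [Int.le_ceil (a - x)])
  rw [Fw_apply_add_int hw, hk0] at h1
  change f x = x
  linarith

theorem exists_lifts {h : ℝ ≃o ℝ} (hh : h ∈ Fw) : ∃ τ ∈ FT, Lifts h τ := by
  have hwd : ∀ f ∈ Fw, ∀ x y : ℝ, (QuotientAddGroup.leftRel (AddSubgroup.zmultiples (1 : ℝ))) x y →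
      ((f x : ℝ) : UnitAddCircle) = (f y : ℝ) := by
    intro f hf x y hxy
    have h1 : (x : UnitAddCircle) = y := Quotient.sound' hxy
    obtain ⟨n, rfl⟩ := unitAddCircle_coe_eq_iff.1 h1
    rw [unitAddCircle_coe_eq_iff]
    exact ⟨n, Fw_apply_add_int hf y n⟩
  have hcont : ∀ f : ℝ ≃o ℝ, Continuous fun x : ℝ => ((f x : ℝ) : UnitAddCircle) :=
    fun f => (AddCircle.continuous_mk' 1).comp f.continuous
  let τ : UnitAddCircle ≃ₜ UnitAddCircle :=
    { toFun := fun x => Quotient.liftOn' x (fun t => ((h t : ℝ) : UnitAddCircle)) (hwd h hh)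
      invFun := fun x => Quotient.liftOn' x (fun t => ((h⁻¹ t : ℝ) : UnitAddCircle))
        (hwd h⁻¹ (inv_mem hh))
      left_inv := by
        intro x
        induction x using QuotientAddGroup.induction_on with
        | H x => exact congrArg _ (h.symm_apply_apply x)
      right_inv := by
        intro x
        induction x using QuotientAddGroup.induction_on with
        | H x => exact congrArg _ (h.apply_symm_apply x)
      continuous_toFun := (hcont h).quotient_liftOn' _
      continuous_invFun := (hcont h⁻¹).quotient_liftOn' _ }
  have hlift : Lifts h τ := fun _ => rfl
  refine ⟨τ, ⟨⟨h, hh.1, hlift⟩, ?_⟩, hlift⟩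
  have h1 := hlift 0
  rw [hh.2.1] at h1
  simpa using h1

theorem mem_normalizer_of_mem_Fw {h : ℝ ≃o ℝ} (hh : h ∈ Fw) :
    h ∈ Subgroup.normalizer (Fx : Set (ℝ ≃o ℝ)) := by
  rw [Subgroup.mem_normalizer_iff]
  intro f
  refine ⟨fun hf => conj_mem_Fx hf hh, fun hf => ?_⟩
  have h1 := conj_mem_Fx hf (inv_mem hh)
  simpa [mul_assoc] using h1

theorem Fw_le_C : Fw ≤ C := by
  intro h hh
  obtain ⟨τ, hτ, hl⟩ := exists_lifts hh
  exact mem_C_iff.2 ⟨⟨hh.1, mem_normalizer_of_mem_Fw hh⟩, τ, hτ,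
    Eventually.of_forall hl, Eventually.of_forall hl⟩

theorem Fx_le_C : Fx ≤ C := by
  intro f hf
  refine mem_C_iff.2 ⟨⟨hf.1, Subgroup.le_normalizer hf⟩, 1, one_mem _, ?_, ?_⟩
  · obtain ⟨l, hl⟩ := hf.2.2
    filter_upwards [hl] with x hx
    rw [hx]
    exact (unitAddCircle_coe_eq_iff.2 ⟨l, rfl⟩).symm
  · obtain ⟨k, hk⟩ := hf.2.1
    filter_upwards [hk] with x hx
    rw [hx]
    exact (unitAddCircle_coe_eq_iff.2 ⟨k, rfl⟩).symm

/-- A circle map in `F` has a periodic lift fixing the integers. -/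
theorem exists_mem_Fw_lifts {τ : UnitAddCircle ≃ₜ UnitAddCircle} (hτ : τ ∈ FT) :
    ∃ h ∈ Fw, Lifts h τ := by
  obtain ⟨⟨f, hf, hl⟩, hτ0⟩ := hτ
  obtain ⟨a, ha⟩ : ∃ a : ℤ, f 0 = a := by
    have h1 := hl 0
    rw [AddCircle.coe_zero, hτ0, ← AddCircle.coe_zero, eq_comm, unitAddCircle_coe_eq_iff] at h1
    simpa using h1
  -- The degree of the circle map: `f (x + 1)` and `f x` project to the same point, so their
  -- difference is an integer, constant by continuity.
  obtain ⟨d, hd⟩ := exists_int_add_of_continuous (f := fun x => f (x + 1)) (g := f)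
    (f.continuous.comp (continuous_add_const 1)) f.continuous isPreconnected_univ (fun x _ => by
      have h1 : ((x + 1 : ℝ) : UnitAddCircle) = x := unitAddCircle_coe_eq_iff.2 ⟨1, by simp⟩
      have h2 := hl (x + 1)
      rw [h1, hl] at h2
      exact unitAddCircle_coe_eq_iff.1 h2.symm)
  have hd' : ∀ x, f (x + 1) = f x + d := fun x => hd x trivial
  -- Monotonicity gives $d>0$. If $d\ge2$, then `f` takes the value $a+1$ strictly between 0 and 1,
  -- and `τ` would identify that point with 0.
  have hd1 : d = 1 := by
    have h1 : (0 : ℝ) < d := by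
      have := f.strictMono (show (0 : ℝ) < 0 + 1 by norm_num)
      rw [hd'] at this
      linarith
    have h1' : 0 < d := by exact_mod_cast h1
    by_contra h2
    have h3 : (1 : ℝ) < d := by exact_mod_cast (show 1 < d by omega)
    have h4 : f (f.symm (a + 1)) = a + 1 := f.apply_symm_apply _
    have h5 : 0 < f.symm (a + 1) := by
      rw [← f.lt_iff_lt, h4, ha]; linarith
    have h6 : f.symm (a + 1) < 0 + 1 := by
      rw [← f.lt_iff_lt, h4, hd', ha]; linarith
    have h7 : τ (f.symm (a + 1) : ℝ) = τ (0 : ℝ) := by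
      rw [hl, hl, h4, ha]
      exact unitAddCircle_coe_eq_iff.2 ⟨1, by simp⟩
    obtain ⟨n, hn⟩ := unitAddCircle_coe_eq_iff.1 (τ.injective h7)
    rw [zero_add] at hn
    rw [hn] at h5 h6
    norm_cast at h5 h6
    omega
  refine ⟨OrderIso.addRight ((-a : ℤ) : ℝ) * f, ⟨mul_mem (addRight_mem_Fx _).1 hf, ?_, fun x => ?_⟩,
    fun x => ?_⟩
  · change f 0 + ((-a : ℤ) : ℝ) = 0
    rw [ha]; push_cast; ring
  · change f (x + 1) + ((-a : ℤ) : ℝ) = f x + ((-a : ℤ) : ℝ) + 1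
    rw [hd', hd1]; push_cast; ring
  · rw [hl]
    exact (unitAddCircle_coe_eq_iff.2 ⟨-a, rfl⟩).symm

/-- Near each end `g` and `h` lift the same circle map, so they differ by an integer, which is
constant on a half-line by continuity. Composing with the inverse of `h` leaves a translation by
that integer. -/
theorem mul_inv_mem_Fx_of_hasGerm {g h : ℝ ≃o ℝ} {τ : UnitAddCircle ≃ₜ UnitAddCircle}
    (hg : g ∈ PL2Plus) (hh : h ∈ PL2Plus) (hl : Lifts h τ) (h1 : HasGerm atBot g τ)
    (h2 : HasGerm atTop g τ) : g * h⁻¹ ∈ Fx := by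
  have happ : ∀ x, h (h⁻¹ x) = x := fun x => h.apply_symm_apply x
  have hint : ∀ x : ℝ, τ (x : UnitAddCircle) = ((g x : ℝ) : UnitAddCircle) →
      ∃ n : ℤ, g x = h x + n := by
    intro x hx
    rw [hl] at hx
    exact unitAddCircle_coe_eq_iff.1 hx.symm
  obtain ⟨a, ha⟩ := eventually_atTop.1 h2
  obtain ⟨b, hb⟩ := eventually_atBot.1 h1
  obtain ⟨k, hk⟩ := exists_int_add_of_continuous g.continuous h.continuous
    (isPreconnected_Ici (a := a)) fun x hx => hint x (ha x hx)
  obtain ⟨l, hl'⟩ := exists_int_add_of_continuous g.continuous h.continuous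
    (isPreconnected_Iic (a := b)) fun x hx => hint x (hb x hx)
  refine ⟨mul_mem hg (inv_mem hh), ⟨k, ?_⟩, l, ?_⟩
  · filter_upwards [(h⁻¹).tendsto_atTop.eventually (eventually_ge_atTop a)] with x hx
    change g (h⁻¹ x) = _
    rw [hk _ hx, happ]
  · filter_upwards [(h⁻¹).tendsto_atBot.eventually (eventually_le_atBot b)] with x hx
    change g (h⁻¹ x) = _
    rw [hl' _ hx, happ]

theorem periodicPart_debris_mem {g : ℝ ≃o ℝ} (hg : g ∈ C) :
    periodicPart g ∈ Fw ∧ debris g ∈ Fx := by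
  have hex : ∃ h, h ∈ Fw ∧ ∃ τ, Lifts h τ ∧ HasGerm atBot g τ ∧ HasGerm atTop g τ := by
    obtain ⟨-, τ, hτ, h1, h2⟩ := mem_C_iff.1 hg
    obtain ⟨h, hh, hl⟩ := exists_mem_Fw_lifts hτ
    exact ⟨h, hh, τ, hl, h1, h2⟩
  obtain ⟨h1, τ, h2, h3, h4⟩ := Classical.epsilon_spec hex
  exact ⟨h1, mul_inv_mem_Fx_of_hasGerm (mem_C_iff.1 hg).1.1 h1.1 h2 h3 h4⟩

theorem debris_mul_periodicPart (g : ℝ ≃o ℝ) : debris g * periodicPart g = g := by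
  simp [debris]

/-- Two factorizations differ by an element of $F_x\cap F_w$, which is trivial. -/
theorem periodicPart_debris_unique {d h : ℝ ≃o ℝ} (hd : d ∈ Fx) (hh : h ∈ Fw) :
    periodicPart (d * h) = h ∧ debris (d * h) = d := by
  have hg : d * h ∈ C := mul_mem (Fx_le_C hd) (Fw_le_C hh)
  obtain ⟨h1, h2⟩ := periodicPart_debris_mem hg
  have h3 := debris_mul_periodicPart (d * h)
  have h4 : d⁻¹ * debris (d * h) = h * (periodicPart (d * h))⁻¹ := by
    rw [eq_mul_inv_iff_mul_eq, mul_assoc, h3]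
    simp
  have h5 : d⁻¹ * debris (d * h) ∈ Fx ⊓ Fw := by
    refine Subgroup.mem_inf.2 ⟨Fx.mul_mem (Fx.inv_mem hd) h2, ?_⟩
    rw [h4]
    exact Fw.mul_mem hh (Fw.inv_mem h1)
  rw [Fx_inf_Fw, Subgroup.mem_bot] at h5
  rw [h5] at h4
  exact ⟨(mul_inv_eq_one.1 h4.symm).symm, (inv_mul_eq_one.1 h5).symm⟩

theorem Fx_sup_Fw : Fx ⊔ Fw = C := by
  refine le_antisymm (sup_le Fx_le_C Fw_le_C) fun g hg => ?_
  obtain ⟨h1, h2⟩ := periodicPart_debris_mem hg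
  rw [← debris_mul_periodicPart g]
  exact mul_mem (Subgroup.mem_sup_left h2) (Subgroup.mem_sup_right h1)

theorem closure_C : Subgroup.closure {x0, x1, w0, w1} = C := by
  rw [← Fx_sup_Fw, ← closure_x, ← closure_w, ← Subgroup.closure_union]
  congr 1
  rw [Set.insert_union, Set.singleton_union]

theorem normal_Fx : (Fx.subgroupOf C).Normal := by
  refine Subgroup.normal_subgroupOf_of_le_normalizer fun g hg => ?_
  exact (mem_C_iff.1 hg).1.2

/-! ## Side vertices and conjugation by periodic maps -/

/-- The vertices on the left and right sides of the tree, without the root. -/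
def sideVertices : Set (List Bool) := {u | ∃ k, u = rightVertex k ∨ u = leftVertex k}

/-- The number of vertices on the sides of the tree that `f` does not carry. -/
noncomputable def sideCount (f : ℝ ≃o ℝ) : ℕ := (uncarried lineCell f ∩ sideVertices).ncard

/-- This invariance lets `uncarried_mul_finite_ncard_le` be applied with `D` the set of side
vertices, whence the side count is subadditive. -/
theorem Carries.mem_sideVertices {f : ℝ ≃o ℝ} {u v : List Bool} (h : Carries lineCell f u v)
    (hu : u ∈ sideVertices) : v ∈ sideVertices := by
  obtain ⟨k, rfl | rfl⟩ := hu
  · obtain ⟨m, rfl⟩ := h.exists_rightVertex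
    exact ⟨m, .inl rfl⟩
  · obtain ⟨m, rfl⟩ := h.exists_leftVertex
    exact ⟨m, .inr rfl⟩

theorem sideCount_le {f : ℝ ≃o ℝ} (hf : f ∈ Fx) : sideCount f ≤ (uncarried lineCell f).ncard :=
  Set.ncard_le_ncard Set.inter_subset_left (uncarried_lineCell_finite hf)

theorem sideCount_mul_le {f g : ℝ ≃o ℝ} (hf : f ∈ Fx) (hg : g ∈ Fx) :
    sideCount (f * g) ≤ sideCount f + sideCount g :=
  (uncarried_mul_finite_ncard_le isCellSystem_lineCell (fun _ _ h hu => h.mem_sideVertices hu)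
    (uncarried_lineCell_finite hf) (uncarried_lineCell_finite hg)).2

theorem leftSide_spec (t : BinaryTree Unit) (k : ℕ) (hk : k < leftSide t) :
    List.replicate k false ∈ inner t := by
  induction t generalizing k with
  | nil => simp [leftSide] at hk
  | node a l r hl hr =>
    cases k with
    | zero => simp
    | succ k =>
      rw [List.replicate_succ, false_cons_mem_inner_node]
      exact hl k (by simpa [leftSide] using hk)

theorem rightSide_spec (t : BinaryTree Unit) (k : ℕ) (hk : k < rightSide t) :
    List.replicate k true ∈ inner t := by
  induction t generalizing k with
  | nil => simp [rightSide] at hk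
  | node a l r hl hr =>
    cases k with
    | zero => simp
    | succ k =>
      rw [List.replicate_succ, true_cons_mem_inner_node]
      exact hr k (by simpa [rightSide] using hk)

theorem sideCarets_le_ncard (t : BinaryTree Unit) :
    sideCarets t ≤ (inner t ∩ sideVertices).ncard := by
  cases t with
  | nil => simp [sideCarets]
  | node a l r =>
    have hinj : ∀ b : Bool, Function.Injective fun k => List.replicate (k + 1) b := by
      intro b i j h
      simpa using congrArg List.length h
    have hL : Function.Injective leftVertex := hinj false
    have hR : Function.Injective rightVertex := hinj true
    have hcard : sideCarets (.node a l r) = ((Finset.range (leftSide l)).image leftVertex ∪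
        (Finset.range (rightSide r)).image rightVertex).card := by
      rw [Finset.card_union_of_disjoint, Finset.card_image_of_injective _ hL,
        Finset.card_image_of_injective _ hR, Finset.card_range, Finset.card_range, sideCarets]
      rw [Finset.disjoint_left]
      simp only [Finset.mem_image]
      rintro _ ⟨i, -, rfl⟩ ⟨j, -, h⟩
      simp [rightVertex, leftVertex, List.replicate_succ] at h
    rw [hcard, ← Set.ncard_coe_finset]
    refine Set.ncard_le_ncard ?_ ((inner_finite_ncard _).1.inter_of_left _)
    intro u hu
    simp only [Finset.coe_union, Finset.coe_image, Finset.coe_range] at hu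
    rcases hu with ⟨k, hk, rfl⟩ | ⟨k, hk, rfl⟩
    · refine ⟨?_, k, .inr rfl⟩
      rw [leftVertex, List.replicate_succ, false_cons_mem_inner_node]
      exact leftSide_spec l k hk
    · refine ⟨?_, k, .inl rfl⟩
      rw [rightVertex, List.replicate_succ, true_cons_mem_inner_node]
      exact rightSide_spec r k hk

/-- The bounded child of a vertex on a side of the tree. -/
def boundedChild (s : List Bool) : List Bool := s ++ [!s.headD true]

theorem exists_unitVertex_eq (n : ℤ) : ∃ s ∈ sideVertices, unitVertex n = boundedChild s := by
  cases n with
  | ofNat k => exact ⟨rightVertex k, ⟨k, .inl rfl⟩, rfl⟩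
  | negSucc k => exact ⟨leftVertex k, ⟨k, .inr rfl⟩, rfl⟩

theorem not_unitVertex_prefix {n : ℤ} {s : List Bool} (hs : s ∈ sideVertices) :
    ¬ unitVertex n <+: s := by
  rintro ⟨w, rfl⟩
  obtain ⟨k, h | h⟩ := hs
  · have h1 := (bddAbove_lineCell_iff (unitVertex n ++ w)).2 (.inr ⟨n, w, rfl⟩)
    rw [h, lineCell_rightVertex] at h1
    exact not_bddAbove_Ici _ h1
  · have h1 := (bddBelow_lineCell_iff (unitVertex n ++ w)).2 (.inr ⟨n, w, rfl⟩)
    rw [h, lineCell_leftVertex] at h1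
    exact not_bddBelow_Iic _ h1

theorem carries_lineCell_of_unitCell {w : ℝ ≃o ℝ} (hw : w ∈ Fw) {u v : List Bool}
    (h : Carries unitCell w u v) (n : ℤ) :
    Carries lineCell w (unitVertex n ++ u) (unitVertex n ++ v) := by
  have key : ∀ u, lineCell (unitVertex n ++ u) = OrderIso.addRight (n : ℝ) '' unitCell u := by
    intro u
    rw [lineCell_unitVertex_append, unitCell, image_halvesCell (s := 1) (c := n) zero_le_one
      fun t _ => by simp]
    simp [add_comm]
  intro w'
  rw [List.append_assoc, List.append_assoc, key, key, ← h w', ← Set.image_comp, ← Set.image_comp]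
  refine Set.image_congr fun t _ => ?_
  exact Fw_apply_add_int hw t n

/-- On a carried half-line `f` is an integer translation, while `w` fixes the end of the half-line
and commutes with integer translations; there conjugation changes nothing. -/
theorem Carries.conj_of_side {f w : ℝ ≃o ℝ} (hw : w ∈ Fw) {u v : List Bool}
    (h : Carries lineCell f u v) (hu : u ∈ sideVertices) : Carries lineCell (w * f * w⁻¹) u v := by
  have happ : ∀ t, w (w⁻¹ t) = t := fun t => w.apply_symm_apply t
  obtain ⟨k, rfl | rfl⟩ := hu
  · obtain ⟨m, rfl⟩ := h.exists_rightVertex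
    refine carries_rightVertex fun t ht => ?_
    have h1 : (k : ℝ) ≤ w⁻¹ t := by
      have := (w⁻¹).monotone ht
      rwa [← Int.cast_natCast, Fw_apply_int (inv_mem hw)] at this
    change w (f (w⁻¹ t)) = _
    rw [apply_of_carries_rightVertex h h1, Fw_apply_add_int hw, happ]
    push_cast; rfl
  · obtain ⟨m, rfl⟩ := h.exists_leftVertex
    refine carries_leftVertex fun t ht => ?_
    have h1 : w⁻¹ t ≤ -(k : ℝ) := by
      have h2 : t ≤ ((-k : ℤ) : ℝ) := by push_cast; exact ht
      have := (w⁻¹).monotone h2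
      rw [Fw_apply_int (inv_mem hw)] at this
      push_cast at this; exact this
    change w (f (w⁻¹ t)) = _
    rw [apply_of_carries_leftVertex h h1, Fw_apply_add_int hw, happ]
    push_cast; rfl

theorem sideCount_conj_le {f w : ℝ ≃o ℝ} (hf : f ∈ Fx) (hw : w ∈ Fw) :
    sideCount (w * f * w⁻¹) ≤ sideCount f := by
  refine Set.ncard_le_ncard ?_ ((uncarried_lineCell_finite hf).inter_of_left _)
  rintro u ⟨hu, hs⟩
  exact ⟨fun ⟨v, hv⟩ => hu ⟨v, hv.conj_of_side hw hs⟩, hs⟩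

/-- Conjugation by a periodic map changes the number of carets at most by a constant multiple of the
number of carets on the sides. -/
theorem uncarried_conj_ncard_le {f w : ℝ ≃o ℝ} (hf : f ∈ Fx) (hw : w ∈ Fw) :
    (uncarried lineCell (w * f * w⁻¹)).ncard ≤ 1 + sideCount f + (uncarried lineCell f).ncard +
      sideCount f * (uncarried unitCell w⁻¹).ncard +
      sideCount f⁻¹ * (uncarried unitCell w).ncard := by
  have hc := isCellSystem_lineCell
  have hfin := uncarried_lineCell_finite hf
  have hA1 := hfin.inter_of_left sideVertices
  have hA1' := (uncarried_lineCell_finite (inv_mem hf)).inter_of_left sideVertices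
  have hJ := uncarried_unitCell_finite hw
  have hJ' := uncarried_unitCell_finite (inv_mem hw)
  -- A pair consisting of a side vertex and a vertex of the tree of $[0,1]$ is placed in the box
  -- hanging off that side vertex. `A3` collects the places where the inverse of `w` fails to be
  -- linear in boxes below uncarried side vertices of `f`; `A4` does the same for `w` and the
  -- inverse of `f`.
  let φ : List Bool × List Bool → List Bool := fun p => boundedChild p.1 ++ p.2
  let A3 : Set (List Bool) :=
    φ '' ((uncarried lineCell f ∩ sideVertices) ×ˢ uncarried unitCell w⁻¹)
  let A4 : Set (List Bool) :=
    φ '' ((uncarried lineCell f⁻¹ ∩ sideVertices) ×ˢ uncarried unitCell w)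
  have h3 : A3.Finite ∧ A3.ncard ≤ sideCount f * (uncarried unitCell w⁻¹).ncard := by
    refine ⟨(hA1.prod hJ').image φ, (Set.ncard_image_le (hA1.prod hJ')).trans ?_⟩
    rw [Set.ncard_prod]
    rfl
  have h4 : A4.Finite ∧ A4.ncard ≤ sideCount f⁻¹ * (uncarried unitCell w).ncard := by
    refine ⟨(hA1'.prod hJ).image φ, (Set.ncard_image_le (hA1'.prod hJ)).trans ?_⟩
    rw [Set.ncard_prod]
    rfl
  obtain ⟨h2, h2'⟩ := setOf_rel_finite_ncard_le hfin (R := Carries lineCell w⁻¹)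
    fun u u' v h h' => h.left_unique hc h'
  obtain ⟨h5, h5'⟩ := setOf_rel_finite_ncard_le h4.1 (R := Carries lineCell (f * w⁻¹))
    fun u u' v h h' => h.left_unique hc h'
  -- The three factors are applied one after another. An uncarried vertex is the root, a side vertex
  -- uncarried by `f`, or a vertex in a box. In a box it fails at the first factor (`A3`), or at `f`
  -- after being carried by the first, or at the last `w` after being carried by both (`A4`).
  have hsub : uncarried lineCell (w * f * w⁻¹) ⊆ (({[]} ∪ (uncarried lineCell f ∩ sideVertices)) ∪
      {u | ∃ v ∈ uncarried lineCell f, Carries lineCell w⁻¹ u v}) ∪ A3 ∪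
      {u | ∃ v ∈ A4, Carries lineCell (f * w⁻¹) u v} := by
    have side : ∀ s x, s ∈ sideVertices → s ++ x ∈ uncarried lineCell (w * f * w⁻¹) →
        s ∈ uncarried lineCell f := fun s x hs hu ⟨v, hv⟩ =>
      uncarried_of_append hu ⟨v, hv.conj_of_side hw hs⟩
    intro u hu
    rcases lineVertex_cases u with rfl | ⟨k, rfl⟩ | ⟨k, rfl⟩ | ⟨n, u, rfl⟩
    · exact .inl (.inl (.inl (.inl rfl)))
    · have hs : rightVertex k ∈ sideVertices := ⟨k, .inl rfl⟩
      exact .inl (.inl (.inl (.inr ⟨side _ [] hs (by simpa using hu), hs⟩)))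
    · have hs : leftVertex k ∈ sideVertices := ⟨k, .inr rfl⟩
      exact .inl (.inl (.inl (.inr ⟨side _ [] hs (by simpa using hu), hs⟩)))
    · obtain ⟨s, hs, hsn⟩ := exists_unitVertex_eq n
      have hsf : s ∈ uncarried lineCell f := by
        refine side s ([!s.headD true] ++ u) hs ?_
        rwa [hsn, boundedChild, List.append_assoc] at hu
      by_cases h1 : u ∈ uncarried unitCell w⁻¹
      · exact .inl (.inr ⟨(s, u), ⟨⟨hsf, hs⟩, h1⟩, by simp [φ, hsn]⟩)
      obtain ⟨u', hu'⟩ := not_not.1 h1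
      have c1 := carries_lineCell_of_unitCell (inv_mem hw) hu' n
      by_cases h6 : unitVertex n ++ u' ∈ uncarried lineCell f
      · exact .inl (.inl (.inr ⟨_, h6, c1⟩))
      obtain ⟨v, c2⟩ := not_not.1 h6
      obtain ⟨m, v', rfl⟩ := c2.exists_unitVertex
      refine .inr ⟨_, ?_, c2.mul c1⟩
      have h7 : v' ∈ uncarried unitCell w := by
        rintro ⟨v'', c3⟩
        exact hu ⟨_, (((carries_lineCell_of_unitCell hw c3 m).mul (c2.mul c1)))⟩
      obtain ⟨s', hs', hsm⟩ := exists_unitVertex_eq m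
      refine ⟨(s', v'), ⟨⟨?_, hs'⟩, h7⟩, by simp [φ, hsm]⟩
      -- If the inverse of `f` carried `s'`, then `f` would carry a side vertex `s''` onto it. The
      -- box of `n` would lie below `s''`, on which the conjugate is a translation, and the given
      -- vertex would be carried after all.
      rintro ⟨s'', c4⟩
      have hs'' : s'' ∈ sideVertices := c4.mem_sideVertices hs'
      have c5 : Carries lineCell f s'' s' := Carries.inv_iff.1 c4
      have c6 := c5.append ([!s'.headD true] ++ v')
      rw [← List.append_assoc s' _ _] at c6
      change Carries lineCell f _ (boundedChild s' ++ v') at c6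
      rw [← hsm] at c6
      have h8 := c6.left_unique hc c2
      have h9 : s'' <+: unitVertex n := by
        rcases List.prefix_or_prefix_of_prefix (l₃ := unitVertex n ++ u') ⟨_, h8⟩ ⟨_, rfl⟩ with h | h
        · exact h
        · exact absurd h (not_unitVertex_prefix hs'')
      obtain ⟨x, hx⟩ := h9
      rw [← hx, List.append_assoc] at hu
      exact side s'' _ hs'' hu ⟨s', c5⟩
  have hfin' := (((((Set.finite_singleton ([] : List Bool)).union hA1).union h2).union h3.1).union h5)
  refine (Set.ncard_le_ncard hsub hfin').trans ?_
  refine (Set.ncard_union_le _ _).trans (add_le_add ?_ (h5'.trans h4.2))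
  refine (Set.ncard_union_le _ _).trans (add_le_add ?_ h3.2)
  refine (Set.ncard_union_le _ _).trans (add_le_add ?_ h2')
  refine (Set.ncard_union_le _ _).trans (add_le_add ?_ le_rfl)
  simp

/-! ## Estimates for word length -/

theorem exists_caret_bounds : ∃ κ : ℕ, 0 < κ ∧
    (∀ s, (s ∈ ({x0, x1} : Set (ℝ ≃o ℝ)) ∨ s⁻¹ ∈ ({x0, x1} : Set (ℝ ≃o ℝ))) →
      (uncarried lineCell s).ncard + (uncarried lineCell s⁻¹).ncard ≤ κ) ∧
    ∀ s, (s ∈ ({w0, w1} : Set (ℝ ≃o ℝ)) ∨ s⁻¹ ∈ ({w0, w1} : Set (ℝ ≃o ℝ))) →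
      (uncarried unitCell s).ncard + (uncarried unitCell s⁻¹).ncard + 1 ≤ κ := by
  obtain ⟨κ, hκ⟩ : ∃ κ, κ = (uncarried lineCell x0).ncard + (uncarried lineCell x0⁻¹).ncard +
    (uncarried lineCell x1).ncard + (uncarried lineCell x1⁻¹).ncard +
    (uncarried unitCell w0).ncard + (uncarried unitCell w0⁻¹).ncard +
    (uncarried unitCell w1).ncard + (uncarried unitCell w1⁻¹).ncard + 1 := ⟨_, rfl⟩
  refine ⟨κ, by omega, ?_, ?_⟩
  · rintro s ((rfl | rfl) | (h | h))
    · omega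
    · omega
    · rw [← inv_inv s, h, inv_inv]; omega
    · rw [← inv_inv s, h, inv_inv]; omega
  · rintro s ((rfl | rfl) | (h | h))
    · omega
    · omega
    · rw [← inv_inv s, h, inv_inv]; omega
    · rw [← inv_inv s, h, inv_inv]; omega

theorem mem_of_mem_or_inv_mem {G : Type*} [Group G] {S : Set G} {H : Subgroup G}
    (h : Subgroup.closure S = H) {s : G} (hs : s ∈ S ∨ s⁻¹ ∈ S) : s ∈ H := by
  rw [← h]
  rcases hs with hs | hs
  · exact Subgroup.subset_closure hs
  · exact inv_mem_iff.1 (Subgroup.subset_closure hs)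

theorem exists_ncard_le_mul_lenFx : ∃ κ : ℕ, 0 < κ ∧ ∀ f ∈ Fx,
    (uncarried lineCell f).ncard ≤ κ * lenFx f := by
  obtain ⟨κ, hκ, hx, -⟩ := exists_caret_bounds
  refine ⟨κ, hκ, fun f hf => ?_⟩
  rw [← closure_x] at hf
  refine wordLength_induction (p := fun g n => (uncarried lineCell g).ncard ≤ κ * n)
    (by simp [uncarried_one]) ?_ hf
  intro s g n hs hg hn
  rw [closure_x] at hg
  have h1 := uncarried_mul_ncard_le isCellSystem_lineCell
    (uncarried_lineCell_finite (mem_of_mem_or_inv_mem closure_x hs)) (uncarried_lineCell_finite hg)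
  have h2 := hx s hs
  rw [mul_add_one]
  omega

theorem generator_cases {s : ℝ ≃o ℝ} (hs : s ∈ ({x0, x1, w0, w1} : Set (ℝ ≃o ℝ)) ∨
      s⁻¹ ∈ ({x0, x1, w0, w1} : Set (ℝ ≃o ℝ))) :
    (s ∈ ({x0, x1} : Set (ℝ ≃o ℝ)) ∨ s⁻¹ ∈ ({x0, x1} : Set (ℝ ≃o ℝ))) ∨
      (s ∈ ({w0, w1} : Set (ℝ ≃o ℝ)) ∨ s⁻¹ ∈ ({w0, w1} : Set (ℝ ≃o ℝ))) := by
  simp only [Set.mem_insert_iff, Set.mem_singleton_iff] at *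
  tauto

theorem debris_mul_of_mem_Fx {s g : ℝ ≃o ℝ} (hs : s ∈ Fx) (hg : g ∈ C) :
    periodicPart (s * g) = periodicPart g ∧ debris (s * g) = s * debris g := by
  obtain ⟨h1, h2⟩ := periodicPart_debris_mem hg
  have h := periodicPart_debris_unique (mul_mem hs h2) h1
  rwa [mul_assoc, debris_mul_periodicPart] at h

/-- From $g=dp$ one gets $sg=(sds^{-1})(sp)$, and the factorization is unique. -/
theorem debris_mul_of_mem_Fw {s g : ℝ ≃o ℝ} (hs : s ∈ Fw) (hg : g ∈ C) :
    periodicPart (s * g) = s * periodicPart g ∧ debris (s * g) = s * debris g * s⁻¹ := by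
  obtain ⟨h1, h2⟩ := periodicPart_debris_mem hg
  have h := periodicPart_debris_unique (conj_mem_Fx h2 hs) (mul_mem hs h1)
  have e : s * debris g * s⁻¹ * (s * periodicPart g) = s * g := by
    rw [mul_assoc, inv_mul_cancel_left, mul_assoc, debris_mul_periodicPart]
  rwa [e] at h

theorem periodicPart_debris_one : periodicPart 1 = 1 ∧ debris 1 = 1 := by
  simpa using periodicPart_debris_unique (one_mem Fx) (one_mem Fw)

/-- The three estimates are proved together along a word. A letter of $F_x$ changes the side counts
and the caret count of the debris by a bounded amount; a letter of $F_w$ does not increase the side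
counts and adds to the carets at most a multiple of them. Linear side counts thus give a quadratic
caret count. -/
theorem exists_lenC_bounds : ∃ κ : ℕ, 0 < κ ∧ ∀ g ∈ C,
    (uncarried unitCell (periodicPart g)).ncard ≤ κ * lenC g ∧
    sideCount (debris g) + sideCount (debris g)⁻¹ ≤ κ * lenC g ∧
    (uncarried lineCell (debris g)).ncard ≤ (κ * lenC g) ^ 2 := by
  obtain ⟨κ, hκ, hx, hw⟩ := exists_caret_bounds
  refine ⟨κ, hκ, fun g hg => ?_⟩
  rw [← closure_C] at hg
  refine wordLength_induction (p := fun g n => (uncarried unitCell (periodicPart g)).ncard ≤ κ * n ∧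
    sideCount (debris g) + sideCount (debris g)⁻¹ ≤ κ * n ∧
    (uncarried lineCell (debris g)).ncard ≤ (κ * n) ^ 2) ?_ ?_ hg
  · simp [periodicPart_debris_one, uncarried_one, sideCount]
  intro s g n hs hg hn
  rw [closure_C] at hg
  obtain ⟨ha, hc, hb⟩ := hn
  obtain ⟨hp, hd⟩ := periodicPart_debris_mem hg
  rcases generator_cases hs with hs | hs
  · have hsx := mem_of_mem_or_inv_mem closure_x hs
    have h0 := hx s hs
    rw [(debris_mul_of_mem_Fx hsx hg).1, (debris_mul_of_mem_Fx hsx hg).2, mul_inv_rev]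
    have h1 := sideCount_mul_le hsx hd
    have h2 := sideCount_mul_le (inv_mem hd) (inv_mem hsx)
    have h3 := uncarried_mul_ncard_le isCellSystem_lineCell
      (uncarried_lineCell_finite hsx) (uncarried_lineCell_finite hd)
    have h4 := sideCount_le hsx
    have h5 := sideCount_le (inv_mem hsx)
    refine ⟨by rw [mul_add_one]; omega, by rw [mul_add_one]; omega, ?_⟩
    have h6 : (κ * (n + 1)) ^ 2 = (κ * n) ^ 2 + κ * (2 * κ * n) + κ * κ := by ring
    have h7 : κ ≤ κ * κ := Nat.le_mul_self κ
    rw [h6]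
    omega
  · have hsw := mem_of_mem_or_inv_mem closure_w hs
    have h0 := hw s hs
    rw [(debris_mul_of_mem_Fw hsw hg).1, (debris_mul_of_mem_Fw hsw hg).2]
    have e : (s * debris g * s⁻¹)⁻¹ = s * (debris g)⁻¹ * s⁻¹ := by group
    rw [e]
    have h1 := sideCount_conj_le hd hsw
    have h2 := sideCount_conj_le (inv_mem hd) hsw
    have h3 := uncarried_mul_ncard_le isCellSystem_unitCell
      (uncarried_unitCell_finite hsw) (uncarried_unitCell_finite hp)
    have h4 := uncarried_conj_ncard_le hd hsw
    refine ⟨by rw [mul_add_one]; omega, by rw [mul_add_one]; omega, h4.trans ?_⟩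
    generalize (uncarried unitCell s).ncard = J at *
    generalize (uncarried unitCell s⁻¹).ncard = J' at *
    generalize sideCount (debris g) = a at *
    generalize sideCount (debris g)⁻¹ = b at *
    -- Apart from the constant 1, this is the number of carets the conjugation can add. Being at
    -- most $\kappa^2n$, it fits below the increment $2\kappa^2n+\kappa^2$ of $(\kappa n)^2$.
    have h5 : a * (J' + 1) + b * J ≤ κ * (κ * n) :=
      calc a * (J' + 1) + b * J ≤ a * κ + b * κ := by gcongr <;> omega
        _ = κ * (a + b) := by ring
        _ ≤ κ * (κ * n) := by gcongr
    have h6 : (κ * (n + 1)) ^ 2 = (κ * n) ^ 2 + κ * (κ * n) + κ * (κ * n) + κ * κ := by ring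
    have h7 : 1 ≤ κ * κ := Nat.mul_pos hκ hκ
    rw [mul_add_one] at h5
    rw [h6]
    omega

/-- Passing to the periodic part deletes the letters of $F_x$ from a word and keeps those of $F_w$.
-/
theorem lenFw_periodicPart_le {g : ℝ ≃o ℝ} (hg : g ∈ C) : lenFw (periodicPart g) ≤ lenC g := by
  rw [← closure_C] at hg
  refine HasWord.wordLength_le ?_
  refine wordLength_induction (p := fun g n => HasWord {w0, w1} n (periodicPart g)) ?_ ?_ hg
  · rw [periodicPart_debris_one.1]
    exact .one 0
  intro s g n hs hg hn
  rw [closure_C] at hg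
  rcases generator_cases hs with hs | hs
  · rw [(debris_mul_of_mem_Fx (mem_of_mem_or_inv_mem closure_x hs) hg).1]
    exact hn.mono (Nat.le_succ n)
  · rw [(debris_mul_of_mem_Fw (mem_of_mem_or_inv_mem closure_w hs) hg).1, add_comm]
    refine HasWord.mul ?_ hn
    rcases hs with hs | hs
    · exact .of_mem hs
    · simpa using (HasWord.of_mem hs).inv

theorem carets_lineCell_eq {f : ℝ ≃o ℝ} (hf : f ∈ Fx) :
    carets lineCell f = (uncarried lineCell f).ncard :=
  carets_eq_ncard isCellSystem_lineCell (uncarried_lineCell_finite hf)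
    (uncarried_lineCell_finite (inv_mem hf))

theorem cNum_le {g : ℝ ≃o ℝ} (hg : g ∈ C) :
    cNum g ≤ sideCount (debris g) + sideCount (debris g)⁻¹ := by
  have hd := (periodicPart_debris_mem hg).2
  obtain ⟨h1, h2⟩ := inner_reducedDiagram isCellSystem_lineCell (uncarried_lineCell_finite hd)
    (uncarried_lineCell_finite (inv_mem hd))
  rw [cNum, sideCount, sideCount, ← h1, ← h2]
  exact add_le_add (sideCarets_le_ncard _) (sideCarets_le_ncard _)

theorem exists_aNum_bNum_cNum_le : ∃ K : ℝ, 0 < K ∧ ∀ g ∈ C,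
    (aNum g : ℝ) + √(bNum g : ℝ) + (cNum g : ℝ) ≤ K * (lenC g : ℝ) := by
  obtain ⟨κ, hκ, h⟩ := exists_lenC_bounds
  refine ⟨3 * κ, by positivity, fun g hg => ?_⟩
  obtain ⟨ha, hc, hb⟩ := h g hg
  obtain ⟨hp, hd⟩ := periodicPart_debris_mem hg
  have h1 : aNum g ≤ κ * lenC g := by
    rw [aNum, carets_eq_ncard isCellSystem_unitCell (uncarried_unitCell_finite hp)
      (uncarried_unitCell_finite (inv_mem hp))]
    exact ha
  have h2 : bNum g ≤ (κ * lenC g) ^ 2 := by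
    rw [bNum, carets_lineCell_eq hd]
    exact hb
  have h3 : cNum g ≤ κ * lenC g := (cNum_le hg).trans hc
  have h1' : (aNum g : ℝ) ≤ κ * lenC g := by exact_mod_cast h1
  have h2' : √(bNum g : ℝ) ≤ κ * lenC g := by
    refine Real.sqrt_le_iff.2 ⟨by positivity, ?_⟩
    exact_mod_cast h2
  have h3' : (cNum g : ℝ) ≤ κ * lenC g := by exact_mod_cast h3
  linarith

theorem exists_carets_le_sq : ∃ κ : ℕ, 0 < κ ∧ ∀ f ∈ Fx,
    (uncarried lineCell f).ncard ≤ κ * lenC f ^ 2 := by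
  obtain ⟨κ, hκ, h⟩ := exists_lenC_bounds
  refine ⟨κ ^ 2, by positivity, fun f hf => ?_⟩
  have h1 := (h f (Fx_le_C hf)).2.2
  have h2 := (periodicPart_debris_unique hf (one_mem Fw)).2
  rw [mul_one] at h2
  rwa [h2, mul_pow] at h1

theorem exists_lenFx_le_sq : ∃ κ : ℕ, 0 < κ ∧ ∀ f ∈ Fx, lenFx f ≤ κ * lenC f ^ 2 := by
  obtain ⟨κ, hκ, h⟩ := exists_carets_le_sq
  refine ⟨8 * κ, by positivity, fun f hf => (hasWord_of_mem_Fx hf).wordLength_le.trans ?_⟩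
  have := h f hf
  rw [mul_assoc]
  omega

theorem lenFw_le_lenC {w : ℝ ≃o ℝ} (hw : w ∈ Fw) : lenFw w ≤ lenC w := by
  have h1 := lenFw_periodicPart_le (Fw_le_C hw)
  have h2 := (periodicPart_debris_unique (one_mem Fx) hw).1
  rw [one_mul] at h2
  rwa [h2] at h1

/-! ## Elements of `F_x` with quadratically many carets -/

/-- The cell is $[2^{-i-1},2^{-i}]$. The map $w_0$ shifts these intervals towards $[\frac12,1]$ and
is affine on each, also once they have entered it, so every power is affine on all of them. -/
theorem exists_carries_w0_pow (n i : ℕ) :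
    ∃ v, Carries unitCell (w0 ^ n) (List.replicate i false ++ [true]) v := by
  have h := isGeneratorPair_w
  induction n generalizing i with
  | zero => exact ⟨_, .one _⟩
  | succ n ih =>
    rw [pow_succ]
    match i with
    | 0 =>
      obtain ⟨v, hv⟩ := ih 0
      exact ⟨_, (hv.append [true]).mul h.y0_t⟩
    | 1 =>
      obtain ⟨v, hv⟩ := ih 0
      exact ⟨_, (hv.append [false]).mul h.y0_ft⟩
    | i + 2 =>
      obtain ⟨v, hv⟩ := ih (i + 1)
      exact ⟨v, hv.mul (h.y0_ff.append (List.replicate i false ++ [true]))⟩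

theorem carries_x1_pow_tt (n : ℕ) : Carries lineCell (x1 ^ n) [true, true] (rightVertex (n + 1)) := by
  induction n with
  | zero => exact .one _
  | succ n ih =>
    rw [pow_succ, rightVertex_add (n + 1) 1]
    exact (ih.append [true]).mul isGeneratorPair_x.y1_tt

/-- The map $x_1$ moves $[2^{-i-1},2^{-i}]$ one place up until it is $[\frac12,1]$, which goes onto
the unit box $[1,2]$; from then on it is translated. -/
theorem exists_carries_x1_pow {n i : ℕ} (hi : i < n) : ∃ m, Carries lineCell (x1 ^ n)
    (unitVertex 0 ++ (List.replicate i false ++ [true])) (unitVertex m) := by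
  have h := isGeneratorPair_x
  induction n generalizing i with
  | zero => simp at hi
  | succ n ih =>
    rw [pow_succ]
    cases i with
    | zero => exact ⟨Int.ofNat (n + 1), ((carries_x1_pow_tt n).append [false]).mul h.y1_tft⟩
    | succ i =>
      obtain ⟨m, hm⟩ := ih (Nat.lt_of_succ_lt_succ hi)
      exact ⟨m, hm.mul (h.y1_tff.append (List.replicate i false ++ [true]))⟩

theorem Carries.apply_midpoint {cell : List Bool → Set ℝ} {f : ℝ ≃o ℝ} {u v : List Bool}
    {a b c d : ℝ} (h : Carries cell f u v) (hu : ∀ w, cell (u ++ w) = halvesCell a b w)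
    (hv : ∀ w, cell (v ++ w) = halvesCell c d w) (hab : a ≤ b) :
    f ((a + b) / 2) = (f a + f b) / 2 := by
  have h0 := h []
  have h1 := h [false]
  rw [hu, hv] at h0 h1
  simp only [halvesCell, OrderIso.image_Icc] at h0 h1
  have h2 := (Set.Icc_eq_Icc_iff (f.monotone hab)).1 h0
  have h3 := (Set.Icc_eq_Icc_iff (f.monotone (show a ≤ (a + b) / 2 by linarith))).1 h1
  rw [h3.2, h2.1, h2.2]

/-- The point $2^{-j-1}$ is doubled by $w_0$ until it reaches $\frac12$ after `j` steps; further
applications only move it up. -/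
theorem half_le_w0_pow (n j : ℕ) (hj : j ≤ n) : 1 / 2 ≤ (w0 ^ n) (1 / 2 ^ (j + 1)) := by
  induction n generalizing j with
  | zero =>
    obtain rfl : j = 0 := by omega
    rw [pow_zero]
    change (1 : ℝ) / 2 ≤ 1 / 2 ^ (0 + 1)
    norm_num
  | succ n ih =>
    rw [pow_succ]
    change _ ≤ (w0 ^ n) (w0 _)
    cases j with
    | zero =>
      have h1 : w0 (1 / 2 ^ (0 + 1)) = 3 / 4 := by
        rw [w0_apply 0 (by norm_num)]; norm_num [u0]
      rw [h1]
      refine (ih 0 (Nat.zero_le n)).trans ((w0 ^ n).monotone ?_)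
      norm_num
    | succ j =>
      have h2 : (1 : ℝ) ≤ 2 ^ j := one_le_pow₀ one_le_two
      have h3 : (1 : ℝ) / 2 ^ (j + 1 + 1) ≤ 1 / 4 := by
        rw [div_le_div_iff₀ (by positivity) (by norm_num), pow_succ, pow_succ]
        linarith
      have h4 : (0 : ℝ) < 1 / 2 ^ (j + 1 + 1) := by positivity
      have h1 : w0 (1 / 2 ^ (j + 1 + 1)) = 1 / 2 ^ (j + 1) := by
        rw [w0_apply 0 ⟨by push_cast; linarith, by push_cast; linarith⟩, u0, if_pos (by push_cast; linarith)]
        push_cast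
        field_simp
        ring
      rw [h1]
      exact ih j (by omega)

/-- If $[m,m+2^{-j}]$ were carried, its midpoint would go to the midpoint of the image. But relative
to `m` the image midpoint is less than $\frac12$, as the right end stays below 1, while
`half_le_w0_pow` puts the image of $2^{-j-1}$ at $\frac12$ or beyond. -/
theorem not_carries_w0_pow (n : ℕ) (m : ℤ) {j : ℕ} (hj : 1 ≤ j) (hjn : j ≤ n) :
    unitVertex m ++ List.replicate j false ∈ uncarried lineCell (w0 ^ n) := by
  rintro ⟨v, hv⟩
  have hw : w0 ^ n ∈ Fw := pow_mem w0_mem_Fw n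
  have hidx : ∀ j : ℕ, levelIndex (List.replicate j false) = 0 := by
    intro j
    induction j with
    | zero => rfl
    | succ j ih => rw [List.replicate_succ, levelIndex, ih]
  obtain ⟨m', v', rfl⟩ := hv.exists_unitVertex
  have h := hv.apply_midpoint (a := m) (b := m + 1 / 2 ^ j) (fun w => by
    rw [List.append_assoc, lineCell_unitVertex_append, halvesCell_append, hidx]
    simp) (fun w => by
    rw [List.append_assoc, lineCell_unitVertex_append, halvesCell_append]) (by
      have : (0 : ℝ) ≤ 1 / 2 ^ j := by positivity
      linarith)
  have e : ((m : ℝ) + (m + 1 / 2 ^ j)) / 2 = 1 / 2 ^ (j + 1) + m := by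
    field_simp; ring
  rw [e, add_comm (m : ℝ) (1 / 2 ^ j), Fw_apply_add_int hw, Fw_apply_add_int hw,
    Fw_apply_int hw] at h
  have h1 := half_le_w0_pow n j hjn
  have h2 : (w0 ^ n) (1 / 2 ^ j) < 1 := by
    have h3 : (w0 ^ n) 1 = 1 := by simpa using Fw_apply_int hw 1
    rw [← h3, OrderIso.lt_iff_lt, h3, div_lt_one (by positivity)]
    exact one_lt_pow₀ one_lt_two (by omega)
  linarith

theorem replicate_append_true_injective {i i' j j' : ℕ}
    (h : List.replicate i false ++ true :: List.replicate j false =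
      List.replicate i' false ++ true :: List.replicate j' false) : i = i' ∧ j = j' := by
  induction i generalizing i' with
  | zero =>
    cases i' with
    | zero => simpa using h
    | succ i' => simp [List.replicate_succ] at h
  | succ i ih =>
    cases i' with
    | zero => simp [List.replicate_succ] at h
    | succ i' =>
      simp only [List.replicate_succ, List.cons_append, List.cons.injEq, true_and] at h
      simpa using ih h

theorem rWord_mem_Fx (n : ℕ) : rWord n ∈ Fx :=
  conj_mem_Fx (pow_mem x1_mem_Fx n) (pow_mem w0_mem_Fw n)

theorem lenC_rWord_le (n : ℕ) : lenC (rWord n) ≤ 3 * n := by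
  have hw : HasWord ({x0, x1, w0, w1} : Set (ℝ ≃o ℝ)) 1 w0 := .of_mem (by simp)
  have hx : HasWord ({x0, x1, w0, w1} : Set (ℝ ≃o ℝ)) 1 x1 := .of_mem (by simp)
  refine HasWord.wordLength_le (HasWord.mono (((hw.pow n).mul (hx.pow n)).mul (hw.pow n).inv) ?_)
  omega

theorem sq_le_ncard_rWord (n : ℕ) : n ^ 2 ≤ (uncarried lineCell (rWord n)).ncard := by
  have hc := isCellSystem_lineCell
  have hw : w0 ^ n ∈ Fw := pow_mem w0_mem_Fw n
  have hex : ∀ i, ∃ v, Carries lineCell (w0 ^ n)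
      (unitVertex 0 ++ (List.replicate i false ++ [true])) v := by
    intro i
    obtain ⟨v, hv⟩ := exists_carries_w0_pow n i
    exact ⟨_, carries_lineCell_of_unitCell hw hv 0⟩
  choose v hv using hex
  have hcard : n ^ 2 = ((Finset.range n ×ˢ Finset.Icc 1 n).image
      fun p => v p.1 ++ List.replicate p.2 false).card := by
    rw [Finset.card_image_of_injective, Finset.card_product, Finset.card_range, Nat.card_Icc,
      Nat.add_sub_cancel, sq]
    -- Injectivity is read off after pulling back by $w_0^n$, where the vertices are visibly
    -- distinct.
    rintro ⟨i, j⟩ ⟨i', j'⟩ h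
    have h1 := (hv i).append (List.replicate j false)
    have h2 := (hv i').append (List.replicate j' false)
    change v i ++ _ = v i' ++ _ at h
    rw [h] at h1
    have h3 := h1.left_unique hc h2
    simp only [List.append_assoc, List.append_cancel_left_eq, List.cons_append,
      List.nil_append] at h3
    rw [Prod.mk.injEq]
    exact replicate_append_true_injective h3
  rw [hcard, ← Set.ncard_coe_finset]
  refine Set.ncard_le_ncard ?_ (uncarried_lineCell_finite (rWord_mem_Fx n))
  intro u hu
  simp only [Finset.coe_image, Set.mem_image, Finset.mem_coe, Finset.mem_product,
    Finset.mem_range, Finset.mem_Icc] at hu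
  obtain ⟨⟨i, j⟩, ⟨hi, hj, hjn⟩, rfl⟩ := hu
  rintro ⟨y, hy⟩
  -- The vertex is pulled back by $w_0^{-n}$ and sent by $x_1^n$ to $[m,m+2^{-j}]$; both steps are
  -- affine, so carrying it would force $w_0^n$ to carry $[m,m+2^{-j}]$.
  obtain ⟨m, hm⟩ := exists_carries_x1_pow hi
  have h1 := hy.mul ((hv i).append (List.replicate j false))
  have h2 := h1.mul (hm.append (List.replicate j false)).inv
  rw [rWord, inv_mul_cancel_right, mul_inv_cancel_right] at h2
  exact not_carries_w0_pow n m hj hjn ⟨y, h2⟩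

/-! ## Distortion -/

section Distortion

variable {G : Type*} [Group G] {H K : Subgroup G} {SH SG S₀ S₁ : Set G}

theorem distortion_le {n M : ℕ} (h : ∀ x ∈ H, wordLength SG x ≤ n → wordLength SH x ≤ M) :
    distortion H SH SG n ≤ M := by
  refine csSup_le' ?_
  rintro m ⟨x, hx, hn, rfl⟩
  exact h x hx hn

/-- The bound `M` is needed because the supremum of an unbounded set of naturals is 0 by convention.
-/
theorem le_distortion {n M : ℕ} (h : ∀ x ∈ H, wordLength SG x ≤ n → wordLength SH x ≤ M) {x : G}
    (hx : x ∈ H) (hn : wordLength SG x ≤ n) : wordLength SH x ≤ distortion H SH SG n := by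
  refine le_csSup ⟨M, ?_⟩ ⟨x, hx, hn, rfl⟩
  rintro m ⟨x, hx, hn, rfl⟩
  exact h x hx hn

/-- A polynomial bound for the length in a subgroup passes to all finite generating sets. -/
theorem exists_wordLength_le_pow (hHK : H ≤ K) (h0 : S₀.Finite) (h0' : Subgroup.closure S₀ = H)
    (h1' : Subgroup.closure S₁ = K) (hSG : SG.Finite)
    (hSH' : Subgroup.closure SH = H) (hSG' : Subgroup.closure SG = K) {p κ : ℕ}
    (h : ∀ x ∈ H, wordLength S₀ x ≤ κ * wordLength S₁ x ^ p) :
    ∃ A : ℕ, ∀ n : ℕ, ∀ x ∈ H, wordLength SG x ≤ n → wordLength SH x ≤ A * n ^ p := by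
  obtain ⟨a, -, ha⟩ := exists_wordLength_le_mul (S' := SH) h0
    (by rw [hSH', ← h0']; exact Subgroup.subset_closure)
  obtain ⟨b, -, hb⟩ := exists_wordLength_le_mul (S' := S₁) hSG
    (by rw [h1', ← hSG']; exact Subgroup.subset_closure)
  refine ⟨a * (κ * b ^ p), fun n x hx hn => ?_⟩
  calc wordLength SH x ≤ a * wordLength S₀ x := ha x (by rwa [h0'])
    _ ≤ a * (κ * wordLength S₁ x ^ p) := by gcongr; exact h x hx
    _ ≤ a * (κ * (b * wordLength SG x) ^ p) := by
      gcongr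
      exact hb x (by rw [hSG']; exact hHK hx)
    _ ≤ a * (κ * (b * n) ^ p) := by gcongr
    _ = a * (κ * b ^ p) * n ^ p := by ring

end Distortion

theorem isUndistorted_Fw : IsUndistorted Fw C := by
  refine ⟨Fw_le_C, (Subgroup.fg_iff _).2 ⟨_, closure_w, by simp⟩,
    (Subgroup.fg_iff _).2 ⟨_, closure_C, by simp⟩, fun SH SG hSH hSG hSH' hSG' => ?_⟩
  obtain ⟨A, hA⟩ := exists_wordLength_le_pow (p := 1) (κ := 1) Fw_le_C (by simp) closure_w closure_C
    hSG hSH' hSG' fun x hx => by rw [one_mul, pow_one]; exact lenFw_le_lenC hx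
  refine Asymptotics.IsBigO.of_bound A (Eventually.of_forall fun n => ?_)
  have h1 := distortion_le (hA n)
  rw [pow_one] at h1
  simp only [Real.norm_natCast]
  exact_mod_cast h1

theorem exists_sq_le_lenFx_rWord : ∃ κ : ℕ, 0 < κ ∧ ∀ n : ℕ, n ^ 2 ≤ κ * lenFx (rWord n) := by
  obtain ⟨κ, hκ, h⟩ := exists_ncard_le_mul_lenFx
  exact ⟨κ, hκ, fun n => (sq_le_ncard_rWord n).trans (h _ (rWord_mem_Fx n))⟩

theorem isQuadraticallyDistorted_Fx : IsQuadraticallyDistorted Fx C := by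
  refine ⟨Fx_le_C, (Subgroup.fg_iff _).2 ⟨_, closure_x, by simp⟩,
    (Subgroup.fg_iff _).2 ⟨_, closure_C, by simp⟩, fun SH SG hSH hSG hSH' hSG' => ⟨?_, ?_⟩⟩
  all_goals
    obtain ⟨κ, -, hκ⟩ := exists_lenFx_le_sq
    obtain ⟨A, hA⟩ := exists_wordLength_le_pow Fx_le_C (by simp) closure_x closure_C
      hSG hSH' hSG' hκ
  · refine Asymptotics.IsBigO.of_bound A (Eventually.of_forall fun n => ?_)
    have h1 := distortion_le (hA n)
    simp only [norm_pow, Real.norm_natCast]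
    exact_mod_cast h1
  · obtain ⟨q, -, hq⟩ := exists_sq_le_lenFx_rWord
    obtain ⟨a, -, ha⟩ := exists_wordLength_le_mul (S' := {x0, x1}) hSH
      (by rw [closure_x, ← hSH']; exact Subgroup.subset_closure)
    obtain ⟨b, hb0, hb⟩ := exists_wordLength_le_mul (S := {x0, x1, w0, w1}) (S' := SG) (by simp)
      (by rw [hSG', ← closure_C]; exact Subgroup.subset_closure)
    refine Asymptotics.IsBigO.of_bound ((6 * b) ^ 2 * (q * a) : ℕ) ?_
    filter_upwards [eventually_ge_atTop (3 * b)] with n hn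
    simp only [norm_pow, Real.norm_natCast]
    norm_cast
    -- The largest `m` for which the bound $3m$ on the length of $r_m$, multiplied by the cost `b`
    -- of changing generators, is at most `n`. As $m\ge1$, rounding loses at most a factor two,
    -- whence $n\le 6bm$.
    obtain ⟨m, hm⟩ : ∃ m, m = n / (3 * b) := ⟨_, rfl⟩
    have hm1 : 1 ≤ m := by
      rw [hm, Nat.le_div_iff_mul_le (by omega)]
      omega
    have hm2 : b * (3 * m) ≤ n := by
      have h1 := Nat.div_mul_le_self n (3 * b)
      rw [← hm] at h1
      calc b * (3 * m) = m * (3 * b) := by ring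
        _ ≤ n := h1
    have hm3 : n ≤ 6 * b * m := by
      have h1 := Nat.lt_mul_div_succ n (show 0 < 3 * b by omega)
      rw [← hm] at h1
      have h2 : 3 * b * (m + 1) ≤ 3 * b * (2 * m) := by gcongr; omega
      have h3 : 3 * b * (2 * m) = 6 * b * m := by ring
      omega
    have hr := rWord_mem_Fx m
    have h1 : wordLength SG (rWord m) ≤ n := by
      refine (hb _ (by rw [closure_C]; exact Fx_le_C hr)).trans (le_trans ?_ hm2)
      gcongr
      exact lenC_rWord_le m
    have h2 := le_distortion (hA n) hr h1
    calc n ^ 2 ≤ (6 * b * m) ^ 2 := by gcongr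
      _ = (6 * b) ^ 2 * m ^ 2 := by ring
      _ ≤ (6 * b) ^ 2 * (q * lenFx (rWord m)) := by gcongr; exact hq m
      _ ≤ (6 * b) ^ 2 * (q * (a * wordLength SH (rWord m))) := by
        gcongr
        exact ha _ (by rw [hSH']; exact hr)
      _ ≤ (6 * b) ^ 2 * (q * (a * distortion Fx SH SG n)) := by gcongr
      _ = (6 * b) ^ 2 * (q * a) * distortion Fx SH SG n := by ring

theorem exists_rWord_bounds : ∃ K : ℝ, 0 < K ∧ ∀ n : ℕ, rWord n ∈ Fx ∧ lenC (rWord n) ≤ 3 * n ∧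
    (n : ℝ) ^ 2 ≤ K * (carets lineCell (rWord n) : ℝ) ∧
    (carets lineCell (rWord n) : ℝ) ≤ K * (n : ℝ) ^ 2 ∧
    (n : ℝ) ^ 2 ≤ K * (lenFx (rWord n) : ℝ) := by
  obtain ⟨κ, hκ, h⟩ := exists_carets_le_sq
  obtain ⟨q, hq, h'⟩ := exists_sq_le_lenFx_rWord
  -- The 9 comes from squaring the length bound $3n$; `q` serves the lower bound for the length in
  -- $F_x$.
  refine ⟨(9 * κ + q : ℕ), by exact_mod_cast (by omega), fun n => ⟨rWord_mem_Fx n, lenC_rWord_le n, ?_⟩⟩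
  rw [carets_lineCell_eq (rWord_mem_Fx n)]
  have h1 := sq_le_ncard_rWord n
  have h2 := h _ (rWord_mem_Fx n)
  have h3 := h' n
  norm_cast
  refine ⟨h1.trans (Nat.le_mul_of_pos_left _ (by omega)), ?_, ?_⟩
  · calc (uncarried lineCell (rWord n)).ncard ≤ κ * lenC (rWord n) ^ 2 := h2
      _ ≤ κ * (3 * n) ^ 2 := by gcongr; exact lenC_rWord_le n
      _ = 9 * κ * n ^ 2 := by ring
      _ ≤ (9 * κ + q) * n ^ 2 := by gcongr; omega
  · refine h3.trans ?_
    gcongr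
    omega

end ThompsonAut

theorem mainTheorem1 :
    -- `C` is the internal semidirect product of `F_x` (normal) and `F_w`
    (ThompsonAut.Fx ⊔ ThompsonAut.Fw = ThompsonAut.C ∧
      ThompsonAut.Fx ⊓ ThompsonAut.Fw = ⊥ ∧
      (ThompsonAut.Fx.subgroupOf ThompsonAut.C).Normal) ∧
    -- the generating sets
    (Subgroup.closure {ThompsonAut.x0, ThompsonAut.x1} = ThompsonAut.Fx ∧
      Subgroup.closure {ThompsonAut.w0, ThompsonAut.w1} = ThompsonAut.Fw ∧
      Subgroup.closure {ThompsonAut.x0, ThompsonAut.x1, ThompsonAut.w0, ThompsonAut.w1} =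
        ThompsonAut.C) ∧
    -- reduced diagrams, periodic parts and debris are well defined
    ((∀ f ∈ ThompsonAut.Fx, ∃! p, ThompsonAut.IsReducedDiagram ThompsonAut.lineCell f p) ∧
      (∀ h ∈ ThompsonAut.Fw, ∃! p, ThompsonAut.IsReducedDiagram ThompsonAut.unitCell h p) ∧
      (∀ g ∈ ThompsonAut.C,
        ThompsonAut.periodicPart g ∈ ThompsonAut.Fw ∧ ThompsonAut.debris g ∈ ThompsonAut.Fx)) ∧
    -- the distortion of the two copies of `F`
    ThompsonAut.IsQuadraticallyDistorted ThompsonAut.Fx ThompsonAut.C ∧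
    ThompsonAut.IsUndistorted ThompsonAut.Fw ThompsonAut.C ∧
    -- the estimate for word length in `C`
    (∃ K : ℝ, 0 < K ∧ ∀ g ∈ ThompsonAut.C,
      (ThompsonAut.aNum g : ℝ) + √(ThompsonAut.bNum g : ℝ) + (ThompsonAut.cNum g : ℝ) ≤
        K * (ThompsonAut.lenC g : ℝ)) ∧
    -- the two upper bounds
    (∃ K : ℝ, 0 < K ∧ ∀ x ∈ ThompsonAut.Fx,
      (ThompsonAut.lenFx x : ℝ) ≤ K * (ThompsonAut.lenC x : ℝ) ^ 2) ∧
    (∃ K : ℝ, 0 < K ∧ ∀ w ∈ ThompsonAut.Fw,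
      (ThompsonAut.lenFw w : ℝ) ≤ K * (ThompsonAut.lenC w : ℝ)) ∧
    -- the words giving the lower bound
    (∃ K : ℝ, 0 < K ∧ ∀ n : ℕ,
      ThompsonAut.rWord n ∈ ThompsonAut.Fx ∧
      ThompsonAut.lenC (ThompsonAut.rWord n) ≤ 3 * n ∧
      (n : ℝ) ^ 2 ≤ K * (ThompsonAut.carets ThompsonAut.lineCell (ThompsonAut.rWord n) : ℝ) ∧
      (ThompsonAut.carets ThompsonAut.lineCell (ThompsonAut.rWord n) : ℝ) ≤ K * (n : ℝ) ^ 2 ∧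
      (n : ℝ) ^ 2 ≤ K * (ThompsonAut.lenFx (ThompsonAut.rWord n) : ℝ)) := by
  open ThompsonAut in
  refine ⟨⟨Fx_sup_Fw, Fx_inf_Fw, normal_Fx⟩, ⟨closure_x, closure_w, closure_C⟩,
    ⟨fun f hf => ?_, fun h hh => ?_, fun g hg => periodicPart_debris_mem hg⟩,
    isQuadraticallyDistorted_Fx, isUndistorted_Fw, exists_aNum_bNum_cNum_le, ?_, ?_,
    exists_rWord_bounds⟩
  · exact existsUnique_isReducedDiagram isCellSystem_lineCell (uncarried_lineCell_finite hf)
      (uncarried_lineCell_finite (inv_mem hf))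
  · exact existsUnique_isReducedDiagram isCellSystem_unitCell (uncarried_unitCell_finite hh)
      (uncarried_unitCell_finite (inv_mem hh))
  · obtain ⟨κ, hκ, h⟩ := exists_lenFx_le_sq
    exact ⟨κ, by exact_mod_cast hκ, fun x hx => by exact_mod_cast h x hx⟩
  · exact ⟨1, one_pos, fun w hw => by rw [one_mul]; exact_mod_cast lenFw_le_lenC hw⟩
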